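/- A \emph{partial field} is a set $P$ with elements $0,1$, a multiplication for which $P\setminus\{0\}$ is an abelian group with identity $1$ and $0p=p0=0$, and a partial addition such that: $p+0=p$; every $p$ has a unique $-p$ with $p+(-p)=0$; if $p+q$ is defined then so is $q+p$ and they are equal; for $p\neq0$, $p(q+r)$ is defined if and only if $pq+pr$ is, and then they are equal; and the following associative law holds. An \emph{association} of a finite nonempty multiset $S$ of elements of $P$ is a labelled binary tree whose leaves are labelled by the members of $S$ and in which the label of every other vertex is the (defined) sum of the labels of its two children; its value is the label of the root. The law says that if $S$ has an association with value $r$, and $S$ is split into two parts with associations of values $u$ and $w$, then $u+w$ is defined and equal to $r$. A sum $p_1+\dots+p_n$ is \emph{defined}, with value $r$, if for some $z_1,\dots,z_k\in P$ the multiset $\{p_1,\dots,p_n,z_1,-z_1,\dots,z_k,-z_k\}$ has an association with value $r$. The determinant of a square matrix over $P$ is \emph{defined} if the sum $\sum_\sigma \mathrm{sgn}(\sigma)\prod_i a_{i\sigma(i)}$ is. A finite matroid $M$ with ground set $E$ is \emph{representable over} $P$ if for some $r$ there is an $r\times E$ matrix $A$ over $P$ such that the determinants of all square submatrices of $A$ are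 defined, the largest size of a square submatrix with nonzero determinant is $r$, and the bases of $M$ are exactly the $r$-element sets $B\subseteq E$ for which the submatrix of $A$ with column set $B$ has nonzero determinant. Every field is a partial field. For partial fields $P_1,P_2$, the partial field $P_1\otimes P_2$ is the set of pairs $(p_1,p_2)\in P_1\times P_2$ with $p_1\ne 0$ if and only if $p_2\neq 0$, with componentwise multiplication, and with $(p_1,p_2)+(q_1,q_2)=(p_1+q_1,p_2+q_2)$, defined if and only if both sums are defined and they are both zero or both nonzero. Let $\tau$ be the positive root of $x^2-x-1=0$. The \emph{golden ratio partial field} $\mathbb{G}=\mathbb{P}(\mathbb{R},\tau)$ is the set $\{0\}\cup\{\pm\tau^k: k\in\mathbb{Z}\}$ with the multiplication of $\mathbb{R}$ and with the addition of $\mathbb{R}$ restricted to those pairs whose sum is in this set. \textbf{Theorem (Vertigan).} Let $M$ be a finite matroid. The following are equivalent: (i) $M$ is representable over $\mathrm{GF}(4)\otimes\mathrm{GF}(5)$; (ii) $M$ is representable over $\mathbb{G}$; (iii) $M$ is representable over $\mathrm{GF}(5)$, over $\mathrm{GF}(p^2)$ for all primes $p$, and over $\mathrm{GF}(p)$ for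 all primes $p$ with $p\equiv\pm1 \pmod 5$. -/

import Mathlib

universe u v w

/-- `Association add S r`: there is an association of the multiset `S` whose root is labelled `r`,
that is, a labelled binary tree whose leaves are labelled by the members of `S`, in which the label
of every other vertex is the (defined) partial sum of the labels of its two children. -/
inductive Association {P : Type u} (add : P → P → Part P) : Multiset P → P → Prop
  | leaf (p : P) : Association add {p} p
  | node {S T : Multiset P} {u w r : P} :
      Association add S u → Association add T w → r ∈ add u w → Association add (S + T) r

/-- Partial fields. `padd` is the partial addition: `r ∈ padd p q` says that `p + q` is defined
and equal to `r`. That `P \ {0}` is an abelian group is `CommGroupWithZero`. -/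
class PartialField (P : Type u) extends CommGroupWithZero P, Neg P where
  padd : P → P → Part P
  padd_zero : ∀ p : P, padd p 0 = Part.some p
  zero_mem_padd_neg : ∀ p : P, 0 ∈ padd p (-p)
  eq_neg_of_zero_mem_padd : ∀ p q : P, 0 ∈ padd p q → q = -p
  padd_comm : ∀ p q r : P, r ∈ padd p q → r ∈ padd q p
  /-- `p * (q + r)` is defined if and only if `p * q + p * r` is, and then they are equal. (For
  `p = 0` the second sum is always defined, so the equivalence is one about `p ≠ 0`.) -/
  mul_padd : ∀ p q r : P, p ≠ 0 → padd (p * q) (p * r) = (padd q r).map (fun s => p * s)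
  /-- The associative law: if `S + T` has an association with root label `r`, then every
  pre-association of `S + T`, whose root has children labelled `u` and `w`, is compatible
  with it. -/
  padd_assoc : ∀ (S T : Multiset P) (r u w : P), Association padd (S + T) r →
    Association padd S u → Association padd T w → r ∈ padd u w

namespace PartialField

section Matrices

variable {P : Type u} [PartialField P]

/-- The sum of the members of `S` is defined and equal to `r`: some multiset
`S ∪ {z₁, -z₁, …, zₖ, -zₖ}` has an association with root label `r`. -/
def SumsTo (S : Multiset P) (r : P) : Prop :=
  ∃ Z : Multiset P, Association padd (S + (Z + Z.map (fun z => -z))) r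

/-- The terms `sign(σ) * ∏ i, A i (σ i)` of the determinant. -/
def detTerms {n : Type v} [Fintype n] [DecidableEq n] (A : Matrix n n P) : Multiset P :=
  (Finset.univ : Finset (Equiv.Perm n)).val.map
    (fun σ => if Equiv.Perm.sign σ = 1 then ∏ i, A i (σ i) else -∏ i, A i (σ i))

/-- `det A` is defined and equal to `d`. -/
def HasDet {n : Type v} [Fintype n] [DecidableEq n] (A : Matrix n n P) (d : P) : Prop :=
  SumsTo (detTerms A) d

/-- Matrices over a partial field all of whose subdeterminants are defined. -/
def IsPMatrix {X : Type v} {Y : Type w} (A : Matrix X Y P) : Prop :=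
  ∀ (k : ℕ) (f : Fin k ↪ X) (g : Fin k ↪ Y), ∃ d : P, HasDet (A.submatrix f g) d

/-- The largest size of a square submatrix with nonzero determinant. -/
noncomputable def rank {X : Type v} {Y : Type w} (A : Matrix X Y P) : ℕ :=
  sSup {k : ℕ | ∃ (f : Fin k ↪ X) (g : Fin k ↪ Y) (d : P), HasDet (A.submatrix f g) d ∧ d ≠ 0}

/-- The sets `B` of `r` columns of an `r × E` matrix `A` such that `det A[r, B] ≠ 0`. -/
def bases {r : ℕ} {E : Type w} (A : Matrix (Fin r) E P) : Set (Set E) :=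
  {B | ∃ g : Fin r ↪ E, Set.range g = B ∧ ∃ d : P, HasDet (A.submatrix id g) d ∧ d ≠ 0}

/-- Two associations of the same multiset have the same root label. -/
theorem association_unique {S : Multiset P} {r s : P}
    (hr : Association padd S r) (hs : Association padd S s) : r = s := by
  have h0 : Association padd ({0} : Multiset P) (0 : P) := Association.leaf 0
  have h1 : Association padd (S + {0}) r :=
    Association.node hr h0 (by rw [padd_zero]; exact Part.mem_some r)
  have h2 := padd_assoc S {0} r s 0 h1 hs h0
  rw [padd_zero] at h2
  exact Part.mem_some_iff.1 h2

theorem association_zero (Z : Multiset P) :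
    Association padd (Z + Z.map (fun z => -z) + {0}) (0 : P) := by
  induction Z using Multiset.induction_on with
  | empty => simpa using Association.leaf (add := padd) (0 : P)
  | cons a Z ih =>
    have h1 : Association padd (({a} : Multiset P) + {-a}) (0 : P) :=
      Association.node (Association.leaf a) (Association.leaf (-a)) (zero_mem_padd_neg a)
    have h2 := Association.node h1 ih (r := 0) (by rw [padd_zero]; exact Part.mem_some 0)
    convert h2 using 1
    rw [Multiset.map_cons, ← Multiset.singleton_add, ← Multiset.singleton_add]
    abel

/-- The value of a defined sum does not depend on the choices. -/
theorem SumsTo.unique {S : Multiset P} {r s : P} (hr : SumsTo S r) (hs : SumsTo S s) : r = s := by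
  obtain ⟨Z, hZ⟩ := hr
  obtain ⟨W, hW⟩ := hs
  have h1 := Association.node hZ (association_zero W) (r := r)
    (by rw [padd_zero]; exact Part.mem_some r)
  have h2 := Association.node hW (association_zero Z) (r := s)
    (by rw [padd_zero]; exact Part.mem_some s)
  refine association_unique h1 ?_
  convert h2 using 1
  abel

end Matrices

/-- Every field is a partial field, with its total addition. -/
instance ofField (F : Type u) [Field F] : PartialField F where
  toCommGroupWithZero := inferInstance
  toNeg := inferInstance
  padd p q := Part.some (p + q)
  padd_zero p := by simp
  zero_mem_padd_neg p := by simp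
  eq_neg_of_zero_mem_padd p q h := by
    rw [Part.mem_some_iff] at h
    exact (neg_eq_of_add_eq_zero_right h.symm).symm
  padd_comm p q r h := by rwa [add_comm]
  mul_padd p q r _ := by simp [mul_add]
  padd_assoc S T r u w h hS hT := by
    have key : ∀ {S : Multiset F} {r : F},
        Association (fun p q : F => Part.some (p + q)) S r → r = S.sum := by
      intro S r h
      induction h with
      | leaf p => simp
      | node _ _ h3 ih1 ih2 => rw [Part.mem_some_iff] at h3; simp [h3, ih1, ih2]
    simp [key h, key hS, key hT]

section OfRing

/-- The set `⟨S ∪ {-1}⟩ ∪ {0}`. -/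
def carrier {R : Type u} [CommRing R] (S : Set Rˣ) : Set R :=
  {x | x = 0 ∨ ∃ u ∈ Subgroup.closure (S ∪ {-1}), (u : R) = x}

/-- The type underlying the partial field `ℙ(R, S)`. -/
def OfRing (R : Type u) [CommRing R] (S : Set Rˣ) : Type u :=
  {x : R // x ∈ carrier S}

/-- Addition in `ℙ(R, S)`: that of `R`, defined when the result is in `⟨S ∪ {-1}⟩ ∪ {0}`. -/
def OfRing.padd {R : Type u} [CommRing R] {S : Set Rˣ} (p q : OfRing R S) : Part (OfRing R S) where
  Dom := p.1 + q.1 ∈ carrier S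
  get h := ⟨p.1 + q.1, h⟩

theorem OfRing.mem_padd {R : Type u} [CommRing R] {S : Set Rˣ} {p q r : OfRing R S} :
    r ∈ OfRing.padd p q ↔ r.1 = p.1 + q.1 := by
  constructor
  · rintro ⟨_, rfl⟩
    rfl
  · intro h
    exact ⟨show p.1 + q.1 ∈ carrier S from h ▸ r.2, Subtype.ext h.symm⟩

theorem OfRing.association {R : Type u} [CommRing R] {S : Set Rˣ} {A : Multiset (OfRing R S)}
    {r : OfRing R S} (h : Association OfRing.padd A r) :
    r.1 = (A.map fun p => p.1).sum := by
  induction h with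
  | leaf p => rw [Multiset.map_singleton, Multiset.sum_singleton]
  | node _ _ h3 ih1 ih2 =>
    rw [OfRing.mem_padd.1 h3, ih1, ih2, Multiset.map_add, Multiset.sum_add]

variable {R : Type u} [CommRing R] [Nontrivial R] {S : Set Rˣ}

/-- `ℙ(R, S)`: multiplication and addition are the restrictions of those of `R`. -/
noncomputable instance : PartialField (OfRing R S) where
  mul p q := ⟨p.1 * q.1, by
    obtain ⟨x, rfl | ⟨u, hu, rfl⟩⟩ := p
    · exact Or.inl (zero_mul _)
    obtain ⟨y, rfl | ⟨v, hv, rfl⟩⟩ := q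
    · exact Or.inl (mul_zero _)
    exact Or.inr ⟨u * v, mul_mem hu hv, by simp⟩⟩
  one := ⟨1, Or.inr ⟨1, one_mem _, rfl⟩⟩
  zero := ⟨0, Or.inl rfl⟩
  inv p := ⟨Ring.inverse p.1, by
    obtain ⟨x, rfl | ⟨u, hu, rfl⟩⟩ := p
    · exact Or.inl (Ring.inverse_zero R)
    exact Or.inr ⟨u⁻¹, inv_mem hu, by simp⟩⟩
  neg p := ⟨-p.1, by
    obtain ⟨x, rfl | ⟨u, hu, rfl⟩⟩ := p
    · exact Or.inl neg_zero
    exact Or.inr ⟨-1 * u, mul_mem (Subgroup.subset_closure (Or.inr rfl)) hu, by simp⟩⟩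
  mul_assoc p q r := Subtype.ext (mul_assoc _ _ _)
  one_mul p := Subtype.ext (one_mul _)
  mul_one p := Subtype.ext (mul_one _)
  mul_comm p q := Subtype.ext (mul_comm _ _)
  zero_mul p := Subtype.ext (zero_mul _)
  mul_zero p := Subtype.ext (mul_zero _)
  exists_pair_ne := ⟨⟨0, Or.inl rfl⟩, ⟨1, Or.inr ⟨1, one_mem _, rfl⟩⟩,
    fun h => zero_ne_one (congrArg Subtype.val h)⟩
  inv_zero := Subtype.ext (Ring.inverse_zero R)
  mul_inv_cancel p hp := by
    obtain ⟨x, rfl | ⟨u, hu, rfl⟩⟩ := p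
    · exact absurd rfl hp
    exact Subtype.ext (Ring.mul_inverse_cancel _ u.isUnit)
  padd := OfRing.padd
  padd_zero p := Part.eq_some_iff.2 (OfRing.mem_padd.2 (add_zero p.1).symm)
  zero_mem_padd_neg p := OfRing.mem_padd.2 (add_neg_cancel p.1).symm
  eq_neg_of_zero_mem_padd p q h :=
    Subtype.ext (neg_eq_of_add_eq_zero_right (OfRing.mem_padd.1 h).symm).symm
  padd_comm p q r h := OfRing.mem_padd.2 ((OfRing.mem_padd.1 h).trans (add_comm _ _))
  mul_padd p q r hp := by
    obtain ⟨x, rfl | ⟨u, hu, rfl⟩⟩ := p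
    · exact absurd rfl hp
    refine Part.ext' ?_ (fun _ _ => Subtype.ext (mul_add _ _ _).symm)
    change (u : R) * q.1 + u * r.1 ∈ carrier S ↔ q.1 + r.1 ∈ carrier S
    rw [← mul_add]
    constructor
    · rintro (h | ⟨v, hv, h⟩)
      · exact Or.inl (u.mul_right_eq_zero.1 h)
      · exact Or.inr ⟨u⁻¹ * v, mul_mem (inv_mem hu) hv, by simp [h]⟩
    · rintro (h | ⟨v, hv, h⟩)
      · exact Or.inl (u.mul_right_eq_zero.2 h)
      · exact Or.inr ⟨u * v, mul_mem hu hv, by simp [h]⟩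
  padd_assoc A B r u w h hA hB := by
    rw [OfRing.mem_padd, OfRing.association h, OfRing.association hA, OfRing.association hB,
      Multiset.map_add, Multiset.sum_add]

end OfRing

section Product

/-- The set of pairs underlying the product `P₁ ⊗ P₂` of partial fields. -/
def Product (P₁ : Type u) (P₂ : Type v) [PartialField P₁] [PartialField P₂] : Type (max u v) :=
  {p : P₁ × P₂ // p.1 ≠ 0 ↔ p.2 ≠ 0}

variable {P₁ : Type u} {P₂ : Type v} [PartialField P₁] [PartialField P₂]

/-- Componentwise addition, defined when both sums are, and both are zero or both nonzero. -/
def Product.padd (p q : Product P₁ P₂) : Part (Product P₁ P₂) where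
  Dom := ∃ (h₁ : (PartialField.padd p.1.1 q.1.1).Dom) (h₂ : (PartialField.padd p.1.2 q.1.2).Dom),
    (PartialField.padd p.1.1 q.1.1).get h₁ ≠ 0 ↔ (PartialField.padd p.1.2 q.1.2).get h₂ ≠ 0
  get h := ⟨((PartialField.padd p.1.1 q.1.1).get h.1, (PartialField.padd p.1.2 q.1.2).get h.2.1),
    h.2.2⟩

theorem Product.mem_padd {p q r : Product P₁ P₂} : r ∈ Product.padd p q ↔
    r.1.1 ∈ PartialField.padd p.1.1 q.1.1 ∧ r.1.2 ∈ PartialField.padd p.1.2 q.1.2 := by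
  constructor
  · rintro ⟨⟨h1, h2, h3⟩, rfl⟩
    exact ⟨⟨h1, rfl⟩, ⟨h2, rfl⟩⟩
  · rintro ⟨⟨h1, e1⟩, ⟨h2, e2⟩⟩
    refine ⟨⟨h1, h2, ?_⟩, Subtype.ext (Prod.ext e1 e2)⟩
    rw [e1, e2]
    exact r.2

theorem Product.association {A : Multiset (Product P₁ P₂)} {r : Product P₁ P₂}
    (h : Association Product.padd A r) :
    Association PartialField.padd (A.map fun p => p.1.1) r.1.1 ∧
      Association PartialField.padd (A.map fun p => p.1.2) r.1.2 := by
  induction h with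
  | leaf p => simpa using ⟨Association.leaf _, Association.leaf _⟩
  | node _ _ h3 ih1 ih2 =>
    rw [Product.mem_padd] at h3
    simp only [Multiset.map_add]
    exact ⟨.node ih1.1 ih2.1 h3.1, .node ih1.2 ih2.2 h3.2⟩

theorem neg_ne_zero_iff {P : Type u} [PartialField P] (p : P) : -p ≠ 0 ↔ p ≠ 0 := by
  have h := zero_mem_padd_neg p
  refine not_congr ⟨fun e => ?_, fun e => ?_⟩
  · rw [e, padd_zero] at h
    exact (Part.mem_some_iff.1 h).symm
  · subst e
    have h' := padd_comm _ _ _ h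
    rw [padd_zero] at h'
    exact (Part.mem_some_iff.1 h').symm

/-- The product `P₁ ⊗ P₂`, with componentwise operations. -/
instance : PartialField (Product P₁ P₂) where
  mul p q := ⟨(p.1.1 * q.1.1, p.1.2 * q.1.2), by
    have := p.2; have := q.2; simp only [mul_ne_zero_iff]; tauto⟩
  one := ⟨(1, 1), by simp⟩
  zero := ⟨(0, 0), by simp⟩
  inv p := ⟨(p.1.1⁻¹, p.1.2⁻¹), by have := p.2; simpa using this⟩
  neg p := ⟨(-p.1.1, -p.1.2), by
    simp only [neg_ne_zero_iff]; exact p.2⟩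
  mul_assoc p q r := Subtype.ext (Prod.ext (mul_assoc _ _ _) (mul_assoc _ _ _))
  one_mul p := Subtype.ext (Prod.ext (one_mul _) (one_mul _))
  mul_one p := Subtype.ext (Prod.ext (mul_one _) (mul_one _))
  mul_comm p q := Subtype.ext (Prod.ext (mul_comm _ _) (mul_comm _ _))
  zero_mul p := Subtype.ext (Prod.ext (zero_mul _) (zero_mul _))
  mul_zero p := Subtype.ext (Prod.ext (mul_zero _) (mul_zero _))
  exists_pair_ne := ⟨⟨(0, 0), by simp⟩, ⟨(1, 1), by simp⟩,
    fun h => zero_ne_one (congrArg (fun p => p.1.1) h)⟩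
  inv_zero := Subtype.ext (Prod.ext inv_zero inv_zero)
  mul_inv_cancel p hp := by
    have h1 : p.1.1 ≠ 0 := fun h => hp (Subtype.ext (Prod.ext h (by
      by_contra h2; exact p.2.2 h2 h)))
    exact Subtype.ext (Prod.ext (mul_inv_cancel₀ h1) (mul_inv_cancel₀ (p.2.1 h1)))
  padd := Product.padd
  padd_zero p := by
    refine Part.eq_some_iff.2 (Product.mem_padd.2 ⟨?_, ?_⟩)
    · exact Part.eq_some_iff.1 (padd_zero p.1.1)
    · exact Part.eq_some_iff.1 (padd_zero p.1.2)
  zero_mem_padd_neg p := Product.mem_padd.2 ⟨zero_mem_padd_neg _, zero_mem_padd_neg _⟩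
  eq_neg_of_zero_mem_padd p q h := by
    have := Product.mem_padd.1 h
    exact Subtype.ext (Prod.ext (eq_neg_of_zero_mem_padd _ _ this.1)
      (eq_neg_of_zero_mem_padd _ _ this.2))
  padd_comm p q r h := by
    have := Product.mem_padd.1 h
    exact Product.mem_padd.2 ⟨padd_comm _ _ _ this.1, padd_comm _ _ _ this.2⟩
  mul_padd p q r hp := by
    have h1 : p.1.1 ≠ 0 := fun h => hp (Subtype.ext (Prod.ext h (by
      by_contra h2; exact p.2.2 h2 h)))
    have h2 := p.2.1 h1
    ext s
    rw [Part.mem_map_iff, Product.mem_padd]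
    change s.1.1 ∈ PartialField.padd (p.1.1 * q.1.1) (p.1.1 * r.1.1) ∧
      s.1.2 ∈ PartialField.padd (p.1.2 * q.1.2) (p.1.2 * r.1.2) ↔ _
    rw [mul_padd _ _ _ h1, mul_padd _ _ _ h2, Part.mem_map_iff, Part.mem_map_iff]
    constructor
    · rintro ⟨⟨a, ha, ea⟩, ⟨b, hb, eb⟩⟩
      have hs := s.2
      rw [← ea, ← eb, mul_ne_zero_iff, mul_ne_zero_iff] at hs
      exact ⟨⟨(a, b), by tauto⟩, Product.mem_padd.2 ⟨ha, hb⟩, Subtype.ext (Prod.ext ea eb)⟩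
    · rintro ⟨t, ht, rfl⟩
      have := Product.mem_padd.1 ht
      exact ⟨⟨_, this.1, rfl⟩, ⟨_, this.2, rfl⟩⟩
  padd_assoc A B r u w h hA hB := by
    have h' := Product.association h
    have hA' := Product.association hA
    have hB' := Product.association hB
    simp only [Multiset.map_add] at h'
    exact Product.mem_padd.2 ⟨padd_assoc _ _ _ _ _ h'.1 hA'.1 hB'.1,
      padd_assoc _ _ _ _ _ h'.2 hA'.2 hB'.2⟩

end Product

end PartialField

/-- The golden ratio partial field `𝔾 = ℙ(ℝ, {τ})`. -/
abbrev GoldenRatioPartialField : Type :=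
  PartialField.OfRing ℝ {Units.mk0 Real.goldenRatio Real.goldenRatio_ne_zero}

/-- `M` is representable over the partial field `P`: `M = M[A]` for some `r × E` matrix `A` over
`P`, of rank `r`, all of whose subdeterminants are defined. Here `E` is the ground set of `M`. -/
def Matroid.IsRepresentableOver {α : Type v} (M : Matroid α) (P : Type u) [PartialField P] : Prop :=
  ∃ (r : ℕ) (A : Matrix (Fin r) M.E P), PartialField.IsPMatrix A ∧ PartialField.rank A = r ∧
    ∀ B : Set M.E, M.IsBase ((↑) '' B : Set α) ↔ B ∈ PartialField.bases A

instance factPrimeFive : Fact (Nat.Prime 5) := ⟨by norm_num⟩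

/-! For (iii) ⇒ (i) only GF(4) and GF(5) matter. Representations in standard form with respect to
one common base have the same vanishing maximal minors, so they pair up to a matrix over the
product. For (ii) ⇒ (iii), `𝔾` consists of 0 and the units `±τ^k` of `ℤ[τ]`, and `ℤ[τ]` maps to
every field with a root of `x² = 1 + x`. All fields in (iii) have one.

The substance is (i) ⇒ (ii): lifting a representation along `φ : ℤ[τ] → GF(4) × GF(5)`, `τ ↦ (w,
3)`. A matrix is strong if all its subdeterminants lie in `H ∪ {0}` for a given group `H` of units.
Cross ratios of 2 × 2 submatrices of a strong matrix without zeros are fundamental elements: nonzero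
`f` with `f` and `1 - f` in `H ∪ {0}`. `IsLifting` asks that units and fundamental elements lift,
that a product of three fundamental elements is 1 if its image is, and that `f = -g` if this holds
for the images. For `φ` there are seven fundamental elements on either side, and these conditions
are finite checks.

Under these conditions every strong matrix lifts (`IsStrong.hasStrongLift`), by induction on the
number of rows and columns. A disconnected matrix splits into blocks. A connected one with three
nonzero entries in a line has, up to transposition, two columns `u`, `v` without which the rows stay
connected. The matrices without `u` and without `v` lift by induction. On the common columns the two
lifts differ by a scaling (`exists_scaling`), so they glue. In the glued matrix, pivoting reduces
every determinant to a 2 × 2 one on `u` and `v` (`IsGlued.isStrong`), and its cross ratio is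
controlled by pivoting along a chain of rows (`ratio_of_chain`). A connected matrix without such a
line acquires one after a pivot or is at most 2 × 2.

The passage from strong matrices to partial fields has to show that determinants are defined. This
uses the universal ring of `P`: a sum is defined in `P` as soon as its value in that ring comes from
`P` (`sumsTo_of_universal`). -/

set_option linter.unusedSectionVars false

/-! ### Elements that are zero or units of a given group -/

section UnitOrZero

variable {R : Type*} [CommRing R]

/-- `x` is zero or a unit that belongs to the subgroup `H`. -/
def UnitOrZero (H : Subgroup Rˣ) (x : R) : Prop :=
  x = 0 ∨ ∃ u ∈ H, (u : R) = x

namespace UnitOrZero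

variable {H : Subgroup Rˣ} {x y : R}

theorem zero : UnitOrZero H (0 : R) := Or.inl rfl

theorem one : UnitOrZero H (1 : R) := Or.inr ⟨1, one_mem _, rfl⟩

theorem of_mem {u : Rˣ} (hu : u ∈ H) : UnitOrZero H (u : R) := Or.inr ⟨u, hu, rfl⟩

theorem mul (hx : UnitOrZero H x) (hy : UnitOrZero H y) : UnitOrZero H (x * y) := by
  obtain rfl | ⟨u, hu, rfl⟩ := hx
  · simpa using zero
  obtain rfl | ⟨v, hv, rfl⟩ := hy
  · simpa using zero
  exact Or.inr ⟨u * v, mul_mem hu hv, by simp⟩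

theorem neg (hH : -1 ∈ H) (hx : UnitOrZero H x) : UnitOrZero H (-x) := by
  obtain rfl | ⟨u, hu, rfl⟩ := hx
  · simpa using zero
  exact Or.inr ⟨-1 * u, mul_mem hH hu, by simp⟩

theorem neg_one_pow (hH : -1 ∈ H) (n : ℕ) : UnitOrZero H ((-1 : R) ^ n) :=
  Or.inr ⟨(-1) ^ n, pow_mem hH n, by simp⟩

theorem sub_comm (hH : -1 ∈ H) (h : UnitOrZero H (x - y)) : UnitOrZero H (y - x) := by
  simpa using h.neg hH

theorem inverse (hx : UnitOrZero H x) : UnitOrZero H (Ring.inverse x) := by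
  obtain rfl | ⟨u, hu, rfl⟩ := hx
  · simpa using zero
  exact Or.inr ⟨u⁻¹, inv_mem hu, by simp⟩

theorem isUnit (hx : UnitOrZero H x) (h : x ≠ 0) : IsUnit x := by
  obtain rfl | ⟨u, -, rfl⟩ := hx
  · exact absurd rfl h
  exact u.isUnit

theorem mul_inverse (hx : UnitOrZero H x) (h : x ≠ 0) : x * Ring.inverse x = 1 :=
  Ring.mul_inverse_cancel _ (hx.isUnit h)

theorem inverse_ne_zero [Nontrivial R] (hx : UnitOrZero H x) (h : x ≠ 0) : Ring.inverse x ≠ 0 := by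
  intro h0
  have := hx.mul_inverse h
  rw [h0, mul_zero] at this
  exact zero_ne_one this

theorem mul_ne_zero (hx : UnitOrZero H x) (h : x ≠ 0) (h' : y ≠ 0) : x * y ≠ 0 := by
  intro h0
  exact h' ((hx.isUnit h).mul_right_eq_zero.1 h0)

theorem prod {ι : Type*} (s : Finset ι) (f : ι → R) (hf : ∀ i ∈ s, UnitOrZero H (f i)) :
    UnitOrZero H (∏ i ∈ s, f i) := by
  classical
  induction s using Finset.induction_on with
  | empty => simpa using one
  | insert a s ha ih =>
    rw [Finset.prod_insert ha]
    exact (hf a (Finset.mem_insert_self _ _)).mul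
      (ih fun i hi => hf i (Finset.mem_insert_of_mem hi))

end UnitOrZero

theorem map_ringInverse {R S : Type*} [CommRing R] [CommRing S] (φ : R →+* S) {x : R}
    (hx : IsUnit x) : φ (Ring.inverse x) = Ring.inverse (φ x) := by
  obtain ⟨u, rfl⟩ := hx
  have h : φ (u : R) = (Units.map (φ : R →* S) u : Sˣ) := rfl
  rw [Ring.inverse_unit, h, Ring.inverse_unit, ← map_inv]
  rfl

end UnitOrZero

/-! ### Pivoting and strong matrices -/

namespace Matrix

section Pivot

variable {R : Type*} [CommRing R] {X Y : Type*} [DecidableEq X] [DecidableEq Y]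

/-- The pivot of `D` over the entry `(x, y)`; the labels `x` and `y` are kept in place. -/
noncomputable def pivot (D : Matrix X Y R) (x : X) (y : Y) : Matrix X Y R := fun i j =>
  if i = x then
    if j = y then Ring.inverse (D x y) else Ring.inverse (D x y) * D x j
  else
    if j = y then -(D i y * Ring.inverse (D x y))
    else D i j - D i y * Ring.inverse (D x y) * D x j

variable (D : Matrix X Y R) {x i : X} {y j : Y}

@[simp] theorem pivot_self : pivot D x y x y = Ring.inverse (D x y) := by simp [pivot]

theorem pivot_row (h : j ≠ y) : pivot D x y x j = Ring.inverse (D x y) * D x j := by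
  simp [pivot, h]

theorem pivot_col (h : i ≠ x) : pivot D x y i y = -(D i y * Ring.inverse (D x y)) := by
  simp [pivot, h]

theorem pivot_of_ne (h : i ≠ x) (h' : j ≠ y) :
    pivot D x y i j = D i j - D i y * Ring.inverse (D x y) * D x j := by
  simp [pivot, h, h']

theorem pivot_of_row_eq_zero (h : i ≠ x) (h0 : D i y = 0) : pivot D x y i j = D i j := by
  by_cases hj : j = y
  · subst hj; rw [pivot_col _ h, h0]; simp
  · rw [pivot_of_ne _ h hj, h0]; simp

theorem pivot_of_col_eq_zero (h : j ≠ y) (h0 : D x j = 0) : pivot D x y i j = D i j := by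
  by_cases hi : i = x
  · subst hi; rw [pivot_row _ h, h0]; simp
  · rw [pivot_of_ne _ hi h, h0]; simp

theorem pivot_pivot (hu : IsUnit (D x y)) : pivot (pivot D x y) x y = D := by
  have h1 := Ring.mul_inverse_cancel _ hu
  have h2 : Ring.inverse (Ring.inverse (D x y)) = D x y := by
    obtain ⟨u, hu⟩ := hu
    rw [← hu, Ring.inverse_unit, Ring.inverse_unit, inv_inv]
  ext i j
  by_cases hi : i = x <;> by_cases hj : j = y
  · subst hi hj; simp [h2]
  · subst hi
    rw [pivot_row _ hj, pivot_self, pivot_row _ hj, h2]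
    linear_combination D i j * h1
  · subst hj
    rw [pivot_col _ hi, pivot_self, pivot_col _ hi, h2]
    linear_combination D i j * h1
  · rw [pivot_of_ne _ hi hj, pivot_self, pivot_col _ hi, pivot_row _ hj, pivot_of_ne _ hi hj, h2]
    linear_combination D i y * Ring.inverse (D x y) * D x j * h1

theorem pivot_map {S : Type*} [CommRing S] (φ : R →+* S) (hu : IsUnit (D x y)) :
    (pivot D x y).map φ = pivot (D.map φ) x y := by
  ext i j
  simp only [map_apply, pivot]
  split_ifs <;> simp [map_ringInverse φ hu]

theorem pivot_submatrix {X' Y' : Type*} [DecidableEq X'] [DecidableEq Y'] {f : X' → X}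
    {g : Y' → Y} (hf : Function.Injective f) (hg : Function.Injective g) (x : X') (y : Y') :
    pivot (D.submatrix f g) x y = (pivot D (f x) (g y)).submatrix f g := by
  ext i j
  simp [pivot, hf.eq_iff, hg.eq_iff]

/-- Subtracting multiples of row `i` clears the rest of column `j`. Laplace expansion then leaves
one minor, whose entries are those of the pivot away from its row and column. This is how pivoting
lowers the size of a determinant. -/
theorem det_submatrix_eq_det_pivot {k : ℕ} {f : Fin (k + 1) → X} {g : Fin (k + 1) → Y}
    (hf : Function.Injective f) (hg : Function.Injective g) (i j : Fin (k + 1))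
    (hu : IsUnit (D (f i) (g j))) :
    (D.submatrix f g).det = (-1) ^ (i + j : ℕ) * D (f i) (g j) *
      ((pivot D (f i) (g j)).submatrix (f ∘ i.succAbove) (g ∘ j.succAbove)).det := by
  have h1 := Ring.mul_inverse_cancel _ hu
  set a := Ring.inverse (D (f i) (g j)) with ha
  set c : Fin (k + 1) → R := fun l => if l = i then 0 else D (f l) (g j) * a with hc
  set B : Matrix (Fin (k + 1)) (Fin (k + 1)) R :=
    fun l m => D (f l) (g m) - c l * D (f i) (g m) with hB
  have hdet : (D.submatrix f g).det = B.det := by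
    refine det_eq_of_forall_row_eq_smul_add_const c i (by simp [hc]) fun l m => ?_
    simp [hB, hc]
  rw [hdet, det_succ_column B j, Finset.sum_eq_single i]
  · congr 1
    · simp [hB, hc]
    · congr 1
      ext l m
      simp only [submatrix_apply, Function.comp_apply]
      rw [pivot_of_ne _ (hf.ne (Fin.succAbove_ne i l)) (hg.ne (Fin.succAbove_ne j m))]
      simp [hB, hc, ha]
  · intro l _ hl
    have : B l j = 0 := by
      simp only [hB, hc, if_neg hl]
      linear_combination (-D (f l) (g j)) * h1
    simp [this]
  · simp

end Pivot

section Strong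

variable {R : Type*} [CommRing R] (H : Subgroup Rˣ) {X Y : Type*}

/-- All square submatrices of `D` have determinants in `H ∪ {0}`. -/
def IsStrong (D : Matrix X Y R) : Prop :=
  ∀ (k : ℕ) (f : Fin k → X) (g : Fin k → Y), UnitOrZero H (D.submatrix f g).det

variable {H}

namespace IsStrong

variable {D : Matrix X Y R}

theorem apply (h : D.IsStrong H) (x : X) (y : Y) : UnitOrZero H (D x y) := by
  simpa using h 1 (fun _ => x) (fun _ => y)

theorem det_two (h : D.IsStrong H) (x x' : X) (y y' : Y) :
    UnitOrZero H (D x y * D x' y' - D x y' * D x' y) := by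
  have := h 2 ![x, x'] ![y, y']
  rw [det_fin_two] at this
  simpa only [submatrix_apply, cons_val_zero, cons_val_one] using this

theorem submatrix {X' Y' : Type*} (h : D.IsStrong H) (f : X' → X) (g : Y' → Y) :
    (D.submatrix f g).IsStrong H := fun k f' g' => h k (f ∘ f') (g ∘ g')

theorem transpose (h : D.IsStrong H) : Dᵀ.IsStrong H := by
  intro k f g
  rw [← transpose_submatrix, det_transpose]
  exact h k g f

theorem scale (h : D.IsStrong H) {r : X → R} {c : Y → R} (hr : ∀ x, UnitOrZero H (r x))
    (hc : ∀ y, UnitOrZero H (c y)) : IsStrong H (of fun x y => r x * c y * D x y) := by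
  intro k f g
  have : ((of fun x y => r x * c y * D x y).submatrix f g) =
      of fun i j => r (f i) * (of (fun i j => c (g j) * D.submatrix f g i j)) i j := by
    ext i j
    simp [mul_assoc]
  rw [this, det_mul_column, det_mul_row]
  exact (UnitOrZero.prod _ _ fun _ _ => hr _).mul ((UnitOrZero.prod _ _ fun _ _ => hc _).mul
    (h k f g))

end IsStrong

/-- A repeated row or column makes the determinant vanish, so strongness can be stated for arbitrary
index maps and checked on injective ones. -/
theorem unitOrZero_det_of_injective {k : ℕ} (D : Matrix X Y R) (f : Fin k → X) (g : Fin k → Y)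
    (h : Function.Injective f → Function.Injective g → UnitOrZero H (D.submatrix f g).det) :
    UnitOrZero H (D.submatrix f g).det := by
  by_cases hf : Function.Injective f
  · by_cases hg : Function.Injective g
    · exact h hf hg
    · simp only [Function.Injective, not_forall] at hg
      obtain ⟨a, b, hab, hne⟩ := hg
      rw [det_zero_of_column_eq hne (by intro m; simp [hab])]
      exact .zero
  · simp only [Function.Injective, not_forall] at hf
    obtain ⟨a, b, hab, hne⟩ := hf
    rw [det_zero_of_row_eq hne (by ext m; simp [hab])]
    exact .zero

/-- If `D` is strong then so is `[I | D]`. -/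
theorem IsStrong.fromCols_one [DecidableEq X] (hH : -1 ∈ H) {D : Matrix X Y R} (h : D.IsStrong H) :
    (fromCols (1 : Matrix X X R) D).IsStrong H := by
  intro k
  induction k with
  | zero => intro f g; simpa using UnitOrZero.one
  | succ k ih =>
    intro f g
    refine unitOrZero_det_of_injective _ f g fun hf _ => ?_
    by_cases hg : ∃ j x, g j = Sum.inl x
    · obtain ⟨j, x, hj⟩ := hg
      by_cases hx : ∃ i, f i = x
      · obtain ⟨i, rfl⟩ := hx
        rw [det_succ_column _ j, Finset.sum_eq_single i]
        · refine ((UnitOrZero.neg_one_pow hH _).mul ?_).mul ?_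
          · simpa [hj] using UnitOrZero.one
          · rw [submatrix_submatrix]
            exact ih _ _
        · intro l _ hl
          simp [hj, hf.ne hl]
        · simp
      · push Not at hx
        rw [det_eq_zero_of_column_eq_zero j (by intro i; simp [hj, hx i])]
        exact .zero
    · push Not at hg
      have : ∀ j, ∃ y, g j = Sum.inr y := fun j => by
        rcases hgj : g j with x | y
        · exact absurd hgj (hg j x)
        · exact ⟨y, rfl⟩
      choose g' hg' using this
      convert h (k + 1) f g' using 2
      ext i j
      simp [hg']

theorem IsStrong.det_fromCols_one [DecidableEq X] [Fintype X] (hH : -1 ∈ H) {D : Matrix X Y R} (h : D.IsStrong H)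
    (g : X → X ⊕ Y) : UnitOrZero H ((fromCols (1 : Matrix X X R) D).submatrix id g).det := by
  have e := (Fintype.equivFin X).symm
  rw [← det_submatrix_equiv_self e, submatrix_submatrix]
  exact h.fromCols_one hH _ _ _

variable [DecidableEq X] [DecidableEq Y]

/-- A class of matrices that is closed under pivoting and whose members have all their entries in
`H ∪ {0}` consists of strong matrices. -/
theorem isStrong_of_pivot_closed (hH : -1 ∈ H) (C : Set (Matrix X Y R))
    (h1 : ∀ D ∈ C, ∀ x y, UnitOrZero H (D x y))
    (h2 : ∀ D ∈ C, ∀ x y, D x y ≠ 0 → pivot D x y ∈ C) {D : Matrix X Y R} (hD : D ∈ C) :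
    D.IsStrong H := by
  intro k
  induction k generalizing D with
  | zero => intro f g; simpa using UnitOrZero.one
  | succ k ih =>
    intro f g
    refine unitOrZero_det_of_injective D f g fun hf hg => ?_
    by_cases h0 : ∀ i, D (f i) (g 0) = 0
    · rw [det_eq_zero_of_column_eq_zero 0 (by simpa using h0)]
      exact .zero
    push Not at h0
    obtain ⟨i, hi⟩ := h0
    rw [det_submatrix_eq_det_pivot D hf hg i 0 ((h1 D hD _ _).isUnit hi)]
    exact ((UnitOrZero.neg_one_pow hH _).mul (h1 D hD _ _)).mul (ih (h2 D hD _ _ hi) _ _)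

variable [Fintype X]

theorem det_one_updateCol (x : X) (b : X → R) : ((1 : Matrix X X R).updateCol x b).det = b x := by
  rw [← cramer_apply, cramer_one]
  rfl

/-- A pivot is a change of basis: it replaces the basis column `x` of `[I | D]` by the column `y`.
The transition matrix has determinant `D x y`, so maximal minors change by this unit only. -/
theorem updateCol_one_mul_fromCols_pivot (D : Matrix X Y R) {x : X} {y : Y}
    (hu : IsUnit (D x y)) :
    (1 : Matrix X X R).updateCol x (fun i => D i y) * fromCols (1 : Matrix X X R) (pivot D x y) =
      (fromCols (1 : Matrix X X R) D).submatrix id (Equiv.swap (Sum.inl x) (Sum.inr y)) := by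
  have h1 := Ring.mul_inverse_cancel _ hu
  have key : ∀ {n : Type _} (M : Matrix X n R) (i : X) (c : n),
      ((1 : Matrix X X R).updateCol x (fun i => D i y) * M) i c =
        D i y * M x c + if i = x then 0 else M i c := by
    intro n M i c
    rw [mul_apply]
    have : ∀ l, ((1 : Matrix X X R).updateCol x (fun i => D i y)) i l * M l c =
        (if l = x then D i y * M x c else 0) +
          (if l = i then if i = x then 0 else M i c else 0) := by
      intro l
      rw [updateCol_apply, one_apply]
      by_cases hl : l = x
      · subst hl
        by_cases hi : l = i <;> simp [hi]
      · by_cases hi : l = i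
        · subst hi; simp [hl]
        · simp [hl, hi, Ne.symm hi]
    simp [this, Finset.sum_add_distrib]
  ext i c
  rw [key]
  rcases c with j | j
  · by_cases hj : j = x
    · subst hj
      simp +contextual [one_apply]
    · have h2 : (Sum.inl j : X ⊕ Y) ≠ Sum.inl x := by simpa using hj
      rw [submatrix_apply, Equiv.swap_apply_of_ne_of_ne h2 (by simp)]
      by_cases hi : i = x
      · subst hi; simp [Ne.symm hj]
      · simp [one_apply, Ne.symm hj, hi]
  · by_cases hj : j = y
    · subst hj
      rw [submatrix_apply, Equiv.swap_apply_right]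
      by_cases hi : i = x
      · subst hi; simp [h1]
      · simp [hi, pivot_col]
    · have h2 : (Sum.inr j : X ⊕ Y) ≠ Sum.inr y := by simpa using hj
      rw [submatrix_apply, Equiv.swap_apply_of_ne_of_ne (by simp) h2]
      by_cases hi : i = x
      · subst hi
        simp only [fromCols_apply_inr, if_true, pivot_row _ hj, id]
        linear_combination D i j * h1
      · simp only [fromCols_apply_inr, if_neg hi, pivot_row _ hj, pivot_of_ne _ hi hj, id]
        ring

theorem unitOrZero_det_fromCols_pivot {D : Matrix X Y R} {x : X} {y : Y} (hxy : D x y ≠ 0)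
    (hD : UnitOrZero H (D x y)) (g : X → X ⊕ Y)
    (h1 : UnitOrZero H ((fromCols (1 : Matrix X X R) D).submatrix id
      (Equiv.swap (Sum.inl x) (Sum.inr y) ∘ g)).det) :
    UnitOrZero H ((fromCols (1 : Matrix X X R) (pivot D x y)).submatrix id g).det := by
  have h2 := congrArg (fun M => (M.submatrix id g).det)
    (updateCol_one_mul_fromCols_pivot D (hD.isUnit hxy))
  simp only [submatrix_submatrix, Function.id_comp] at h2
  rw [← submatrix_mul_equiv _ _ _ (Equiv.refl X), det_mul] at h2
  simp only [Equiv.coe_refl, submatrix_id_id, det_one_updateCol] at h2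
  rw [← h2] at h1
  have h3 := hD.mul_inverse hxy
  convert hD.inverse.mul h1 using 1
  linear_combination (-(det ((fromCols (1 : Matrix X X R) (pivot D x y)).submatrix id g))) * h3

/-- `D` is strong as soon as the maximal minors of `[I | D]` are in `H ∪ {0}`. -/
theorem isStrong_of_det_fromCols_one (hH : -1 ∈ H) {D : Matrix X Y R}
    (h : ∀ g : X → X ⊕ Y, UnitOrZero H ((fromCols (1 : Matrix X X R) D).submatrix id g).det) :
    D.IsStrong H := by
  have hent : ∀ D : Matrix X Y R, (∀ g : X → X ⊕ Y,
      UnitOrZero H ((fromCols (1 : Matrix X X R) D).submatrix id g).det) →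
      ∀ x y, UnitOrZero H (D x y) := by
    intro D h x y
    -- An entry of `D` is a maximal minor of `[I | D]`: exchange the identity column `x` for the
    -- column `y`.
    have h1 := h (Function.update Sum.inl x (Sum.inr y))
    convert h1 using 1
    rw [← det_one_updateCol x fun i => D i y]
    congr 1
    ext i j
    by_cases hj : j = x
    · subst hj; simp
    · simp [hj]
  -- The condition on maximal minors survives pivoting, and it bounds the entries; that is all the
  -- induction on the size of a determinant needs.
  refine isStrong_of_pivot_closed hH {D | ∀ g : X → X ⊕ Y,
      UnitOrZero H ((fromCols (1 : Matrix X X R) D).submatrix id g).det} hent ?_ h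
  intro D hD x y hxy g
  exact unitOrZero_det_fromCols_pivot hxy (hent D hD x y) g (hD _)

/-- Subdeterminants of a pivot are awkward to follow, but maximal minors of `[I | D]` are merely
permuted and multiplied by a unit; they determine strongness. -/
theorem IsStrong.pivot (hH : -1 ∈ H) {D : Matrix X Y R} (h : D.IsStrong H) {x : X} {y : Y}
    (hxy : D x y ≠ 0) : (pivot D x y).IsStrong H := by
  refine isStrong_of_det_fromCols_one hH fun g => ?_
  exact unitOrZero_det_fromCols_pivot hxy (h.apply x y) g (h.det_fromCols_one hH _)

end Strong

end Matrix

/-! ### Fundamental elements, cross ratios and lifting homomorphisms -/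

section Fundamental

variable {R : Type*} [CommRing R]

/-- Nonzero elements `f` of `H ∪ {0}` for which `1 - f` is in `H ∪ {0}`. -/
structure IsFundamental (H : Subgroup Rˣ) (f : R) : Prop where
  unitOrZero : UnitOrZero H f
  ne_zero : f ≠ 0
  one_sub : UnitOrZero H (1 - f)

/-- The cross ratio `a * d / (b * c)` is fundamental. -/
def HasFundamentalRatio (H : Subgroup Rˣ) (a b c d : R) : Prop :=
  ∃ f, IsFundamental H f ∧ f * (b * c) = a * d

variable {H : Subgroup Rˣ}

theorem IsFundamental.one [Nontrivial R] : IsFundamental H (1 : R) :=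
  ⟨.one, one_ne_zero, by simpa using UnitOrZero.zero⟩

theorem IsFundamental.inverse [Nontrivial R] (hH : -1 ∈ H) {f : R} (h : IsFundamental H f) :
    IsFundamental H (Ring.inverse f) := by
  refine ⟨h.1.inverse, h.1.inverse_ne_zero h.2, ?_⟩
  have h1 := h.1.mul_inverse h.2
  convert (h.3.mul h.1.inverse).neg hH using 1
  linear_combination -h1

theorem IsFundamental.one_sub' {f : R} (h : IsFundamental H f) (hf : f ≠ 1) :
    IsFundamental H (1 - f) :=
  ⟨h.3, sub_ne_zero.2 hf.symm, by simpa using h.1⟩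

namespace HasFundamentalRatio

variable {a b c d : R}

theorem swap_cols [Nontrivial R] (hH : -1 ∈ H) (h : HasFundamentalRatio H a b c d) :
    HasFundamentalRatio H b a d c := by
  obtain ⟨f, hf, h⟩ := h
  refine ⟨_, hf.inverse hH, ?_⟩
  have h1 := hf.1.mul_inverse hf.2
  linear_combination b * c * h1 - Ring.inverse f * h

theorem det (h : HasFundamentalRatio H a b c d) (hH : -1 ∈ H) (hb : UnitOrZero H b)
    (hc : UnitOrZero H c) : UnitOrZero H (a * d - b * c) := by
  obtain ⟨f, hf, h⟩ := h
  convert (hf.3.mul (hb.mul hc)).neg hH using 1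
  linear_combination -h

end HasFundamentalRatio

theorem hasFundamentalRatio_of_det [Nontrivial R] (hH : -1 ∈ H) {a b c d : R}
    (ha : UnitOrZero H a) (hb : UnitOrZero H b) (hc : UnitOrZero H c) (hd : UnitOrZero H d)
    (ha' : a ≠ 0) (hb' : b ≠ 0) (hc' : c ≠ 0) (hd' : d ≠ 0) (h : UnitOrZero H (a * d - b * c)) :
    HasFundamentalRatio H a b c d := by
  have h1 := hb.mul_inverse hb'
  have h2 := hc.mul_inverse hc'
  refine ⟨a * d * (Ring.inverse b * Ring.inverse c), ⟨(ha.mul hd).mul (hb.inverse.mul hc.inverse),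
    (ha.mul hd).mul_ne_zero (ha.mul_ne_zero ha' hd')
      (hb.inverse.mul_ne_zero (hb.inverse_ne_zero hb') (hc.inverse_ne_zero hc')), ?_⟩, ?_⟩
  · convert (h.mul (hb.inverse.mul hc.inverse)).neg hH using 1
    linear_combination -(c * Ring.inverse c) * h1 - h2
  · linear_combination a * d * (c * Ring.inverse c) * h1 + a * d * h2

theorem Matrix.IsStrong.hasFundamentalRatio [Nontrivial R] (hH : -1 ∈ H) {X Y : Type*}
    {D : Matrix X Y R} (hD : D.IsStrong H) {x x' : X} {y y' : Y} (h1 : D x y ≠ 0)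
    (h2 : D x y' ≠ 0) (h3 : D x' y ≠ 0) (h4 : D x' y' ≠ 0) :
    HasFundamentalRatio H (D x y) (D x y') (D x' y) (D x' y') :=
  hasFundamentalRatio_of_det hH (hD.apply _ _) (hD.apply _ _) (hD.apply _ _) (hD.apply _ _)
    h1 h2 h3 h4 (hD.det_two _ _ _ _)

end Fundamental

/-- The properties of a ring homomorphism that allow strong matrices to be lifted along it. -/
structure IsLifting {S R : Type*} [CommRing S] [CommRing R] (φ : S →+* R) (K : Subgroup Sˣ)
    (H : Subgroup Rˣ) : Prop where
  neg_one_mem : -1 ∈ K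
  neg_one_mem' : -1 ∈ H
  surj : ∀ u ∈ H, ∃ v ∈ K, φ (v : S) = u
  exists_fundamental : ∀ f, IsFundamental H f → ∃ g, IsFundamental K g ∧ φ g = f
  eq_one : ∀ f g h, IsFundamental K f → IsFundamental K g → IsFundamental K h →
    φ (f * g * h) = 1 → f * g * h = 1
  eq_neg : ∀ f g, IsFundamental K f → IsFundamental K g → φ f = -φ g → f = -g

namespace IsLifting

variable {S R : Type*} [CommRing S] [CommRing R] [Nontrivial S] [Nontrivial R] {φ : S →+* R}
  {K : Subgroup Sˣ} {H : Subgroup Rˣ}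

theorem _root_.UnitOrZero.map_eq_zero {x : S} (hx : UnitOrZero K x) : φ x = 0 ↔ x = 0 := by
  refine ⟨fun h => ?_, fun h => by rw [h, map_zero]⟩
  by_contra h0
  exact ((hx.isUnit h0).map φ).ne_zero h

theorem injOn (L : IsLifting φ K H) {f g : S} (hf : IsFundamental K f) (hg : IsFundamental K g)
    (h : φ f = φ g) : f = g := by
  have h1 := hg.1.mul_inverse hg.2
  have h2 := L.eq_one f (Ring.inverse g) 1 hf (hg.inverse L.neg_one_mem) .one (by
    rw [mul_one, map_mul, h, ← map_mul, h1, map_one])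
  linear_combination g * h2 - f * h1

/-- If `e` is a fundamental lift of `φ (f * g)`, then `f * g * e⁻¹` is a product of three
fundamental elements with image 1, hence equal to 1. This is the main use of `eq_one`. -/
theorem fundamental_mul (L : IsLifting φ K H) {f g : S} (hf : IsFundamental K f)
    (hg : IsFundamental K g) (h : IsFundamental H (φ (f * g))) : IsFundamental K (f * g) := by
  obtain ⟨e, he, h⟩ := L.exists_fundamental _ h
  have h1 := he.1.mul_inverse he.2
  have h2 := L.eq_one f g (Ring.inverse e) hf hg (he.inverse L.neg_one_mem) (by
    rw [map_mul, ← h, ← map_mul, h1, map_one])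
  convert he using 1
  linear_combination e * h2 - f * g * h1

/-- If a product of two fundamental elements is a ratio whose image is fundamental, then that ratio
is fundamental. -/
theorem ratio_of_mul (L : IsLifting φ K H) {a b c d f g : S} (hf : IsFundamental K f)
    (hg : IsFundamental K g) (hb : UnitOrZero K b) (hc : UnitOrZero K c) (hb' : b ≠ 0)
    (hc' : c ≠ 0) (h : f * g * (b * c) = a * d)
    (h' : HasFundamentalRatio H (φ a) (φ b) (φ c) (φ d)) : HasFundamentalRatio K a b c d := by
  obtain ⟨e, he, h'⟩ := h'
  have hu := ((hb.mul hc).isUnit (hb.mul_ne_zero hb' hc')).map φ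
  rw [← map_mul, ← map_mul φ a, ← h, map_mul φ (f * g), hu.mul_left_inj] at h'
  exact ⟨f * g, L.fundamental_mul hf hg (h' ▸ he), h⟩

/-- Corresponding ratios with the same image agree. -/
theorem ratio_unique (L : IsLifting φ K H) {a b c d a' b' c' d' : S}
    (h : HasFundamentalRatio K a b c d) (h' : HasFundamentalRatio K a' b' c' d')
    (hb : UnitOrZero K b) (hc : UnitOrZero K c) (hb' : b ≠ 0) (hc' : c ≠ 0)
    (ea : φ a = φ a') (eb : φ b = φ b') (ec : φ c = φ c') (ed : φ d = φ d') :
    a * d * (b' * c') = a' * d' * (b * c) := by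
  obtain ⟨f, hf, h⟩ := h
  obtain ⟨f', hf', h'⟩ := h'
  have hu := ((hb.mul hc).isUnit (hb.mul_ne_zero hb' hc')).map φ
  have : f = f' := by
    refine L.injOn hf hf' (hu.mul_left_inj.1 ?_)
    rw [← map_mul, h, map_mul φ b c, eb, ec, ← map_mul φ b', ← map_mul, h', map_mul, map_mul, ea, ed]
  rw [← h, ← h', this]
  ring

end IsLifting

/-! ### Uniqueness of lifts along chains of rows -/

namespace Matrix

section Chain

variable {R : Type*} [CommRing R] {X Y : Type*}

/-- A chain of `n + 1` rows in which consecutive ones have a common nonzero column in `T`. -/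
inductive Chain (D : Matrix X Y R) (T : Set Y) : ℕ → X → X → Prop
  | nil (x : X) : Chain D T 0 x x
  | cons {n : ℕ} {x x₁ x' : X} {y : Y} :
      y ∈ T → D x y ≠ 0 → D x₁ y ≠ 0 → Chain D T n x₁ x' → Chain D T (n + 1) x x'

namespace Chain

variable {D : Matrix X Y R} {T : Set Y}

theorem trans {m n : ℕ} {a b c : X} (h : Chain D T m a b) (h' : Chain D T n b c) :
    Chain D T (m + n) a c := by
  induction h with
  | nil => rwa [Nat.zero_add]
  | cons hy h1 h2 _ ih => rw [Nat.add_right_comm]; exact .cons hy h1 h2 (ih h')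

theorem symm {m : ℕ} {a b : X} (h : Chain D T m a b) : Chain D T m b a := by
  induction h with
  | nil => exact .nil _
  | cons hy h1 h2 _ ih => exact ih.trans (.cons hy h2 h1 (.nil _))

/-- Either a chain has a row with a nonzero entry in column `y`, which allows a shortcut, or it
persists in all matrices that agree with `D` on the rows with a zero entry in column `y`. -/
theorem shortcut_or_persists (D' : Matrix X Y R) (y : Y)
    (hD' : ∀ i j, D i y = 0 → D' i j = D i j) {m : ℕ} {a b : X} (h : Chain D T m a b) :
    (∃ m' ≤ m, ∃ a', D a' y ≠ 0 ∧ Chain D T m' a' b) ∨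
      (D a y = 0 ∧ D b y = 0 ∧ Chain D' T m a b) := by
  induction h with
  | nil x =>
    by_cases hx : D x y = 0
    · exact .inr ⟨hx, hx, .nil _⟩
    · exact .inl ⟨0, le_rfl, x, hx, .nil _⟩
  | @cons n x x₁ x' z hz h1 h2 h ih =>
    by_cases hx : D x y = 0
    · obtain ⟨m', hm', a', ha', h'⟩ | ⟨h3, h4, h5⟩ := ih
      · exact .inl ⟨m', by omega, a', ha', h'⟩
      · exact .inr ⟨hx, h4, .cons hz (by rwa [hD' _ _ hx]) (by rwa [hD' _ _ h3]) h5⟩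
    · exact .inl ⟨n + 1, le_rfl, x, hx, .cons hz h1 h2 h⟩

end Chain

end Chain

section Uniqueness

variable {S R : Type*} [CommRing S] [CommRing R] [Nontrivial S] [Nontrivial R] {φ : S →+* R}
  {K : Subgroup Sˣ} {H : Subgroup Rˣ} {X Y : Type*} [Fintype X] [DecidableEq X] [DecidableEq Y]

/-- If two strong lifts of the same matrix agree on the columns in `T`, then the ratio of their
entries in another column is constant along chains in `T`. -/
theorem ratio_eq_of_chain (L : IsLifting φ K H) {T : Set Y} {u : Y} (hu : u ∉ T) {n : ℕ}
    {D E : Matrix X Y S} (hD : D.IsStrong K) (hE : E.IsStrong K) (hDE : D.map φ = E.map φ)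
    (hT : ∀ i, ∀ j ∈ T, D i j = E i j) {x x' : X} (hc : Chain D T n x x') (hx : D x u ≠ 0)
    (hx' : D x' u ≠ 0) : E x u * D x' u = D x u * E x' u := by
  induction n using Nat.strong_induction_on generalizing D E x x' with
  | _ n ih =>
  have hφ : ∀ i j, φ (D i j) = φ (E i j) := fun i j => congrFun (congrFun hDE i) j
  have hne : ∀ i j, D i j ≠ 0 → E i j ≠ 0 := fun i j h h0 => h <| by
    rw [← (hD.apply i j).map_eq_zero (φ := φ), hφ, h0, map_zero]
  cases hc with
  | nil => ring
  | @cons n _ x₁ _ y hy h1 h2 hc =>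
  have hyu : u ≠ y := fun h => hu (h ▸ hy)
  cases hc with
  | nil =>
    -- With one common column, the cross ratios of `D` and `E` are fundamental with the same image,
    -- hence equal, and column `y` is the same in both.
    have k1 := hD.hasFundamentalRatio L.neg_one_mem hx h1 hx' h2
    have k2 := hE.hasFundamentalRatio L.neg_one_mem (hne _ _ hx) (hne _ _ h1) (hne _ _ hx')
      (hne _ _ h2)
    have k3 := L.ratio_unique k1 k2 (hD.apply _ _) (hD.apply _ _) h1 hx' (hφ _ _) (hφ _ _)
      (hφ _ _) (hφ _ _)
    rw [← hT _ y hy, ← hT _ y hy] at k3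
    have hu1 := ((hD.apply x y).mul (hD.apply x' y)).isUnit ((hD.apply x y).mul_ne_zero h1 h2)
    refine hu1.mul_left_inj.1 ?_
    linear_combination -k3
  | @cons n _ x₂ _ y₁ hy₁ h3 h4 hc =>
  by_cases hx1u : D x₁ u = 0
  swap
  · have k1 := ih 1 (by omega) hD hE hDE hT (.cons hy h1 h2 (.nil _)) hx hx1u
    have k2 := ih (n + 1) (by omega) hD hE hDE hT (.cons hy₁ h3 h4 hc) hx1u hx'
    refine ((hD.apply _ _).isUnit hx1u).mul_left_inj.1 ?_
    linear_combination D x' u * k1 + D x u * k2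
  by_cases hxy1 : D x y₁ = 0
  swap
  · exact ih (n + 1) (by omega) hD hE hDE hT (.cons hy₁ hxy1 h4 hc) hx hx'
  have hxx1 : x ≠ x₁ := by rintro rfl; exact hx hx1u
  have hx1x' : x' ≠ x₁ := by rintro rfl; exact hx' hx1u
  have hyy1 : y₁ ≠ y := by rintro rfl; exact h1 hxy1
  have hx1uE : E x₁ u = 0 := by
    rw [← (hE.apply _ _).map_eq_zero (φ := φ), ← hφ, hx1u, map_zero]
  -- No shortcut past `x₁` is visible so far. Pivoting on `(x₁, y)` leaves column `u` alone, as `D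
  -- x₁ u = 0`, and fills `(x, y₁)`, which joins `x` to `x₂` directly. The rest of the chain
  -- survives unless it meets column `y`, and then it can be shortened already in `D`.
  obtain ⟨m', hm', a', ha', hc'⟩ | ⟨k1, -, k3⟩ := hc.shortcut_or_persists (pivot D x₁ y) y
    (fun i j hi => pivot_of_row_eq_zero D (by rintro rfl; exact h2 hi) hi)
  · exact ih (m' + 1) (by omega) hD hE hDE hT (.cons hy h1 ha' hc') hx hx'
  have hu1 := (hD.apply _ _).isUnit h2
  have hu2 := (hE.apply _ _).isUnit (hne _ _ h2)
  have hx2 : x₂ ≠ x₁ := by rintro rfl; exact h2 k1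
  have key := ih (n + 1) (by omega) (hD.pivot L.neg_one_mem h2)
    (hE.pivot L.neg_one_mem (hne _ _ h2)) (by rw [pivot_map _ _ hu1, pivot_map _ _ hu2, hDE])
    (fun i j hj => by simp only [pivot, hT _ _ hy, hT _ _ hj])
    (x := x) (x' := x') (.cons hy₁ ?_ ?_ k3) ?_ ?_
  · simpa only [pivot_of_col_eq_zero _ hyu hx1u, pivot_of_col_eq_zero _ hyu hx1uE] using key
  · rw [pivot_of_ne _ hxx1 hyy1, hxy1, zero_sub, neg_ne_zero]
    exact ((hD.apply _ _).mul (hD.apply _ _).inverse).mul_ne_zero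
      ((hD.apply _ _).mul_ne_zero h1 ((hD.apply _ _).inverse_ne_zero h2)) h3
  · rwa [pivot_of_row_eq_zero _ hx2 k1]
  · rwa [pivot_of_col_eq_zero _ hyu hx1u]
  · rwa [pivot_of_col_eq_zero _ hyu hx1u]

end Uniqueness

end Matrix

/-! ### Cross ratios in a matrix glued from two strong ones -/

namespace Matrix

section Existence

variable {S R : Type*} [CommRing S] [CommRing R] [Nontrivial S] [Nontrivial R] {φ : S →+* R}
  {K : Subgroup Sˣ} {H : Subgroup Rˣ} {X Y : Type*} [Fintype X] [DecidableEq X] [DecidableEq Y]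

/-- `D` has a strong image, and it becomes strong when one of the columns `u` and `v` is deleted. -/
structure IsGlued (L : IsLifting φ K H) (D : Matrix X Y S) (u v : Y) : Prop where
  ne : u ≠ v
  left : (D.submatrix id (Subtype.val : {j // j ≠ u} → Y)).IsStrong K
  right : (D.submatrix id (Subtype.val : {j // j ≠ v} → Y)).IsStrong K
  map : (D.map φ).IsStrong H

namespace IsGlued

variable {L : IsLifting φ K H} {D : Matrix X Y S} {u v : Y}

theorem symm (h : IsGlued L D u v) : IsGlued L D v u := ⟨h.ne.symm, h.right, h.left, h.map⟩

theorem apply (h : IsGlued L D u v) (i : X) (j : Y) : UnitOrZero K (D i j) := by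
  by_cases hj : j = u
  · exact h.right.apply i ⟨j, hj ▸ h.ne⟩
  · exact h.left.apply i ⟨j, hj⟩

theorem map_ne_zero (h : IsGlued L D u v) {i : X} {j : Y} (hij : D i j ≠ 0) : φ (D i j) ≠ 0 :=
  fun h0 => hij ((h.apply i j).map_eq_zero.1 h0)

protected theorem pivot (h : IsGlued L D u v) {x : X} {y : Y} (hxy : D x y ≠ 0) (hu : y ≠ u) (hv : y ≠ v) :
    IsGlued L (pivot D x y) u v := by
  refine ⟨h.ne, ?_, ?_, ?_⟩
  · have := h.left.pivot L.neg_one_mem (x := x) (y := ⟨y, hu⟩) hxy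
    rwa [pivot_submatrix _ Function.injective_id Subtype.val_injective] at this
  · have := h.right.pivot L.neg_one_mem (x := x) (y := ⟨y, hv⟩) hxy
    rwa [pivot_submatrix _ Function.injective_id Subtype.val_injective] at this
  · rw [pivot_map _ _ ((h.apply _ _).isUnit hxy)]
    exact h.map.pivot L.neg_one_mem' (h.map_ne_zero hxy)

theorem ratio_left (h : IsGlued L D u v) {x x' : X} {y y' : Y} (hy : y ≠ u) (hy' : y' ≠ u)
    (h1 : D x y ≠ 0) (h2 : D x y' ≠ 0) (h3 : D x' y ≠ 0) (h4 : D x' y' ≠ 0) :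
    HasFundamentalRatio K (D x y) (D x y') (D x' y) (D x' y') :=
  h.left.hasFundamentalRatio L.neg_one_mem (y := ⟨y, hy⟩) (y' := ⟨y', hy'⟩) h1 h2 h3 h4

theorem ratio_map (h : IsGlued L D u v) {x x' : X}
    (h1 : D x u ≠ 0) (h2 : D x v ≠ 0) (h3 : D x' u ≠ 0) (h4 : D x' v ≠ 0) :
    HasFundamentalRatio H (φ (D x u)) (φ (D x v)) (φ (D x' u)) (φ (D x' v)) :=
  h.map.hasFundamentalRatio L.neg_one_mem' (h.map_ne_zero h1) (h.map_ne_zero h2)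
    (h.map_ne_zero h3) (h.map_ne_zero h4)

theorem ratio_of_mul (h : IsGlued L D u v) {x x' : X}
    (h1 : D x u ≠ 0) (h2 : D x v ≠ 0) (h3 : D x' u ≠ 0) (h4 : D x' v ≠ 0) {f g : S}
    (hf : IsFundamental K f) (hg : IsFundamental K g)
    (hfg : f * g * (D x v * D x' u) = D x u * D x' v) :
    HasFundamentalRatio K (D x u) (D x v) (D x' u) (D x' v) :=
  L.ratio_of_mul hf hg (h.apply _ _) (h.apply _ _) h2 h3 hfg (h.ratio_map h1 h2 h3 h4)

/-- Cross ratios multiply along rows. The product of two fundamental elements is fundamental because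
its image is, by strongness of the image of `D`. -/
theorem ratio_trans (h : IsGlued L D u v) {x x₁ x' : X}
    (h1 : D x u ≠ 0) (h2 : D x v ≠ 0) (h3 : D x' u ≠ 0) (h4 : D x' v ≠ 0) (h5 : D x₁ u ≠ 0)
    (h6 : D x₁ v ≠ 0) (k1 : HasFundamentalRatio K (D x u) (D x v) (D x₁ u) (D x₁ v))
    (k2 : HasFundamentalRatio K (D x₁ u) (D x₁ v) (D x' u) (D x' v)) :
    HasFundamentalRatio K (D x u) (D x v) (D x' u) (D x' v) := by
  obtain ⟨f, hf, k1⟩ := k1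
  obtain ⟨g, hg, k2⟩ := k2
  refine h.ratio_of_mul h1 h2 h3 h4 hf hg ?_
  refine (((h.apply _ _).mul (h.apply _ _)).isUnit
    ((h.apply _ _).mul_ne_zero h5 h6)).mul_left_inj.1 ?_
  linear_combination g * D x₁ v * D x' u * k1 + D x u * D x₁ v * k2

/-- Column `y` splits the cross ratio into those of `u, y` and `y, v`. These avoid `v` and `u`
respectively, so each lies in a strong part of `D`. -/
theorem ratio_of_common_col (h : IsGlued L D u v) {x x' : X} {y : Y} (hu : y ≠ u) (hv : y ≠ v)
    (h1 : D x u ≠ 0) (h2 : D x v ≠ 0) (h3 : D x' u ≠ 0) (h4 : D x' v ≠ 0) (h5 : D x y ≠ 0)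
    (h6 : D x' y ≠ 0) : HasFundamentalRatio K (D x u) (D x v) (D x' u) (D x' v) := by
  obtain ⟨f, hf, k1⟩ := h.symm.ratio_left h.ne hv h1 h5 h3 h6
  obtain ⟨g, hg, k2⟩ := h.ratio_left hu h.ne.symm h5 h2 h6 h4
  refine h.ratio_of_mul h1 h2 h3 h4 hf hg ?_
  refine (((h.apply _ _).mul (h.apply _ _)).isUnit
    ((h.apply _ _).mul_ne_zero h5 h6)).mul_left_inj.1 ?_
  linear_combination g * D x v * D x' y * k1 + D x u * D x' y * k2

/-- The case of three rows in which the middle one meets column `u` but not column `v`. -/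
theorem ratio_of_path (h : IsGlued L D u v) {x x₁ x' : X} {y y₁ : Y} (hu : y ≠ u) (hv : y ≠ v)
    (hu₁ : y₁ ≠ u) (hv₁ : y₁ ≠ v)
    (h1 : D x u ≠ 0) (h2 : D x v ≠ 0) (h3 : D x' u ≠ 0) (h4 : D x' v ≠ 0) (h5 : D x y ≠ 0)
    (h6 : D x₁ y ≠ 0) (h7 : D x₁ y₁ ≠ 0) (h8 : D x' y₁ ≠ 0) (h9 : D x y₁ = 0) (h10 : D x' y = 0)
    (h11 : D x₁ u ≠ 0) (h12 : D x₁ v = 0) :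
    HasFundamentalRatio K (D x u) (D x v) (D x' u) (D x' v) := by
  have hx : x ≠ x₁ := by rintro rfl; exact h7 h9
  have hx' : x' ≠ x₁ := by rintro rfl; exact h6 h10
  have hy : y₁ ≠ y := by rintro rfl; exact h5 h9
  have i1 := (h.apply _ _).mul_inverse h6
  have i2 := (h.apply _ _).mul_inverse h7
  obtain ⟨a, ha, k1⟩ := h.symm.ratio_left hv h.ne h5 h1 h6 h11
  obtain ⟨b, hb, k2⟩ := h.symm.ratio_left hv₁ h.ne h8 h3 h7 h11
  have hP := h.pivot h6 hu hv
  have hQ := h.pivot h7 hu₁ hv₁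
  -- Pivoting in row `x₁` multiplies an entry of column `u` by `1 - a`, where `a` is a fundamental
  -- cross ratio of that column, and leaves column `v` unchanged. So the wanted ratio changes by a
  -- controlled factor.
  have p1 : pivot D x₁ y x u = D x u * (1 - a) := by
    rw [pivot_of_ne _ hx hu.symm]
    linear_combination Ring.inverse (D x₁ y) * k1 - D x u * a * i1
  have q1 : pivot D x₁ y₁ x' u = D x' u * (1 - b) := by
    rw [pivot_of_ne _ hx' hu₁.symm]
    linear_combination Ring.inverse (D x₁ y₁) * k2 - D x' u * b * i2
  have p2 : pivot D x₁ y x v = D x v := pivot_of_col_eq_zero _ hv.symm h12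
  have p3 : pivot D x₁ y x' v = D x' v := pivot_of_col_eq_zero _ hv.symm h12
  have p4 : ∀ j, pivot D x₁ y x' j = D x' j := fun j => pivot_of_row_eq_zero _ hx' h10
  have p5 : pivot D x₁ y x y₁ ≠ 0 := by
    rw [pivot_of_ne _ hx hy, h9, zero_sub, neg_ne_zero]
    exact ((h.apply _ _).mul (h.apply _ _).inverse).mul_ne_zero
      ((h.apply _ _).mul_ne_zero h5 ((h.apply _ _).inverse_ne_zero h6)) h7
  -- If `1 - a` is nonzero it is fundamental; after the pivot `x` and `x'` share column `y₁`, so the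
  -- wanted ratio is a product of two fundamental elements. The case `b ≠ 1` is the mirror image.
  by_cases ha1 : a = 1
  swap
  · have ha' := ha.one_sub' ha1
    obtain ⟨f, hf, k3⟩ := hP.ratio_of_common_col hu₁ hv₁ (x := x) (x' := x')
      (by rw [p1]; exact (h.apply _ _).mul_ne_zero h1 ha'.2) (by rwa [p2]) (by rwa [p4])
      (by rwa [p4]) p5 (by rwa [p4])
    rw [p1, p2, p4, p4] at k3
    refine h.ratio_of_mul h1 h2 h3 h4 hf (ha'.inverse L.neg_one_mem) ?_
    have i3 := ha'.1.mul_inverse ha'.2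
    linear_combination Ring.inverse (1 - a) * k3 + D x u * D x' v * i3
  by_cases hb1 : b = 1
  swap
  · have hb' := hb.one_sub' hb1
    have q4 : ∀ j, pivot D x₁ y₁ x j = D x j := fun j => pivot_of_row_eq_zero _ hx h9
    have q3 : pivot D x₁ y₁ x' v = D x' v := pivot_of_col_eq_zero _ hv₁.symm h12
    have q5 : pivot D x₁ y₁ x' y ≠ 0 := by
      rw [pivot_of_ne _ hx' hy.symm, h10, zero_sub, neg_ne_zero]
      exact ((h.apply _ _).mul (h.apply _ _).inverse).mul_ne_zero
        ((h.apply _ _).mul_ne_zero h8 ((h.apply _ _).inverse_ne_zero h7)) h6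
    obtain ⟨f, hf, k3⟩ := hQ.ratio_of_common_col hu hv (x := x) (x' := x')
      (by rwa [q4]) (by rwa [q4]) (by rw [q1]; exact (h.apply _ _).mul_ne_zero h3 hb'.2)
      (by rwa [q3]) (by rwa [q4]) q5
    rw [q1, q4, q4, q3] at k3
    refine h.ratio_of_mul h1 h2 h3 h4 hf hb' ?_
    linear_combination k3
  -- Both pivots would now create zeros in column `u`. Instead, the wanted ratio turns out to be
  -- `-g` for a cross ratio `g` of the columns `y₁` and `v` in the pivot. Its image is fundamental
  -- and lifts to some `e'`, and `eq_neg` gives `e' = -g`.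
  subst ha1 hb1
  obtain ⟨g, hg, k3⟩ := hP.ratio_left hu₁ h.ne.symm (x := x) (x' := x') p5 (by rwa [p2])
    (by rwa [p4]) (by rwa [p4])
  rw [pivot_of_ne _ hx hy, h9, p2, p4, p4] at k3
  obtain ⟨e, he, k4⟩ := h.ratio_map h1 h2 h3 h4
  obtain ⟨e', he', rfl⟩ := L.exists_fundamental e he
  have k5 : -g * (D x v * D x' u) = D x u * D x' v := by
    refine (((h.apply _ _).mul (h.apply _ _)).isUnit
      ((h.apply _ _).mul_ne_zero h8 h11)).mul_left_inj.1 ?_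
    linear_combination (-D x' u * D x₁ u) * k3 +
      D x₁ u * D x y * Ring.inverse (D x₁ y) * D x' v * k2 -
      Ring.inverse (D x₁ y) * D x' v * D x' y₁ * D x₁ u * k1 +
      D x u * D x' v * D x' y₁ * D x₁ u * i1
  have hne := ((h.apply x v).mul (h.apply x' u)).isUnit ((h.apply _ _).mul_ne_zero h2 h3)
  have k6 : φ e' = -φ g := by
    refine (hne.map φ).mul_left_inj.1 ?_
    rw [map_mul, k4, ← map_mul, ← k5, ← map_mul, ← map_neg, ← map_mul]
  have := L.eq_neg _ _ he' hg k6
  exact ⟨e', he', by rw [this, k5]⟩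

/-- The ratio of the columns `u` and `v` on two rows is fundamental if these rows are joined by a
chain that avoids `u` and `v`. -/
theorem ratio_of_chain {n : ℕ} {D : Matrix X Y S} (h : IsGlued L D u v) {x x' : X}
    (hc : Chain D {j | j ≠ u ∧ j ≠ v} n x x') (h1 : D x u ≠ 0) (h2 : D x v ≠ 0) (h3 : D x' u ≠ 0)
    (h4 : D x' v ≠ 0) : HasFundamentalRatio K (D x u) (D x v) (D x' u) (D x' v) := by
  induction n using Nat.strong_induction_on generalizing D x x' with
  | _ n ih =>
  have pivot_ne : ∀ {i i' : X} {j j' : Y}, i ≠ i' → j' ≠ j → D i j' = 0 → D i j ≠ 0 →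
      D i' j ≠ 0 → D i' j' ≠ 0 → Matrix.pivot D i' j i j' ≠ 0 := by
    intro i i' j j' hi hj e1 e2 e3 e4
    rw [pivot_of_ne _ hi hj, e1, zero_sub, neg_ne_zero]
    exact ((h.apply _ _).mul (h.apply _ _).inverse).mul_ne_zero
      ((h.apply _ _).mul_ne_zero e2 ((h.apply _ _).inverse_ne_zero e3)) e4
  cases hc with
  | nil => exact ⟨1, .one, by ring⟩
  | @cons n _ x₁ _ y hy g1 g2 hc =>
  cases hc with
  | nil => exact h.ratio_of_common_col hy.1 hy.2 h1 h2 h3 h4 g1 g2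
  | @cons n _ x₂ _ y₁ hy₁ g3 g4 hc =>
  by_cases g5 : D x y₁ = 0
  swap
  · exact ih (n + 1) (by omega) h (.cons hy₁ g5 g4 hc) h1 h2 h3 h4
  have hyy1 : y₁ ≠ y := by rintro rfl; exact g1 g5
  have hxx1 : x ≠ x₁ := by rintro rfl; exact g3 g5
  cases hc with
  | nil =>
    by_cases g6 : D x' y = 0
    swap
    · exact ih 1 (by omega) h (.cons hy g1 g6 (.nil _)) h1 h2 h3 h4
    have hx'x1 : x' ≠ x₁ := by rintro rfl; exact g2 g6
    -- One middle row. If it avoids both `u` and `v`, a pivot in it gives `x` and `x'` a common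
    -- column; if it meets one of them, `ratio_of_path` applies; if it meets both, the ratios
    -- multiply.
    by_cases g7 : D x₁ u = 0 <;> by_cases g8 : D x₁ v = 0
    · have e1 : ∀ i, Matrix.pivot D x₁ y i u = D i u := fun i =>
        pivot_of_col_eq_zero _ hy.1.symm g7
      have e2 : ∀ i, Matrix.pivot D x₁ y i v = D i v := fun i =>
        pivot_of_col_eq_zero _ hy.2.symm g8
      have key := ih 1 (by omega) (h.pivot g2 hy.1 hy.2) (x := x) (x' := x')
        (.cons hy₁ (pivot_ne hxx1 hyy1 g5 g1 g2 g3)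
          (by rwa [pivot_of_row_eq_zero _ hx'x1 g6]) (.nil _))
        (by rwa [e1]) (by rwa [e2]) (by rwa [e1]) (by rwa [e2])
      rwa [e1, e2, e1, e2] at key
    · exact (h.symm.ratio_of_path hy.2 hy.1 hy₁.2 hy₁.1 h2 h1 h4 h3 g1 g2 g3 g4 g5 g6 g8
        g7).swap_cols L.neg_one_mem
    · exact h.ratio_of_path hy.1 hy.2 hy₁.1 hy₁.2 h1 h2 h3 h4 g1 g2 g3 g4 g5 g6 g7 g8
    · exact h.ratio_trans h1 h2 h3 h4 g7 g8
        (ih 1 (by omega) h (.cons hy g1 g2 (.nil _)) h1 h2 g7 g8)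
        (ih 1 (by omega) h (.cons hy₁ g3 g4 (.nil _)) g7 g8 h3 h4)
  | @cons n _ x₃ _ y₂ hy₂ g6 g7 hc =>
  -- For longer chains the pivot is on `(x₂, y₁)`. The end rows `x` and `x'` vanish in column `y₁`
  -- and are unchanged, so the cross ratio is too, whatever `x₂` has in columns `u` and `v`. The
  -- pivot joins `x₁` to `x₃` through `y₂`.
  obtain ⟨m', hm', a', ha', hc'⟩ | ⟨k1, k2, k3⟩ := hc.shortcut_or_persists (Matrix.pivot D x₂ y₁) y₁
    (fun i j hi => pivot_of_row_eq_zero D (by rintro rfl; exact g4 hi) hi)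
  · exact ih (m' + 2) (by omega) h (.cons hy g1 g2 (.cons hy₁ g3 ha' hc')) h1 h2 h3 h4
  by_cases g8 : D x₁ y₂ = 0
  swap
  · exact ih (n + 2) (by omega) h (.cons hy g1 g2 (.cons hy₂ g8 g7 hc)) h1 h2 h3 h4
  by_cases g9 : D x₂ y = 0
  swap
  · exact ih (n + 2) (by omega) h (.cons hy g1 g9 (.cons hy₂ g6 g7 hc)) h1 h2 h3 h4
  have hx12 : x₁ ≠ x₂ := by rintro rfl; exact g6 g8
  have hy12 : y₂ ≠ y₁ := by rintro rfl; exact g3 g8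
  have hxx2 : x ≠ x₂ := by rintro rfl; exact g4 g5
  have hx'x2 : x' ≠ x₂ := by rintro rfl; exact g4 k2
  have hx3x2 : x₃ ≠ x₂ := by rintro rfl; exact g4 k1
  have e1 : ∀ j, Matrix.pivot D x₂ y₁ x j = D x j := fun j => pivot_of_row_eq_zero _ hxx2 g5
  have e2 : ∀ j, Matrix.pivot D x₂ y₁ x' j = D x' j := fun j => pivot_of_row_eq_zero _ hx'x2 k2
  have key := ih (n + 2) (by omega) (h.pivot g4 hy₁.1 hy₁.2) (x := x) (x' := x')
    (.cons hy (by rwa [e1]) (by rwa [pivot_of_col_eq_zero _ hyy1.symm g9])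
      (.cons hy₂ (pivot_ne hx12 hy12 g8 g3 g4 g6)
        (by rwa [pivot_of_row_eq_zero _ hx3x2 k1]) k3))
    (by rwa [e1]) (by rwa [e1]) (by rwa [e2]) (by rwa [e2])
  rwa [e1, e1, e2, e2] at key

end IsGlued

end Existence

end Matrix

/-! ### Row connectivity and the gluing of two lifts -/

namespace Matrix

section RowConnected

variable {R : Type*} [CommRing R] {X Y : Type*}

/-- A partition of the rows and columns that is compatible with the nonzero entries of a pivot of `D`
is compatible with those of `D`. -/
theorem iff_of_pivot [DecidableEq X] [DecidableEq Y] [Nontrivial R] {H : Subgroup Rˣ}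
    {D : Matrix X Y R} {T : Set Y} (hD : ∀ i j, UnitOrZero H (D i j)) {x : X} {y : Y} (hy : y ∈ T)
    (hxy : D x y ≠ 0) {s : X → Prop} {t : Y → Prop}
    (hst : ∀ i, ∀ j ∈ T, pivot D x y i j ≠ 0 → (s i ↔ t j)) :
    ∀ i, ∀ j ∈ T, D i j ≠ 0 → (s i ↔ t j) := by
  have hc : ∀ i, D i y ≠ 0 → (s i ↔ t y) := by
    intro i hi
    refine hst i y hy ?_
    by_cases hix : i = x
    · subst hix
      rw [pivot_self]
      exact (hD _ _).inverse_ne_zero hxy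
    · rw [pivot_col _ hix, neg_ne_zero]
      exact (hD _ _).mul_ne_zero hi ((hD _ _).inverse_ne_zero hxy)
  have hr : ∀ j ∈ T, D x j ≠ 0 → (s x ↔ t j) := by
    intro j hj hxj
    by_cases hjy : j = y
    · subst hjy; exact hc x hxy
    · refine hst x j hj ?_
      rw [pivot_row _ hjy]
      exact (hD _ _).inverse.mul_ne_zero ((hD _ _).inverse_ne_zero hxy) hxj
  intro i j hj hij
  by_cases h0 : D i y = 0
  · by_cases hix : i = x
    · subst hix; exact hr j hj hij
    · exact hst i j hj (by rwa [pivot_of_row_eq_zero _ hix h0])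
  by_cases h1 : D x j = 0
  · by_cases hjy : j = y
    · subst hjy; exact hc i hij
    · exact hst i j hj (by rwa [pivot_of_col_eq_zero _ hjy h1])
  -- The pivot may have cancelled the entry `(i, j)`. Then `i` and `j` are joined through `y` and
  -- `x`, since the pivot row and column keep their nonzero entries.
  rw [hc i h0, ← hc x hxy, hr j hj h1]

/-- The rows of `D` are connected through the columns in `T`. -/
def RowConnected (D : Matrix X Y R) (T : Set Y) : Prop :=
  ∀ (s : X → Prop) (t : Y → Prop), (∀ x, ∀ y ∈ T, D x y ≠ 0 → (s x ↔ t y)) → ∀ x x', s x ↔ s x'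

namespace RowConnected

variable {D : Matrix X Y R} {T : Set Y}

theorem exists_chain (h : RowConnected D T) (x x' : X) : ∃ n, Chain D T n x x' := by
  refine (h (fun i => ∃ n, Chain D T n i x') (fun j => ∃ i, D i j ≠ 0 ∧ ∃ n, Chain D T n i x')
    (fun i j hj hij => ⟨fun hi => ⟨i, hij, hi⟩, ?_⟩) x x').2 ⟨0, .nil _⟩
  rintro ⟨i', hi', n, hn⟩
  exact ⟨n + 1, .cons hj hij hi' hn⟩

theorem pivot [DecidableEq X] [DecidableEq Y] [Nontrivial R] {H : Subgroup Rˣ}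
    (h : RowConnected D T) (hD : ∀ i j, UnitOrZero H (D i j)) {x : X} {y : Y} (hy : y ∈ T)
    (hxy : D x y ≠ 0) : RowConnected (pivot D x y) T :=
  fun s t hst => h s t (iff_of_pivot hD hy hxy hst)

end RowConnected

end RowConnected

section Gluing

variable {S R : Type*} [CommRing S] [CommRing R] [Nontrivial S] [Nontrivial R] {φ : S →+* R}
  {K : Subgroup Sˣ} {H : Subgroup Rˣ} {X Y : Type*} [Fintype X] [DecidableEq X] [DecidableEq Y]

theorem IsGlued.det_two {L : IsLifting φ K H} {u v : Y} {D : Matrix X Y S} (h : IsGlued L D u v)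
    (hc : RowConnected D {j | j ≠ u ∧ j ≠ v}) (x x' : X) :
    UnitOrZero K (D x u * D x' v - D x v * D x' u) := by
  have hz : ∀ a b : S, UnitOrZero K a → UnitOrZero K b → (a = 0 ∨ b = 0) →
      UnitOrZero K (a - b) := by
    rintro a b ha hb (rfl | rfl)
    · simpa using hb.neg L.neg_one_mem
    · simpa using ha
  have hz' := hz _ _ ((h.apply x u).mul (h.apply x' v)) ((h.apply x v).mul (h.apply x' u))
  by_cases h1 : D x u = 0
  · exact hz' (.inl (by rw [h1, zero_mul]))
  by_cases h2 : D x v = 0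
  · exact hz' (.inr (by rw [h2, zero_mul]))
  by_cases h3 : D x' u = 0
  · exact hz' (.inr (by rw [h3, mul_zero]))
  by_cases h4 : D x' v = 0
  · exact hz' (.inl (by rw [h4, mul_zero]))
  obtain ⟨n, hn⟩ := hc.exists_chain x x'
  exact (h.ratio_of_chain hn h1 h2 h3 h4).det L.neg_one_mem (h.apply _ _) (h.apply _ _)

/-- A pivot outside `u` and `v` preserves both the gluing and the connectivity, so the size drops
until only the columns `u` and `v` are left. Then the cross ratio decides. -/
theorem IsGlued.isStrong {L : IsLifting φ K H} {u v : Y} {D : Matrix X Y S} (h : IsGlued L D u v)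
    (hc : RowConnected D {j | j ≠ u ∧ j ≠ v}) : D.IsStrong K := by
  intro k
  induction k generalizing D with
  | zero => intro f g; simpa using UnitOrZero.one
  | succ k ih =>
    intro f g
    refine unitOrZero_det_of_injective D f g fun hf hg => ?_
    by_cases hj : ∃ j, g j ≠ u ∧ g j ≠ v
    · obtain ⟨j, hj⟩ := hj
      by_cases h0 : ∀ i, D (f i) (g j) = 0
      · rw [det_eq_zero_of_column_eq_zero j (by simpa using h0)]
        exact .zero
      push Not at h0
      obtain ⟨i, hi⟩ := h0
      rw [det_submatrix_eq_det_pivot D hf hg i j ((h.apply _ _).isUnit hi)]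
      exact ((UnitOrZero.neg_one_pow L.neg_one_mem _).mul (h.apply _ _)).mul
        (ih (h.pivot hi hj.1 hj.2) (hc.pivot h.apply hj hi) _ _)
    · have hj' : ∀ j, g j = u ∨ g j = v := fun j => by
        by_contra hc
        exact hj ⟨j, not_or.1 hc⟩
      match k with
      | 0 => simpa using h.apply (f 0) (g 0)
      | 1 =>
        rw [det_fin_two]
        simp only [submatrix_apply]
        have hne : g 0 ≠ g 1 := hg.ne (by decide)
        obtain h0 | h0 := hj' 0 <;> obtain h1 | h1 := hj' 1
        · exact absurd (h0.trans h1.symm) hne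
        · rw [h0, h1]; exact h.det_two hc _ _
        · rw [h0, h1]; exact (h.det_two hc _ _).sub_comm L.neg_one_mem
        · exact absurd (h0.trans h1.symm) hne
      | k + 2 =>
        exfalso
        have hne : ∀ a b (ha : a < k + 2 + 1) (hb : b < k + 2 + 1), a ≠ b → g ⟨a, ha⟩ ≠ g ⟨b, hb⟩ :=
          fun a b ha hb hab => hg.ne (by simpa using hab)
        have h01 := hne 0 1 (by omega) (by omega) (by omega)
        have h02 := hne 0 2 (by omega) (by omega) (by omega)
        have h12 := hne 1 2 (by omega) (by omega) (by omega)
        obtain h0 | h0 := hj' ⟨0, by omega⟩ <;> obtain h1 | h1 := hj' ⟨1, by omega⟩ <;>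
          obtain h2 | h2 := hj' ⟨2, by omega⟩ <;> simp_all

/-- The members of `K` that are mapped to one. -/
def kerSubgroup (φ : S →+* R) (K : Subgroup Sˣ) : Subgroup Sˣ :=
  K ⊓ (Units.map (φ : S →* R)).ker

theorem kerSubgroup_map {w : Sˣ} (hw : w ∈ kerSubgroup φ K) : φ (w : S) = 1 :=
  congrArg Units.val (MonoidHom.mem_ker.1 hw.2)

theorem mem_kerSubgroup {w : Sˣ} (hw : w ∈ K) (h : φ (w : S) = 1) : w ∈ kerSubgroup φ K :=
  ⟨hw, MonoidHom.mem_ker.2 (Units.ext h)⟩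

/-- Two strong lifts of a matrix differ by a scaling of rows and columns. -/
theorem exists_scaling (L : IsLifting φ K H) {D E : Matrix X Y S} (hD : D.IsStrong K)
    (hE : E.IsStrong K) (hDE : D.map φ = E.map φ) (T : Finset Y) :
    ∃ (r : X → Sˣ) (c : Y → Sˣ), (∀ x, r x ∈ kerSubgroup φ K) ∧ (∀ y, c y ∈ kerSubgroup φ K) ∧
      ∀ x, ∀ y ∈ T, E x y = r x * c y * D x y := by
  induction T using Finset.induction_on with
  | empty => exact ⟨fun _ => 1, fun _ => 1, fun _ => one_mem _, fun _ => one_mem _, by simp⟩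
  | insert u T huT ih =>
  obtain ⟨r, c, hr, hc, hrc⟩ := ih
  set F : Matrix X Y S := of fun x y => (r x : S) * c y * D x y with hF
  have hFs : F.IsStrong K := hD.scale (fun x => .of_mem (hr x).1) (fun y => .of_mem (hc y).1)
  have hFE : F.map φ = E.map φ := by
    rw [← hDE]
    ext x y
    simp [hF, kerSubgroup_map (hr x), kerSubgroup_map (hc y)]
  have hφ : ∀ x y, φ (F x y) = φ (E x y) := fun x y => congrFun (congrFun hFE x) y
  have hFT : ∀ x, ∀ y ∈ (T : Set Y), F x y = E x y := fun x y hy => (hrc x y hy).symm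
  have ht : ∀ x, ∃ t ∈ kerSubgroup φ K, E x u = (t : S) * F x u := by
    intro x
    obtain h0 | ⟨w, hw, hwx⟩ := hFs.apply x u
    · refine ⟨1, one_mem _, ?_⟩
      rw [h0, mul_zero, ← (hE.apply x u).map_eq_zero (φ := φ), ← hφ, h0, map_zero]
    obtain h0 | ⟨w', hw', hwx'⟩ := hE.apply x u
    · exfalso
      have := hφ x u
      rw [h0, map_zero, ← hwx] at this
      exact (w.isUnit.map φ).ne_zero this
    refine ⟨w' * w⁻¹, mem_kerSubgroup (mul_mem hw' (inv_mem hw)) ?_, ?_⟩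
    · have h1 := hφ x u
      rw [← hwx, ← hwx'] at h1
      rw [Units.val_mul, map_mul, ← h1, ← map_mul, Units.mul_inv, map_one]
    · rw [← hwx, ← hwx']
      simp
  choose t htN ht using ht
  -- The factor `t` by which `E` exceeds `F` in column `u` is constant on rows that are connected
  -- through `T`.
  have hchain : ∀ {x x' n}, Chain F (T : Set Y) n x x' → F x u ≠ 0 → F x' u ≠ 0 → t x = t x' := by
    intro x x' n hn hx hx'
    have h1 := ratio_eq_of_chain L (by simpa using huT) hFs hE hFE hFT hn hx hx'
    rw [ht, ht] at h1
    refine Units.ext ((((hFs.apply x u).mul (hFs.apply x' u)).isUnit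
      ((hFs.apply x u).mul_ne_zero hx hx')).mul_left_inj.1 ?_)
    linear_combination h1
  -- `ρ` extends `t` to a function constant on each component of rows, with value 1 on the
  -- components that column `u` does not meet. Scaling rows by `ρ` corrects column `u`.
  obtain ⟨ρ, hρN, hρ1, hρ2⟩ : ∃ ρ : X → Sˣ, (∀ x, ρ x ∈ kerSubgroup φ K) ∧
      (∀ x, F x u ≠ 0 → ρ x = t x) ∧ ∀ x x' n, Chain F (T : Set Y) n x x' → ρ x = ρ x' := by
    classical
    have key : ∀ x, ∃ a ∈ kerSubgroup φ K, (∀ x' n, Chain F (T : Set Y) n x x' → F x' u ≠ 0 →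
        a = t x') ∧ ((∀ x' n, Chain F (T : Set Y) n x x' → F x' u = 0) → a = 1) := by
      intro x
      by_cases hx : ∀ x' n, Chain F (T : Set Y) n x x' → F x' u = 0
      · exact ⟨1, one_mem _, fun x' n hn h0 => absurd (hx x' n hn) h0, fun _ => rfl⟩
      · have hx2 := hx
        push Not at hx
        obtain ⟨x', n, hn, h0⟩ := hx
        exact ⟨t x', htN _, fun x'' m hm h1 => hchain (hn.symm.trans hm) h0 h1,
          fun h => absurd h hx2⟩
    choose ρ h1 h2 h3 using key
    refine ⟨ρ, h1, fun x hx => h2 x x 0 (.nil _) hx, fun x x' n hn => ?_⟩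
    by_cases hx : ∀ x' n, Chain F (T : Set Y) n x x' → F x' u = 0
    · rw [h3 x hx, h3 x' fun x'' m hm => hx x'' _ (hn.trans hm)]
    · push Not at hx
      obtain ⟨x'', m, hm, h0⟩ := hx
      rw [h2 x x'' m hm h0, h2 x' x'' _ (hn.symm.trans hm) h0]
  -- Each nonzero column of `T` meets a single component, so the inverse factor undoes the row
  -- scaling there.
  have hγ : ∀ y, ∃ a ∈ kerSubgroup φ K, ∀ x, y ∈ T → F x y ≠ 0 → a = (ρ x)⁻¹ := by
    intro y
    by_cases hy : ∃ x, F x y ≠ 0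
    · obtain ⟨x, hx⟩ := hy
      exact ⟨(ρ x)⁻¹, inv_mem (hρN x), fun x' hyT hx' => by
        rw [hρ2 x x' 1 (.cons (by simpa using hyT) hx hx' (.nil _))]⟩
    · push Not at hy
      exact ⟨1, one_mem _, fun x _ hx => absurd (hy x) hx⟩
  choose γ hγN hγ using hγ
  refine ⟨fun x => r x * ρ x, fun y => c y * if y = u then 1 else γ y,
    fun x => mul_mem (hr x) (hρN x), fun y => mul_mem (hc y) ?_, fun x y hy => ?_⟩
  · split_ifs
    · exact one_mem _
    · exact hγN y
  have hFxy : F x y = r x * c y * D x y := rfl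
  have hgoal : ((r x * ρ x : Sˣ) : S) * ((c y * if y = u then 1 else γ y : Sˣ) : S) * D x y =
      ρ x * ((if y = u then 1 else γ y : Sˣ) : S) * F x y := by
    rw [hFxy]; push_cast; ring
  rw [hgoal]
  by_cases hyu : y = u
  · subst hyu
    rw [if_pos rfl, Units.val_one, mul_one, ht]
    by_cases h0 : F x y = 0
    · rw [h0, mul_zero, mul_zero]
    · rw [hρ1 x h0]
  · have hyT : y ∈ T := (Finset.mem_insert.1 hy).resolve_left hyu
    rw [if_neg hyu, ← hFT x y hyT]
    by_cases h0 : F x y = 0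
    · rw [h0, mul_zero]
    · rw [hγ y x hyT h0, Units.mul_inv, one_mul]

variable (K φ) in
/-- `D` is the image of a strong matrix. -/
def HasStrongLift (D : Matrix X Y R) : Prop := ∃ E : Matrix X Y S, E.IsStrong K ∧ E.map φ = D

/-- The two given lifts differ by a scaling on the common columns. The row factors of that scaling
can be applied to the missing column as well, so one matrix contains `B` and a rescaled `A`. -/
theorem hasStrongLift_of_columns [Fintype Y] (L : IsLifting φ K H) {D : Matrix X Y R}
    (hD : D.IsStrong H) {u v : Y} (huv : u ≠ v) (hc : RowConnected D {j | j ≠ u ∧ j ≠ v})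
    (hu : HasStrongLift φ K (D.submatrix id (Subtype.val : {j // j ≠ u} → Y)))
    (hv : HasStrongLift φ K (D.submatrix id (Subtype.val : {j // j ≠ v} → Y))) :
    HasStrongLift φ K D := by
  obtain ⟨A, hA, hAD⟩ := hu
  obtain ⟨B, hB, hBD⟩ := hv
  have hA' : ∀ x j, φ (A x j) = D x j := fun x j => congrFun (congrFun hAD x) j
  have hB' : ∀ x j, φ (B x j) = D x j := fun x j => congrFun (congrFun hBD x) j
  obtain ⟨r, c, hr, hc', hrc⟩ := exists_scaling L
    (hA.submatrix id (fun j : {j // j ≠ u ∧ j ≠ v} => (⟨j, j.2.1⟩ : {j // j ≠ u})))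
    (hB.submatrix id (fun j : {j // j ≠ u ∧ j ≠ v} => (⟨j, j.2.2⟩ : {j // j ≠ v})))
    (by ext x j; simp [hA', hB']) Finset.univ
  -- Column `v` comes from `A` with its rows rescaled by `r`, everything else from `B`. Column `v`
  -- is absent from `c`, so its column factor is 1.
  set E : Matrix X Y S := of fun x j => if h : j = v then r x * A x ⟨v, huv.symm⟩ else B x ⟨j, h⟩
    with hE
  have hEu : E.submatrix id (Subtype.val : {j // j ≠ u} → Y) =
      of fun x (j : {j // j ≠ u}) => (r x : S) * (if h : j.1 = v then 1 else (c ⟨j, j.2, h⟩ : S)) * A x j := by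
    ext x ⟨j, hj⟩
    by_cases h : j = v
    · subst h; simp [hE]
    · have := hrc x ⟨j, hj, h⟩ (Finset.mem_univ _)
      simpa [hE, h] using this
  have hEv : E.submatrix id (Subtype.val : {j // j ≠ v} → Y) = B := by
    ext x ⟨j, hj⟩
    simp [hE, hj]
  have hED : E.map φ = D := by
    ext x j
    by_cases h : j = v
    · subst h
      simp [hE, hA', kerSubgroup_map (hr x)]
    · simp [hE, h, hB']
  have hG : IsGlued L E u v := by
    refine ⟨huv, ?_, hEv ▸ hB, hED ▸ hD⟩
    rw [hEu]
    refine hA.scale (fun x => .of_mem (hr x).1) fun j => ?_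
    split_ifs
    · exact .one
    · exact .of_mem (hc' _).1
  refine ⟨E, hG.isStrong fun s t hst => hc s t fun x y hy hxy => hst x y hy fun h0 => hxy ?_, hED⟩
  rw [← hED, map_apply, h0, map_zero]

end Gluing

end Matrix

/-! ### Connectivity of graphs and of matrices -/

/-- In a connected graph with a vertex of degree at least three there are two vertices on the same
side of any given bipartition of the vertex set whose removal leaves a connected graph. -/
theorem exists_pair_of_connected {V : Type*} [Finite V] {adj : V → V → Prop}
    (hsymm : ∀ a b, adj a b → adj b a)
    (hconn : ∀ s : V → Prop, (∀ a b, adj a b → (s a ↔ s b)) → ∀ a b, s a ↔ s b) (z : V)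
    (N : Finset V) (hN : ∀ a ∈ N, adj z a ∧ a ≠ z) (hN3 : 2 < N.card) (side : V → Bool) :
    ∃ u v, u ≠ v ∧ side u = side v ∧ ∀ s : V → Prop,
      (∀ a b, a ≠ u → a ≠ v → b ≠ u → b ≠ v → adj a b → (s a ↔ s b)) →
        ∀ a b, a ≠ u → a ≠ v → b ≠ u → b ≠ v → (s a ↔ s b) := by
  classical
  have := Fintype.ofFinite V
  set bd : Finset V → Finset V := fun W =>
    Finset.univ.filter fun b => b ∉ W ∧ ∃ a ∈ W, adj a b with hbd
  have mem_bd : ∀ {W b}, b ∈ bd W ↔ b ∉ W ∧ ∃ a ∈ W, adj a b := by simp [hbd]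
  -- The set `W` is to be connected, contain `z` and have at least three boundary vertices; a
  -- maximal one is taken.
  set P : Finset V → Prop := fun W => z ∈ W ∧ 2 < (bd W).card ∧ ∀ s : V → Prop,
    (∀ a ∈ W, ∀ b ∈ W, adj a b → (s a ↔ s b)) → ∀ a ∈ W, ∀ b ∈ W, (s a ↔ s b) with hP
  have hPz : P {z} := by
    refine ⟨by simp, hN3.trans_le (Finset.card_le_card fun a ha => ?_), by simp⟩
    rw [mem_bd]
    exact ⟨by simpa using (hN a ha).2, z, by simp, (hN a ha).1⟩
  obtain ⟨W, -, hW⟩ := Finite.exists_le_maximal hPz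
  obtain ⟨hzW, hW3, hWc⟩ := hW.prop
  -- If `W` and its boundary miss a vertex, some boundary vertex `b` has a neighbour `c` beyond.
  -- Adding `b` to `W` costs the boundary `b` but gains it `c`, against maximality.
  have hcover : ∀ c, c ∈ W ∨ c ∈ bd W := by
    by_contra hcon
    push Not at hcon
    obtain ⟨c, hc⟩ := hcon
    have : ∃ b c, adj b c ∧ (b ∈ W ∨ b ∈ bd W) ∧ ¬(c ∈ W ∨ c ∈ bd W) := by
      by_contra hno
      push Not at hno
      have := (hconn (fun b => b ∈ W ∨ b ∈ bd W) (fun a b hab =>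
        ⟨fun h => by by_contra h'; exact h' (not_not.1 fun h'' => by
            have := hno a b hab h; tauto),
          fun h => by by_contra h'; exact h' (not_not.1 fun h'' => by
            have := hno b a (hsymm _ _ hab) h; tauto)⟩) z c).1 (Or.inl hzW)
      tauto
    obtain ⟨b, c, hbc, hb, hc⟩ := this
    have hbW : b ∉ W := fun hbW => hc (by
      by_cases hcW : c ∈ W
      · exact .inl hcW
      · exact .inr (mem_bd.2 ⟨hcW, b, hbW, hbc⟩))
    have hb := hb.resolve_left hbW
    obtain ⟨-, a, haW, hab⟩ := mem_bd.1 hb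
    have hcb : c ≠ b := by rintro rfl; exact hc (.inr hb)
    have hPb : P (insert b W) := by
      refine ⟨Finset.mem_insert_of_mem hzW, ?_, ?_⟩
      · have hsub : insert c ((bd W).erase b) ⊆ bd (insert b W) := by
          intro d hd
          rw [mem_bd]
          obtain rfl | hd := Finset.mem_insert.1 hd
          · exact ⟨by simp only [Finset.mem_insert]; tauto, b, by simp, hbc⟩
          · rw [Finset.mem_erase, mem_bd] at hd
            obtain ⟨h1, h2, e, he, hed⟩ := hd
            exact ⟨by simp only [Finset.mem_insert]; tauto, e, Finset.mem_insert_of_mem he, hed⟩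
        have h1 := Finset.card_le_card hsub
        rw [Finset.card_insert_of_notMem
          (fun h => hc (.inr (Finset.mem_of_mem_erase h))), Finset.card_erase_of_mem hb] at h1
        omega
      · intro s hs
        have h1 := hWc s fun a ha b hb => hs a (Finset.mem_insert_of_mem ha) b
          (Finset.mem_insert_of_mem hb)
        have h2 := hs a (Finset.mem_insert_of_mem haW) b (Finset.mem_insert_self _ _) hab
        have h3 : ∀ d ∈ insert b W, (s d ↔ s a) := by
          intro d hd
          obtain rfl | hd := Finset.mem_insert.1 hd
          · exact h2.symm
          · exact h1 d hd a haW
        intro d hd e he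
        rw [h3 d hd, h3 e he]
    exact hbW (hW.le_of_ge hPb (Finset.subset_insert b W) (Finset.mem_insert_self b W))
  -- Two of the three boundary vertices lie on one side. Without them all remaining vertices are in
  -- `W` or adjacent to it.
  obtain ⟨u, hu, v, hv, huv, hside⟩ := Finset.exists_ne_map_eq_of_card_lt_of_maps_to
    (s := bd W) (t := Finset.univ) (f := side) (by simpa using hW3) (fun _ _ => Finset.mem_coe.2 (Finset.mem_univ _))
  have huW := (mem_bd.1 hu).1
  have hvW := (mem_bd.1 hv).1
  refine ⟨u, v, huv, hside, fun s hs => ?_⟩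
  have hne : ∀ a ∈ W, a ≠ u ∧ a ≠ v := fun a ha =>
    ⟨by rintro rfl; exact huW ha, by rintro rfl; exact hvW ha⟩
  have h1 := hWc s fun a ha b hb =>
    hs a b (hne a ha).1 (hne a ha).2 (hne b hb).1 (hne b hb).2
  have h2 : ∀ a, a ≠ u → a ≠ v → (s a ↔ s z) := by
    intro a hau hav
    obtain ha | ha := hcover a
    · exact h1 a ha z hzW
    · obtain ⟨-, b, hb, hba⟩ := mem_bd.1 ha
      rw [← hs b a (hne b hb).1 (hne b hb).2 hau hav hba]
      exact h1 b hb z hzW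
  intro a b h3 h4 h5 h6
  rw [h2 a h3 h4, h2 b h5 h6]

namespace Matrix

section Connected

variable {R : Type*} [CommRing R] {X Y : Type*}

/-- The bipartite graph of the nonzero entries of `D` is connected. -/
def IsConnected (D : Matrix X Y R) : Prop :=
  ∀ (s : X → Prop) (t : Y → Prop), (∀ x y, D x y ≠ 0 → (s x ↔ t y)) →
    ((∀ x, s x) ∧ ∀ y, t y) ∨ ((∀ x, ¬s x) ∧ ∀ y, ¬t y)

/-- Some row or column of `D` has at least three nonzero entries. -/
def HasTriple (D : Matrix X Y R) : Prop :=
  (∃ x, ∃ N : Finset Y, 2 < N.card ∧ ∀ y ∈ N, D x y ≠ 0) ∨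
    ∃ y, ∃ N : Finset X, 2 < N.card ∧ ∀ x ∈ N, D x y ≠ 0

theorem IsConnected.pivot [DecidableEq X] [DecidableEq Y] [Nontrivial R] {H : Subgroup Rˣ}
    {D : Matrix X Y R} (h : D.IsConnected) (hD : ∀ i j, UnitOrZero H (D i j)) {x : X} {y : Y}
    (hxy : D x y ≠ 0) : (pivot D x y).IsConnected := fun s t hst =>
  h s t fun i j hij => iff_of_pivot hD (Set.mem_univ y) hxy (fun i j _ => hst i j) i j
    (Set.mem_univ j) hij

theorem IsConnected.exists_pair [Finite X] [Finite Y] {D : Matrix X Y R} (h : D.IsConnected)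
    (hD : D.HasTriple) :
    (∃ u v, u ≠ v ∧ D.RowConnected {j | j ≠ u ∧ j ≠ v}) ∨
      ∃ u v, u ≠ v ∧ Dᵀ.RowConnected {i | i ≠ u ∧ i ≠ v} := by
  classical
  set adj : X ⊕ Y → X ⊕ Y → Prop := fun a b =>
    (∃ x y, D x y ≠ 0 ∧ a = .inl x ∧ b = .inr y) ∨ ∃ x y, D x y ≠ 0 ∧ b = .inl x ∧ a = .inr y
    with hadj
  have hsymm : ∀ a b, adj a b → adj b a := fun a b => Or.symm
  have hconn : ∀ s : X ⊕ Y → Prop, (∀ a b, adj a b → (s a ↔ s b)) → ∀ a b, s a ↔ s b := by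
    intro s hs
    have := h (fun x => s (.inl x)) (fun y => s (.inr y))
      fun x y hxy => hs _ _ (.inl ⟨x, y, hxy, rfl, rfl⟩)
    obtain ⟨h1, h2⟩ | ⟨h1, h2⟩ := this
    · have h3 : ∀ a, s a := Sum.forall.2 ⟨h1, h2⟩
      exact fun a b => iff_of_true (h3 a) (h3 b)
    · have h3 : ∀ a, ¬s a := Sum.forall.2 ⟨h1, h2⟩
      exact fun a b => iff_of_false (h3 a) (h3 b)
  obtain ⟨z, N, hN, hN3⟩ : ∃ (z : X ⊕ Y) (N : Finset (X ⊕ Y)), (∀ a ∈ N, adj z a ∧ a ≠ z) ∧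
      2 < N.card := by
    obtain ⟨x, N, hN3, hN⟩ | ⟨y, N, hN3, hN⟩ := hD
    · refine ⟨.inl x, N.map .inr, fun a ha => ?_, by simpa⟩
      obtain ⟨y, hy, rfl⟩ := Finset.mem_map.1 ha
      exact ⟨.inl ⟨x, y, hN y hy, rfl, rfl⟩, by simp⟩
    · refine ⟨.inr y, N.map .inl, fun a ha => ?_, by simpa⟩
      obtain ⟨x, hx, rfl⟩ := Finset.mem_map.1 ha
      exact ⟨.inr ⟨x, y, hN x hx, rfl, rfl⟩, by simp⟩
  obtain ⟨u, v, huv, hside, hs⟩ := exists_pair_of_connected hsymm hconn z N hN hN3 Sum.isLeft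
  rcases u with u | u <;> rcases v with v | v
  · refine .inr ⟨u, v, fun h => huv (by rw [h]), fun s t hst y y' => ?_⟩
    refine hs (Sum.elim t s) ?_ (.inr y) (.inr y') (by simp) (by simp) (by simp) (by simp)
    rintro a b h1 h2 h3 h4 (⟨x, y, hxy, rfl, rfl⟩ | ⟨x, y, hxy, rfl, rfl⟩)
    · exact (hst y x ⟨by simpa using h1, by simpa using h2⟩ hxy).symm
    · exact hst y x ⟨by simpa using h3, by simpa using h4⟩ hxy
  · simp at hside
  · simp at hside
  · refine .inl ⟨u, v, fun h => huv (by rw [h]), fun s t hst x x' => ?_⟩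
    refine hs (Sum.elim s t) ?_ (.inl x) (.inl x') (by simp) (by simp) (by simp) (by simp)
    rintro a b h1 h2 h3 h4 (⟨x, y, hxy, rfl, rfl⟩ | ⟨x, y, hxy, rfl, rfl⟩)
    · exact hst x y ⟨by simpa using h3, by simpa using h4⟩ hxy
    · exact (hst x y ⟨by simpa using h1, by simpa using h2⟩ hxy).symm

variable [Fintype X] [Fintype Y] [DecidableEq X] [DecidableEq Y]

/-- Each line of a full 2 × 2 square is already saturated, so the square is a component of its own.
-/
theorem IsConnected.card_le_two_of_square {D : Matrix X Y R} (h : D.IsConnected)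
    (hD : ¬D.HasTriple) {x x' : X} {y y' : Y} (hx : x ≠ x') (hy : y ≠ y') (h1 : D x y ≠ 0)
    (h2 : D x y' ≠ 0) (h3 : D x' y ≠ 0) (h4 : D x' y' ≠ 0) :
    Fintype.card X ≤ 2 ∧ Fintype.card Y ≤ 2 := by
  have hrow : ∀ i j, D i y ≠ 0 → D i y' ≠ 0 → D i j ≠ 0 → j = y ∨ j = y' := by
    intro i j e1 e2 e3
    by_contra hcon
    push Not at hcon
    refine hD (.inl ⟨i, {y, y', j}, ?_, ?_⟩)
    · rw [Finset.card_eq_three.2 ⟨y, y', j, hy, hcon.1.symm, hcon.2.symm, rfl⟩]; omega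
    · simp [e1, e2, e3]
  have hcol : ∀ i j, D x j ≠ 0 → D x' j ≠ 0 → D i j ≠ 0 → i = x ∨ i = x' := by
    intro i j e1 e2 e3
    by_contra hcon
    push Not at hcon
    refine hD (.inr ⟨j, {x, x', i}, ?_, ?_⟩)
    · rw [Finset.card_eq_three.2 ⟨x, x', i, hx, hcon.1.symm, hcon.2.symm, rfl⟩]; omega
    · simp [e1, e2, e3]
  have key := h (fun i => i = x ∨ i = x') (fun j => j = y ∨ j = y') fun i j hij => by
    constructor
    · rintro (rfl | rfl)
      · exact hrow _ _ h1 h2 hij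
      · exact hrow _ _ h3 h4 hij
    · rintro (rfl | rfl)
      · exact hcol _ _ h1 h3 hij
      · exact hcol _ _ h2 h4 hij
  obtain ⟨k1, k2⟩ | ⟨k1, -⟩ := key
  · constructor
    · rw [← Finset.card_univ]
      exact (Finset.card_le_card fun i _ => by simpa using k1 i).trans
        (Finset.card_le_two (a := x) (b := x'))
    · rw [← Finset.card_univ]
      exact (Finset.card_le_card fun i _ => by simpa using k2 i).trans
        (Finset.card_le_two (a := y) (b := y'))
  · exact absurd (.inl rfl) (k1 x)

theorem card_le_two_of_forall {Z : Type*} [Fintype Z] {P : Z → Prop}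
    (hN : ∀ N : Finset Z, 2 < N.card → ¬∀ a ∈ N, P a) (hP : ∀ a, P a) : Fintype.card Z ≤ 2 := by
  by_contra hcon
  exact hN Finset.univ (by rw [Finset.card_univ]; omega) fun a _ => hP a

theorem card_le_two_of_forall_eq {Z : Type*} [Fintype Z] (a : Z) (ha : ∀ b, b = a) :
    Fintype.card Z ≤ 2 := by
  have := Fintype.card_le_one_iff.2 fun b c => (ha b).trans (ha c).symm
  omega

theorem IsConnected.card_le_two [Nontrivial R] {H : Subgroup Rˣ} {D : Matrix X Y R}
    (h : D.IsConnected) (h0 : D ≠ 0) (hH : ∀ i j, UnitOrZero H (D i j)) (hD : ¬D.HasTriple)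
    (hD' : ∀ x y, D x y ≠ 0 → ¬(Matrix.pivot D x y).HasTriple) :
    Fintype.card X ≤ 2 ∧ Fintype.card Y ≤ 2 := by
  by_cases hpath : ∃ x x' y y', x ≠ x' ∧ y ≠ y' ∧ D x y ≠ 0 ∧ D x y' ≠ 0 ∧ D x' y ≠ 0
  · obtain ⟨x, x', y, y', hx, hy, h1, h2, h3⟩ := hpath
    -- Three nonzero entries in a 2 × 2 submatrix: if the fourth is zero, the pivot on `(x, y)`
    -- fills it and produces a square.
    by_cases h4 : D x' y' = 0
    · refine (h.pivot hH h1).card_le_two_of_square (hD' x y h1) hx hy ?_ ?_ ?_ ?_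
      · rw [pivot_self]; exact (hH _ _).inverse_ne_zero h1
      · rw [pivot_row _ hy.symm]
        exact (hH _ _).inverse.mul_ne_zero ((hH _ _).inverse_ne_zero h1) h2
      · rw [pivot_col _ hx.symm, neg_ne_zero]
        exact (hH _ _).mul_ne_zero h3 ((hH _ _).inverse_ne_zero h1)
      · rw [pivot_of_ne _ hx.symm hy.symm, h4, zero_sub, neg_ne_zero]
        exact ((hH _ _).mul (hH _ _).inverse).mul_ne_zero
          ((hH _ _).mul_ne_zero h3 ((hH _ _).inverse_ne_zero h1)) h2
    · exact h.card_le_two_of_square hD hx hy h1 h2 h3 h4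
  have hedge : ∀ x x' y y', D x y ≠ 0 → D x y' ≠ 0 → D x' y ≠ 0 → x = x' ∨ y = y' := by
    intro x x' y y' h1 h2 h3
    by_contra hcon
    push Not at hcon
    exact hpath ⟨x, x', y, y', hcon.1, hcon.2, h1, h2, h3⟩
  obtain ⟨x, y, hxy⟩ : ∃ x y, D x y ≠ 0 := by
    by_contra hcon
    push Not at hcon
    exact h0 (by ext i j; exact hcon i j)
  -- Without a path of three edges the graph is a star, centred at `y` or at `x`; its centre has at
  -- most two neighbours.
  by_cases hx : ∀ y', D x y' ≠ 0 → y' = y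
  · have key := h (fun i => D i y ≠ 0) (fun j => j = y) fun i j hij => by
      refine ⟨fun hi => ?_, by rintro rfl; exact hij⟩
      obtain rfl | rfl := hedge i x y j hi hij hxy
      · exact hx j hij
      · rfl
    obtain ⟨k1, k2⟩ | ⟨k1, -⟩ := key
    · exact ⟨card_le_two_of_forall (fun N hN hP => hD (.inr ⟨y, N, hN, hP⟩)) k1, card_le_two_of_forall_eq y k2⟩
    · exact absurd hxy (k1 x)
  · push Not at hx
    obtain ⟨y', hxy', hy'⟩ := hx
    have key := h (fun i => i = x) (fun j => D x j ≠ 0) fun i j hij => by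
      refine ⟨by rintro rfl; exact hij, fun hj => ?_⟩
      by_cases hjy : j = y
      · subst hjy
        exact ((hedge x i j y' hj hxy' hij).resolve_right hy'.symm).symm
      · exact ((hedge x i j y hj hxy hij).resolve_right hjy).symm
    obtain ⟨k1, k2⟩ | ⟨k1, -⟩ := key
    · exact ⟨card_le_two_of_forall_eq x k1, card_le_two_of_forall (fun N hN hP => hD (.inl ⟨x, N, hN, hP⟩)) k2⟩
    · exact absurd rfl (k1 x)

end Connected

end Matrix

/-! ### The lift theorem -/

namespace Matrix

section Lift

variable {S R : Type*} [CommRing S] [CommRing R] [Nontrivial S] [Nontrivial R] {φ : S →+* R}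
  {K : Subgroup Sˣ} {H : Subgroup Rˣ}

section Blocks

variable {X Y : Type*} [DecidableEq X] [DecidableEq Y]

/-- A pivot acts inside one block only. The other block is described by a free predicate `s'`, so
that the lemma applies with the blocks interchanged without double negations in the subtypes. -/
theorem pivot_of_blocks {D : Matrix X Y R} {s s' : X → Prop} {t t' : Y → Prop}
    (hs : ∀ i, s' i ↔ ¬s i) (h : ∀ i j, D i j ≠ 0 → (s i ↔ t j))
    {x : X} {y : Y} (hx : s x) (hxy : D x y ≠ 0) :
    (∀ i j, pivot D x y i j ≠ 0 → (s i ↔ t j)) ∧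
    (pivot D x y).submatrix (Subtype.val : {i // s i} → X) (Subtype.val : {j // t j} → Y) =
      pivot (D.submatrix Subtype.val Subtype.val) ⟨x, hx⟩ ⟨y, (h x y hxy).1 hx⟩ ∧
    (pivot D x y).submatrix (Subtype.val : {i // s' i} → X) (Subtype.val : {j // t' j} → Y) =
      D.submatrix Subtype.val Subtype.val := by
  have hy := (h x y hxy).1 hx
  have h0 : ∀ i j, ¬(s i ↔ t j) → D i j = 0 := fun i j hij => by
    by_contra h1
    exact hij (h i j h1)
  have hrow : ∀ i j, ¬s i → pivot D x y i j = D i j := fun i j hi =>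
    pivot_of_row_eq_zero _ (by rintro rfl; exact hi hx) (h0 _ _ (by tauto))
  have hcol : ∀ i j, ¬t j → pivot D x y i j = D i j := fun i j hj =>
    pivot_of_col_eq_zero _ (by rintro rfl; exact hj hy) (h0 _ _ (by tauto))
  refine ⟨fun i j hij => ?_, ?_, ?_⟩
  · by_cases hi : s i
    · by_cases hj : t j
      · tauto
      · exact h i j (by rwa [hcol i j hj] at hij)
    · exact h i j (by rwa [hrow i j hi] at hij)
  · rw [pivot_submatrix _ Subtype.val_injective Subtype.val_injective]
  · ext i j
    exact hrow i j ((hs i).1 i.2)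

/-- Block matrices with strong blocks form a class closed under pivoting. -/
theorem isStrong_of_blocks (hK : -1 ∈ K) {D : Matrix X Y S} {s : X → Prop} {t : Y → Prop}
    (h : ∀ i j, D i j ≠ 0 → (s i ↔ t j)) [Fintype X]
    (h1 : (D.submatrix (Subtype.val : {i // s i} → X) (Subtype.val : {j // t j} → Y)).IsStrong K)
    (h2 : (D.submatrix (Subtype.val : {i // ¬s i} → X)
      (Subtype.val : {j // ¬t j} → Y)).IsStrong K) : D.IsStrong K := by
  classical
  refine isStrong_of_pivot_closed hK {E : Matrix X Y S | (∀ i j, E i j ≠ 0 → (s i ↔ t j)) ∧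
    (E.submatrix (Subtype.val : {i // s i} → X) (Subtype.val : {j // t j} → Y)).IsStrong K ∧
    (E.submatrix (Subtype.val : {i // ¬s i} → X) (Subtype.val : {j // ¬t j} → Y)).IsStrong K}
    ?_ ?_ ⟨h, h1, h2⟩
  · rintro E ⟨h, h1, h2⟩ x y
    by_cases hxy : E x y = 0
    · exact .inl hxy
    by_cases hx : s x
    · exact h1.apply ⟨x, hx⟩ ⟨y, (h x y hxy).1 hx⟩
    · exact h2.apply ⟨x, hx⟩ ⟨y, fun hy => hx ((h x y hxy).2 hy)⟩
  · rintro E ⟨h, h1, h2⟩ x y hxy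
    by_cases hx : s x
    · obtain ⟨k1, k2, k3⟩ := pivot_of_blocks (s' := fun i => ¬s i) (t' := fun j => ¬t j)
        (fun _ => Iff.rfl) h hx hxy
      refine ⟨k1, ?_, ?_⟩
      · rw [k2]; exact h1.pivot hK hxy
      · rw [k3]; exact h2
    · obtain ⟨k1, k2, k3⟩ := pivot_of_blocks (s := fun i => ¬s i) (t := fun j => ¬t j) (s' := s)
        (t' := t) (fun _ => not_not.symm) (fun i j hij => not_congr (h i j hij)) hx hxy
      refine ⟨fun i j hij => not_iff_not.1 (k1 i j hij), ?_, ?_⟩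
      · rw [k3]; exact h1
      · rw [k2]; exact h2.pivot hK hxy

theorem hasStrongLift_of_blocks (hK : -1 ∈ K) [Fintype X] {D : Matrix X Y R} {s : X → Prop}
    {t : Y → Prop} (h : ∀ i j, D i j ≠ 0 → (s i ↔ t j))
    (h1 : HasStrongLift φ K
      (D.submatrix (Subtype.val : {i // s i} → X) (Subtype.val : {j // t j} → Y)))
    (h2 : HasStrongLift φ K
      (D.submatrix (Subtype.val : {i // ¬s i} → X) (Subtype.val : {j // ¬t j} → Y))) :
    HasStrongLift φ K D := by
  classical
  obtain ⟨A, hA, hAD⟩ := h1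
  obtain ⟨B, hB, hBD⟩ := h2
  have hA' : ∀ i j, φ (A i j) = D i j := fun i j => congrFun (congrFun hAD i) j
  have hB' : ∀ i j, φ (B i j) = D i j := fun i j => congrFun (congrFun hBD i) j
  set E : Matrix X Y S := of fun i j =>
    if h : s i ∧ t j then A ⟨i, h.1⟩ ⟨j, h.2⟩
    else if h' : ¬s i ∧ ¬t j then B ⟨i, h'.1⟩ ⟨j, h'.2⟩ else 0 with hE
  have e1 : E.submatrix (Subtype.val : {i // s i} → X) (Subtype.val : {j // t j} → Y) = A := by
    ext ⟨i, hi⟩ ⟨j, hj⟩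
    simp [hE, hi, hj]
  have e2 : E.submatrix (Subtype.val : {i // ¬s i} → X) (Subtype.val : {j // ¬t j} → Y) = B := by
    ext ⟨i, hi⟩ ⟨j, hj⟩
    simp [hE, hi, hj]
  refine ⟨E, isStrong_of_blocks hK (s := s) (t := t) (fun i j hij => ?_) (e1 ▸ hA) (e2 ▸ hB), ?_⟩
  · by_contra hc
    refine hij ?_
    by_cases hi : s i <;> by_cases hj : t j <;> simp_all
  · ext i j
    by_cases hi : s i <;> by_cases hj : t j
    · simp [hE, hi, hj, hA']
    · have := not_imp_not.2 (h i j) (by tauto)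
      simp [hE, hi, hj, not_not.1 this]
    · have := not_imp_not.2 (h i j) (by tauto)
      simp [hE, hi, hj, not_not.1 this]
    · simp [hE, hi, hj, hB']

end Blocks

theorem eq_or_eq_of_card_le_two {Z : Type*} [Fintype Z] (h : Fintype.card Z ≤ 2) {a b : Z}
    (hab : a ≠ b) (c : Z) : c = a ∨ c = b := by
  classical
  by_contra hcon
  push Not at hcon
  have h1 := Finset.card_eq_three.2 ⟨a, b, c, hab, hcon.1.symm, hcon.2.symm, rfl⟩
  have := Finset.card_le_univ ({a, b, c} : Finset Z)
  omega

theorem isStrong_of_card_le_two {X Y : Type*} [Fintype X] (hX : Fintype.card X ≤ 2)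
    {D : Matrix X Y S} (h1 : ∀ i j, UnitOrZero K (D i j))
    (h2 : ∀ i i' j j', i ≠ i' → j ≠ j' → UnitOrZero K (D i j * D i' j' - D i j' * D i' j)) :
    D.IsStrong K := by
  intro k f g
  refine unitOrZero_det_of_injective D f g fun hf hg => ?_
  have hk := Fintype.card_le_of_injective f hf
  rw [Fintype.card_fin] at hk
  match k with
  | 0 => simpa using UnitOrZero.one
  | 1 => simpa using h1 (f 0) (g 0)
  | 2 =>
    rw [det_fin_two]
    exact h2 _ _ _ _ (hf.ne (by decide)) (hg.ne (by decide))
  | k + 3 => omega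

theorem isStrong_zero {X Y : Type*} : (0 : Matrix X Y S).IsStrong K := by
  intro k f g
  rcases k with - | k
  · simpa using UnitOrZero.one
  · rw [det_eq_zero_of_column_eq_zero 0 (by simp)]
    exact .zero

theorem _root_.UnitOrZero.sub_of_eq_zero (hK : -1 ∈ K) {a b : S} (ha : UnitOrZero K a)
    (hb : UnitOrZero K b) (h : a = 0 ∨ b = 0) : UnitOrZero K (a - b) := by
  obtain rfl | rfl := h
  · simpa using hb.neg hK
  · simpa using ha

/-- Entries lift one by one. Only a full 2 × 2 matrix imposes a condition, and it is met by choosing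
the last entry so that the cross ratio is a fundamental lift of the given one. -/
theorem hasStrongLift_of_card_le_two (L : IsLifting φ K H) {X Y : Type*} [Fintype X] [Fintype Y]
    (hX : Fintype.card X ≤ 2) (hY : Fintype.card Y ≤ 2) {D : Matrix X Y R} (hD : D.IsStrong H) :
    HasStrongLift φ K D := by
  classical
  have hl : ∀ i j, ∃ a : S, UnitOrZero K a ∧ φ a = D i j := by
    intro i j
    obtain h0 | ⟨u, hu, h⟩ := hD.apply i j
    · exact ⟨0, .zero, by rw [h0, map_zero]⟩
    · obtain ⟨v, hv, hvu⟩ := L.surj u hu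
      exact ⟨v, .of_mem hv, hvu.trans h⟩
  choose E hE hED using hl
  have hE0 : ∀ i j, D i j = 0 → E i j = 0 := fun i j h => by
    rwa [← (hE i j).map_eq_zero (φ := φ), hED]
  by_cases hfull : ∃ x x' y y', x ≠ x' ∧ y ≠ y' ∧ D x y ≠ 0 ∧ D x y' ≠ 0 ∧ D x' y ≠ 0 ∧ D x' y' ≠ 0
  swap
  · refine ⟨of E, isStrong_of_card_le_two hX hE fun i i' j j' hi hj => ?_, by ext i j; exact hED i j⟩
    refine .sub_of_eq_zero L.neg_one_mem ((hE _ _).mul (hE _ _)) ((hE _ _).mul (hE _ _)) ?_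
    by_contra hcon
    push Not at hcon
    refine hfull ⟨i, i', j, j', hi, hj, fun h => hcon.1 ?_, fun h => hcon.2 ?_, fun h => hcon.2 ?_,
      fun h => hcon.1 ?_⟩ <;> simp [hE0 _ _ h]
  obtain ⟨x, x', y, y', hx, hy, h1, h2, h3, h4⟩ := hfull
  have hE' : ∀ i j, D i j ≠ 0 → E i j ≠ 0 := fun i j h h0 => h (by rw [← hED, h0, map_zero])
  obtain ⟨f, hf, hfD⟩ := hD.hasFundamentalRatio L.neg_one_mem' h1 h2 h3 h4
  obtain ⟨g, hg, rfl⟩ := L.exists_fundamental f hf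
  have hi := (hE x y).mul_inverse (hE' x y h1)
  -- Solves `g * (E x y' * E x' y) = E x y * e` for the corner entry `e`.
  set e := g * (E x y' * E x' y) * Ring.inverse (E x y) with he
  have heu : UnitOrZero K e := (hg.1.mul ((hE _ _).mul (hE _ _))).mul (hE _ _).inverse
  have hge : g * (E x y' * E x' y) = E x y * e := by
    rw [he]
    linear_combination -(g * (E x y' * E x' y)) * hi
  have hφe : φ e = D x' y' := by
    refine ((hD.apply x y).isUnit h1).mul_right_inj.1 ?_
    rw [← hfD, ← hED, ← hED, ← hED, ← map_mul, ← hge, map_mul, map_mul]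
  set F : Matrix X Y S := of fun i j => if i = x' ∧ j = y' then e else E i j with hF
  have hFu : ∀ i j, UnitOrZero K (F i j) := by
    intro i j
    simp only [hF, of_apply]
    split_ifs
    · exact heu
    · exact hE i j
  have hdet : UnitOrZero K (F x y * F x' y' - F x y' * F x' y) := by
    have : F x y * F x' y' - F x y' * F x' y = E x y * e - E x y' * E x' y := by
      simp [hF, hx, hy]
    rw [this]
    exact HasFundamentalRatio.det ⟨g, hg, hge⟩ L.neg_one_mem (hE _ _) (hE _ _)
  refine ⟨F, isStrong_of_card_le_two hX hFu fun i i' j j' hii hjj => ?_, ?_⟩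
  · obtain rfl | rfl := eq_or_eq_of_card_le_two hX hx i <;>
    obtain rfl | rfl := eq_or_eq_of_card_le_two hX hx i' <;>
    obtain rfl | rfl := eq_or_eq_of_card_le_two hY hy j <;>
    obtain rfl | rfl := eq_or_eq_of_card_le_two hY hy j' <;>
    first
    | exact absurd rfl hii
    | exact absurd rfl hjj
    | exact hdet
    | (convert hdet using 1; ring1)
    | (convert hdet.neg L.neg_one_mem using 1; ring1)
  · ext i j
    by_cases hij : i = x' ∧ j = y'
    · obtain ⟨rfl, rfl⟩ := hij
      simp [hF, hφe]
    · simp [hF, hij, hED]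

theorem HasStrongLift.transpose {X Y : Type*} {D : Matrix X Y R} (h : HasStrongLift φ K D) :
    HasStrongLift φ K Dᵀ := by
  obtain ⟨E, hE, hED⟩ := h
  exact ⟨Eᵀ, hE.transpose, by rw [transpose_map, hED]⟩

/-- Pivoting is an involution that preserves strongness and commutes with `φ`, so a lift of the
pivot can be pivoted back. -/
theorem HasStrongLift.of_pivot (hK : -1 ∈ K) {X Y : Type*} [Fintype X] [DecidableEq X]
    [DecidableEq Y] {D : Matrix X Y R} {x : X} {y : Y} (hD : UnitOrZero H (D x y)) (h0 : D x y ≠ 0)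
    (h : HasStrongLift φ K (pivot D x y)) : HasStrongLift φ K D := by
  obtain ⟨E, hE, hED⟩ := h
  have h1 : φ (E x y) = Ring.inverse (D x y) := by
    rw [← pivot_self D, ← hED, map_apply]
  have h2 : E x y ≠ 0 := fun h => hD.inverse_ne_zero h0 (by rw [← h1, h, map_zero])
  refine ⟨pivot E x y, hE.pivot hK h2, ?_⟩
  rw [pivot_map _ _ ((hE.apply _ _).isUnit h2), hED, pivot_pivot _ (hD.isUnit h0)]

theorem card_subtype_ne {Z : Type*} [Fintype Z] [DecidableEq Z] (u : Z) :
    Fintype.card {z // z ≠ u} < Fintype.card Z :=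
  Fintype.card_subtype_lt (x := u) (by simp)

/-- Strong matrices can be lifted. -/
theorem IsStrong.hasStrongLift_of_card (L : IsLifting φ K H) (n : ℕ) {X Y : Type} [Fintype X]
    [Fintype Y] {D : Matrix X Y R} (hD : D.IsStrong H)
    (hn : Fintype.card X + Fintype.card Y = n) : HasStrongLift φ K D := by
  classical
  induction n using Nat.strong_induction_on generalizing X Y with
  | _ n ih =>
  by_cases hc : D.IsConnected
  swap
  · simp only [IsConnected, not_forall] at hc
    obtain ⟨s, t, hst, hne⟩ := hc
    have hX1 := Fintype.card_subtype_le s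
    have hY1 := Fintype.card_subtype_le t
    have hX2 := Fintype.card_subtype_le fun x => ¬s x
    have hY2 := Fintype.card_subtype_le fun y => ¬t y
    rw [not_or] at hne
    refine hasStrongLift_of_blocks L.neg_one_mem hst (ih _ ?_ (hD.submatrix _ _) rfl)
      (ih _ ?_ (hD.submatrix _ _) rfl)
    · obtain ⟨x, hx⟩ | ⟨y, hy⟩ : (∃ x, ¬s x) ∨ ∃ y, ¬t y := by
        by_contra hcon
        push Not at hcon
        exact hne.1 hcon
      · have := Fintype.card_subtype_lt hx
        omega
      · have := Fintype.card_subtype_lt hy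
        omega
    · obtain ⟨x, hx⟩ | ⟨y, hy⟩ : (∃ x, s x) ∨ ∃ y, t y := by
        by_contra hcon
        push Not at hcon
        exact hne.2 hcon
      · have := Fintype.card_subtype_lt (p := fun x => ¬s x) (not_not.2 hx)
        omega
      · have := Fintype.card_subtype_lt (p := fun y => ¬t y) (not_not.2 hy)
        omega
  have key : ∀ E : Matrix X Y R, E.IsStrong H → E.IsConnected → E.HasTriple →
      HasStrongLift φ K E := by
    intro E hE hEc hE3
    obtain ⟨u, v, huv, h⟩ | ⟨u, v, huv, h⟩ := hEc.exists_pair hE3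
    · have hu := card_subtype_ne u
      have hv := card_subtype_ne v
      exact hasStrongLift_of_columns L hE huv h (ih _ (by omega) (hE.submatrix _ _) rfl)
        (ih _ (by omega) (hE.submatrix _ _) rfl)
    · have hu := card_subtype_ne u
      have hv := card_subtype_ne v
      exact (hasStrongLift_of_columns L hE.transpose huv h
        (ih _ (by omega) (hE.transpose.submatrix _ _) rfl)
        (ih _ (by omega) (hE.transpose.submatrix _ _) rfl)).transpose
  by_cases hD3 : D.HasTriple
  · exact key D hD hc hD3
  by_cases hP : ∃ x y, D x y ≠ 0 ∧ (Matrix.pivot D x y).HasTriple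
  · obtain ⟨x, y, hxy, hP⟩ := hP
    exact .of_pivot L.neg_one_mem (hD.apply x y) hxy
      (key _ (hD.pivot L.neg_one_mem' hxy) (hc.pivot hD.apply hxy) hP)
  push Not at hP
  by_cases h0 : D = 0
  · subst h0
    exact ⟨0, isStrong_zero, by ext; simp⟩
  obtain ⟨hX, hY⟩ := hc.card_le_two h0 hD.apply hD3 hP
  exact hasStrongLift_of_card_le_two L hX hY hD

/-- The induction also treats transposes, which requires row and column types in one universe;
arbitrary finite index types are transported to `Fin`. -/
theorem IsStrong.hasStrongLift (L : IsLifting φ K H) {X Y : Type*} [Finite X] [Finite Y]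
    {D : Matrix X Y R} (hD : D.IsStrong H) : HasStrongLift φ K D := by
  have e := Finite.equivFin X
  have e' := Finite.equivFin Y
  obtain ⟨E, hE, hED⟩ := IsStrong.hasStrongLift_of_card L _ (hD.submatrix e.symm e'.symm) rfl
  refine ⟨E.submatrix e e', hE.submatrix _ _, ?_⟩
  rw [← submatrix_map, hED]
  ext i j
  simp

end Lift

end Matrix

/-! ### Homomorphisms to rings and the calculus of defined sums -/

namespace PartialField

section HomToRing

variable {P : Type*} [PartialField P] {R : Type*} [CommRing R]

/-- Maps from a partial field to a ring that preserve the unit, products and defined sums. -/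
structure IsHomToRing (f : P → R) : Prop where
  map_one : f 1 = 1
  map_mul : ∀ p q, f (p * q) = f p * f q
  map_padd : ∀ p q r, r ∈ padd p q → f r = f p + f q

namespace IsHomToRing

variable {f : P → R} (hf : IsHomToRing f)

include hf

theorem map_zero : f 0 = 0 := by
  have := hf.map_padd 0 0 0 (by rw [padd_zero]; exact Part.mem_some 0)
  simpa using this

theorem map_neg (p : P) : f (-p) = -f p := by
  have := hf.map_padd _ _ _ (zero_mem_padd_neg p)
  rw [hf.map_zero] at this
  linear_combination -this

theorem map_prod {ι : Type*} (s : Finset ι) (g : ι → P) : f (∏ i ∈ s, g i) = ∏ i ∈ s, f (g i) := by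
  classical
  induction s using Finset.induction_on with
  | empty => simpa using hf.map_one
  | insert a s ha ih => rw [Finset.prod_insert ha, Finset.prod_insert ha, hf.map_mul, ih]

theorem mul_inv_eq_one {p : P} (hp : p ≠ 0) : f p * f p⁻¹ = 1 := by
  rw [← hf.map_mul, mul_inv_cancel₀ hp, hf.map_one]

theorem isUnit {p : P} (hp : p ≠ 0) : IsUnit (f p) :=
  IsUnit.of_mul_eq_one _ (hf.mul_inv_eq_one hp)

theorem ringInverse {p : P} (hp : p ≠ 0) : Ring.inverse (f p) = f p⁻¹ := by
  have h1 := Ring.mul_inverse_cancel _ (hf.isUnit hp)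
  have h2 := hf.mul_inv_eq_one hp
  linear_combination f p⁻¹ * h1 - Ring.inverse (f p) * h2

theorem ne_zero_iff [Nontrivial R] {p : P} : f p ≠ 0 ↔ p ≠ 0 :=
  ⟨fun h h0 => h (by rw [h0, hf.map_zero]), fun h => (hf.isUnit h).ne_zero⟩

theorem association {S : Multiset P} {r : P} (h : Association padd S r) :
    f r = (S.map f).sum := by
  induction h with
  | leaf p => simp
  | node _ _ h3 ih1 ih2 => simp [hf.map_padd _ _ _ h3, ih1, ih2]

theorem sumsTo {S : Multiset P} {r : P} (h : SumsTo S r) : f r = (S.map f).sum := by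
  obtain ⟨Z, hZ⟩ := h
  rw [hf.association hZ, Multiset.map_add, Multiset.map_add, Multiset.sum_add, Multiset.sum_add,
    Multiset.map_map]
  simp [hf.map_neg]

theorem sum_detTerms {n : Type*} [Fintype n] [DecidableEq n] (A : Matrix n n P) :
    ((detTerms A).map f).sum = (A.map f).det := by
  rw [← Matrix.det_transpose, Matrix.det_apply', detTerms, Multiset.map_map]
  refine Finset.sum_congr rfl fun σ _ => ?_
  rw [Function.comp_apply]
  split_ifs with h
  · rw [h, hf.map_prod]
    simp
  · rw [(Int.units_eq_one_or _).resolve_left h, hf.map_neg, hf.map_prod]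
    simp

theorem hasDet {n : Type*} [Fintype n] [DecidableEq n] {A : Matrix n n P} {d : P}
    (h : HasDet A d) : (A.map f).det = f d := by
  rw [hf.sumsTo h, hf.sum_detTerms]

end IsHomToRing

end HomToRing

section SumsTo

variable {P : Type*} [PartialField P]

theorem SumsTo.add {S T : Multiset P} {r s t : P} (hS : SumsTo S r) (hT : SumsTo T s)
    (h : t ∈ padd r s) : SumsTo (S + T) t := by
  obtain ⟨Z, hZ⟩ := hS
  obtain ⟨W, hW⟩ := hT
  refine ⟨Z + W, ?_⟩
  convert Association.node hZ hW h using 1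
  rw [Multiset.map_add]
  abel

theorem sumsTo_singleton (p : P) : SumsTo {p} p := ⟨0, by simpa using Association.leaf p⟩

/-- Associations have at least one leaf, so a cancelling pair such as `1, -1` has to be inserted. -/
theorem sumsTo_zero : SumsTo (0 : Multiset P) 0 := by
  refine ⟨{1}, ?_⟩
  simpa using Association.node (Association.leaf 1) (Association.leaf (-1))
    (zero_mem_padd_neg (1 : P))

theorem SumsTo.of_add_neg {S T : Multiset P} {r : P}
    (h : SumsTo (S + (T + T.map fun z => -z)) r) : SumsTo S r := by
  obtain ⟨Z, hZ⟩ := h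
  refine ⟨T + Z, ?_⟩
  convert hZ using 1
  rw [Multiset.map_add]
  abel

theorem mul_neg_eq (p q : P) : p * -q = -(p * q) := by
  by_cases hp : p = 0
  · subst hp
    have h : (0 : P) ∈ padd 0 0 := by rw [padd_zero]; exact Part.mem_some 0
    rw [zero_mul, zero_mul]
    exact eq_neg_of_zero_mem_padd _ _ h
  · refine eq_neg_of_zero_mem_padd _ _ ?_
    rw [mul_padd _ _ _ hp, Part.mem_map_iff]
    exact ⟨0, zero_mem_padd_neg q, mul_zero p⟩

theorem Association.mul {p : P} (hp : p ≠ 0) {S : Multiset P} {r : P}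
    (h : Association padd S r) : Association padd (S.map fun q => p * q) (p * r) := by
  induction h with
  | leaf q => simpa using Association.leaf (p * q)
  | node _ _ h3 ih1 ih2 =>
    rw [Multiset.map_add]
    refine .node ih1 ih2 ?_
    rw [mul_padd _ _ _ hp, Part.mem_map_iff]
    exact ⟨_, h3, rfl⟩

theorem sumsTo_map_zero (S : Multiset P) : SumsTo (S.map fun _ => (0 : P)) 0 := by
  induction S using Multiset.induction_on with
  | empty => exact sumsTo_zero
  | cons a S ih =>
    rw [Multiset.map_cons, ← Multiset.singleton_add]
    exact (sumsTo_singleton 0).add ih (by rw [padd_zero]; exact Part.mem_some 0)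

theorem SumsTo.mul (p : P) {S : Multiset P} {r : P} (h : SumsTo S r) :
    SumsTo (S.map fun q => p * q) (p * r) := by
  by_cases hp : p = 0
  · subst hp
    simpa using sumsTo_map_zero S
  obtain ⟨Z, hZ⟩ := h
  refine ⟨Z.map fun q => p * q, ?_⟩
  simpa [Multiset.map_add, Multiset.map_map, mul_neg_eq] using Association.mul hp hZ

theorem neg_eq_mul (p : P) : -p = p * -1 := by rw [mul_neg_eq, mul_one]

theorem neg_neg_eq (p : P) : - -p = p :=
  (eq_neg_of_zero_mem_padd _ _ (padd_comm _ _ _ (zero_mem_padd_neg p))).symm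

end SumsTo

/-! ### The universal ring of a partial field -/

section Universal

variable (P : Type*) [PartialField P]

/-- The ring relations that come from the defined sums of `P`. -/
def universalRelations : Set (MonoidAlgebra ℤ P) :=
  {x | ∃ p q r : P, r ∈ padd p q ∧
    x = MonoidAlgebra.of ℤ P p + MonoidAlgebra.of ℤ P q - MonoidAlgebra.of ℤ P r}

/-- The universal ring that `P` maps to. -/
abbrev UniversalRing : Type _ := MonoidAlgebra ℤ P ⧸ Ideal.span (universalRelations P)

variable {P}

/-- The canonical map from `P` to its universal ring. -/
noncomputable def toUniversal (p : P) : UniversalRing P := Ideal.Quotient.mk _ (MonoidAlgebra.of ℤ P p)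

theorem isHomToRing_toUniversal : IsHomToRing (toUniversal (P := P)) where
  map_one := by simp only [toUniversal, map_one]
  map_mul p q := by simp only [toUniversal, map_mul]
  map_padd p q r h := by
    simp only [toUniversal, ← map_add]
    have : MonoidAlgebra.of ℤ P p + MonoidAlgebra.of ℤ P q - MonoidAlgebra.of ℤ P r ∈
        universalRelations P := ⟨p, q, r, h, rfl⟩
    exact (Ideal.Quotient.eq.2 (Ideal.subset_span this)).symm

/-- The formal sum of a multiset. -/
noncomputable def formalSum (S : Multiset P) : MonoidAlgebra ℤ P :=
  (S.map (MonoidAlgebra.of ℤ P)).sum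

theorem formalSum_add (S T : Multiset P) : formalSum (S + T) = formalSum S + formalSum T := by
  simp [formalSum]

theorem formalSum_injective : Function.Injective (formalSum (P := P)) := by
  classical
  have key : ∀ (S : Multiset P) (p : P), (formalSum S).coeff p = S.count p := by
    intro S p
    induction S using Multiset.induction_on with
    | empty => simp [formalSum]
    | cons a S ih =>
      rw [← Multiset.singleton_add, formalSum_add, MonoidAlgebra.coeff_add, Finsupp.add_apply, ih,
        Multiset.count_add, Multiset.count_singleton]
      simp [formalSum, Finsupp.single_apply, eq_comm]
  intro S T h
  ext p
  have := key S p
  rw [h, key] at this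
  exact_mod_cast this.symm

/-- The differences of formal sums for which `S` and `-T` together sum to 0 form an ideal containing
the relations: defined sums can be added, negated and multiplied by elements of `P`. -/
theorem exists_of_mem_span {x : MonoidAlgebra ℤ P} (hx : x ∈ Ideal.span (universalRelations P)) :
    ∃ S T : Multiset P, x = formalSum S - formalSum T ∧ SumsTo (S + T.map fun z => -z) 0 := by
  have hadd : ∀ x y : MonoidAlgebra ℤ P,
      (∃ S T : Multiset P, x = formalSum S - formalSum T ∧ SumsTo (S + T.map fun z => -z) 0) →
      (∃ S T : Multiset P, y = formalSum S - formalSum T ∧ SumsTo (S + T.map fun z => -z) 0) →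
      ∃ S T : Multiset P, x + y = formalSum S - formalSum T ∧ SumsTo (S + T.map fun z => -z) 0 := by
    rintro x y ⟨S, T, rfl, h⟩ ⟨S', T', rfl, h'⟩
    refine ⟨S + S', T + T', ?_, ?_⟩
    · rw [formalSum_add, formalSum_add]; ring
    · convert h.add h' (t := 0) (by rw [padd_zero]; exact Part.mem_some 0) using 1
      rw [Multiset.map_add]; abel
  have hneg : ∀ x : MonoidAlgebra ℤ P,
      (∃ S T : Multiset P, x = formalSum S - formalSum T ∧ SumsTo (S + T.map fun z => -z) 0) →
      ∃ S T : Multiset P, -x = formalSum S - formalSum T ∧ SumsTo (S + T.map fun z => -z) 0 := by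
    rintro x ⟨S, T, rfl, h⟩
    refine ⟨T, S, by ring, ?_⟩
    have e : (fun q : P => -1 * q) = fun q => -q := funext fun q => (neg_eq_mul q).trans
      (mul_comm _ _) |>.symm
    have := h.mul (-1)
    rw [mul_zero, e, Multiset.map_add, Multiset.map_map, add_comm] at this
    simpa [Function.comp_def, neg_neg_eq] using this
  have hzero : ∃ S T : Multiset P, (0 : MonoidAlgebra ℤ P) = formalSum S - formalSum T ∧
      SumsTo (S + T.map fun z => -z) 0 := ⟨0, 0, by simp, by simpa using sumsTo_zero⟩
  refine Submodule.span_induction ?_ hzero (fun x y _ _ => hadd x y) ?_ hx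
  · rintro x ⟨p, q, r, h, rfl⟩
    refine ⟨{p, q}, {r}, by simp [formalSum], ?_⟩
    have := ((sumsTo_singleton p).add (sumsTo_singleton q) h).add (sumsTo_singleton (-r))
      (zero_mem_padd_neg r)
    simpa using this
  · intro a x _ hx
    rw [smul_eq_mul]
    induction a using MonoidAlgebra.induction_on with
    | of p =>
      obtain ⟨S, T, rfl, h⟩ := hx
      have hp : ∀ S : Multiset P, MonoidAlgebra.of ℤ P p * formalSum S =
          formalSum (S.map fun q => p * q) := by
        intro S
        rw [formalSum, formalSum, ← Multiset.sum_map_mul_left, Multiset.map_map]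
        simp only [Function.comp_def, map_mul]
      refine ⟨S.map fun q => p * q, T.map fun q => p * q, by rw [mul_sub, hp, hp], ?_⟩
      have := h.mul p
      simpa [Multiset.map_add, Multiset.map_map, mul_neg_eq, Function.comp_def] using this
    | add y z hy hz => rw [add_mul]; exact hadd _ _ hy hz
    | smul n y hy =>
      have hn : ∀ n : ℕ, ∃ S T : Multiset P, n • (y * x) = formalSum S - formalSum T ∧
          SumsTo (S + T.map fun z => -z) 0 := by
        intro n
        induction n with
        | zero => rw [zero_smul]; exact hzero
        | succ n ih => rw [succ_nsmul]; exact hadd _ _ ih hy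
      rw [smul_mul_assoc]
      obtain ⟨m, rfl | rfl⟩ := n.eq_nat_or_neg
      · rw [natCast_zsmul]; exact hn m
      · rw [neg_smul, natCast_zsmul]; exact hneg _ (hn m)

/-- A sum is defined as soon as it has a value in the universal ring. -/
theorem sumsTo_of_universal {S : Multiset P} {r : P}
    (h : (S.map toUniversal).sum = toUniversal r) : SumsTo S r := by
  have h1 : Ideal.Quotient.mk (Ideal.span (universalRelations P)) (formalSum S) =
      Ideal.Quotient.mk _ (MonoidAlgebra.of ℤ P r) := by
    rw [formalSum, map_multiset_sum, Multiset.map_map]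
    exact h
  obtain ⟨S', T, h2, h3⟩ := exists_of_mem_span (Ideal.Quotient.eq.1 h1)
  -- Formal sums determine their multisets, so an identity in the monoid algebra gives one of
  -- multisets. Adding `r` to the sum `S' - T = 0` then exhibits `S` together with the cancelling
  -- pairs of `T`.
  have h4 : S + T = S' + {r} := by
    refine formalSum_injective ?_
    rw [formalSum_add, formalSum_add]
    have : formalSum {r} = MonoidAlgebra.of ℤ P r := by simp [formalSum]
    rw [this]
    linear_combination h2
  have h5 := (sumsTo_singleton r).add h3 (t := r) (by rw [padd_zero]; exact Part.mem_some r)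
  refine SumsTo.of_add_neg (T := T) ?_
  rwa [← add_assoc, h4, add_comm S', add_assoc]

theorem hasDet_of_universal {n : Type*} [Fintype n] [DecidableEq n] {A : Matrix n n P} {d : P}
    (h : (A.map toUniversal).det = toUniversal d) : HasDet A d :=
  sumsTo_of_universal (by rw [(isHomToRing_toUniversal (P := P)).sum_detTerms, h])

end Universal

end PartialField

/-! ### Partial fields embedded in rings -/

namespace PartialField

section Embedding

variable {P : Type*} [PartialField P] {R : Type*} [CommRing R]

/-- Embeddings of a partial field in a ring, with image `H ∪ {0}`, such that a sum is defined
whenever its value is in the image. -/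
structure IsEmbedding (f : P → R) (H : Subgroup Rˣ) : Prop extends IsHomToRing f where
  neg_one_mem : -1 ∈ H
  unitOrZero : ∀ p, UnitOrZero H (f p)
  exists_eq : ∀ x, UnitOrZero H x → ∃ p, f p = x
  mem_padd : ∀ p q r, f r = f p + f q → r ∈ padd p q

theorem IsEmbedding.injective {f : P → R} {H : Subgroup Rˣ} (hf : IsEmbedding f H) :
    Function.Injective f := by
  intro p q h
  have := hf.mem_padd p 0 q (by rw [hf.map_zero, add_zero, h])
  rw [padd_zero, Part.mem_some_iff] at this
  exact this.symm

/-- A matrix over a partial field whose image under an embedding is strong has a strong image in the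
universal ring. -/
theorem IsEmbedding.isStrong_universal [Nontrivial R] {f : P → R} {H : Subgroup Rˣ}
    (hf : IsEmbedding f H) {X Y : Type*} [Fintype X] {A : Matrix X Y P}
    (hA : (A.map f).IsStrong H) :
    (A.map toUniversal).IsStrong (Units.map (⟨⟨toUniversal, isHomToRing_toUniversal.map_one⟩,
      isHomToRing_toUniversal.map_mul⟩ : P →* UniversalRing P)).range := by
  classical
  have hU := isHomToRing_toUniversal (P := P)
  have hmem : ∀ p : P, UnitOrZero (Units.map (⟨⟨toUniversal, isHomToRing_toUniversal.map_one⟩,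
      isHomToRing_toUniversal.map_mul⟩ : P →* UniversalRing P)).range (toUniversal p) := by
    intro p
    by_cases hp : p = 0
    · exact .inl (by rw [hp, hU.map_zero])
    · exact .inr ⟨_, ⟨Units.mk0 p hp, rfl⟩, rfl⟩
  refine Matrix.isStrong_of_pivot_closed ?_
    {D | ∃ A : Matrix X Y P, (A.map f).IsStrong H ∧ D = A.map toUniversal} ?_ ?_ ⟨A, hA, rfl⟩
  · refine ⟨Units.mk0 (-1 : P) ((neg_ne_zero_iff _).2 one_ne_zero), Units.ext ?_⟩
    change toUniversal (-1 : P) = -1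
    rw [hU.map_neg, hU.map_one]
  · rintro D ⟨A, -, rfl⟩ x y
    exact hmem _
  · rintro D ⟨A, hA, rfl⟩ x y hxy
    have hxy' : A x y ≠ 0 := fun h => hxy (by rw [Matrix.map_apply, h, hU.map_zero])
    -- The pivot of `A.map f` is strong, so its entries come from `P`. They arise from products,
    -- negatives and defined sums in `P`, so `toUniversal` satisfies the same pivot formulas.
    have hB := hA.pivot hf.neg_one_mem (x := x) (y := y) (hf.ne_zero_iff.2 hxy')
    have hB' : ∀ i j, ∃ p, f p = Matrix.pivot (A.map f) x y i j := fun i j =>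
      hf.exists_eq _ (hB.apply i j)
    choose B hBf using hB'
    refine ⟨Matrix.of B, by convert hB; ext i j; exact hBf i j, ?_⟩
    ext i j
    have key := hBf i j
    rw [Matrix.map_apply, Matrix.of_apply]
    by_cases hi : i = x <;> by_cases hj : j = y
    · subst hi hj
      rw [Matrix.pivot_self, Matrix.map_apply, hf.ringInverse hxy'] at key
      rw [Matrix.pivot_self, Matrix.map_apply, hU.ringInverse hxy', hf.injective key]
    · subst hi
      rw [Matrix.pivot_row _ hj, Matrix.map_apply, Matrix.map_apply, hf.ringInverse hxy',
        ← hf.map_mul] at key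
      rw [Matrix.pivot_row _ hj, Matrix.map_apply, Matrix.map_apply, hU.ringInverse hxy',
        ← hU.map_mul, hf.injective key]
    · subst hj
      rw [Matrix.pivot_col _ hi, Matrix.map_apply, Matrix.map_apply, hf.ringInverse hxy',
        ← hf.map_mul, ← hf.map_neg] at key
      rw [Matrix.pivot_col _ hi, Matrix.map_apply, Matrix.map_apply, hU.ringInverse hxy',
        ← hU.map_mul, ← hU.map_neg, hf.injective key]
    · rw [Matrix.pivot_of_ne _ hi hj] at key ⊢
      simp only [Matrix.map_apply, hf.ringInverse hxy', hU.ringInverse hxy', ← hf.map_mul,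
        ← hU.map_mul, sub_eq_add_neg, ← hf.map_neg, ← hU.map_neg] at key ⊢
      exact (hU.map_padd _ _ _ (hf.mem_padd _ _ _ key)).symm

/-- In the universal ring the determinant is 0 or the image of an element of `P`, which makes it a
defined sum. -/
theorem IsEmbedding.exists_hasDet [Nontrivial R] {f : P → R} {H : Subgroup Rˣ}
    (hf : IsEmbedding f H) {X Y : Type*} [Fintype X] {A : Matrix X Y P}
    (hA : (A.map f).IsStrong H) {k : ℕ} (g : Fin k → X) (h : Fin k → Y) :
    ∃ d, HasDet (A.submatrix g h) d := by
  obtain h0 | ⟨_, ⟨p, rfl⟩, hp⟩ := hf.isStrong_universal hA k g h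
  · exact ⟨0, hasDet_of_universal (by
      rw [(isHomToRing_toUniversal (P := P)).map_zero, ← h0]; rfl)⟩
  · exact ⟨p, hasDet_of_universal hp.symm⟩

end Embedding

end PartialField

/-! ### Matroid representations by matrices over rings -/

namespace Matroid

open PartialField

variable {α : Type*} {R : Type*} [CommRing R]

/-- The columns of the `r × E` matrix `D` that give nonzero maximal minors are the bases of `M`. -/
structure IsRepresentedBy (M : Matroid α) {r : ℕ} (D : Matrix (Fin r) M.E R) : Prop where
  ncard_eq : ∀ B, M.IsBase B → B.ncard = r
  isBase_iff : ∀ g : Fin r ↪ M.E, M.IsBase ((↑) '' Set.range g : Set α) ↔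
    (D.submatrix id g).det ≠ 0

theorem exists_range_eq (M : Matroid α) [M.Finite] {r : ℕ} {B : Set M.E}
    (hB : ((↑) '' B : Set α).ncard = r) : ∃ g : Fin r ↪ M.E, Set.range g = B := by
  have := M.ground_finite.to_subtype
  rw [Set.ncard_image_of_injective _ Subtype.val_injective] at hB
  have e : Fin r ≃ B := (Finite.equivFinOfCardEq (by rw [Nat.card_coe_set_eq, hB])).symm
  exact ⟨e.toEmbedding.trans (Function.Embedding.subtype _), by
    rw [Function.Embedding.coe_trans, Set.range_comp]
    simp⟩

theorem exists_equiv_of_range_eq {r : ℕ} {E : Type*} {g h : Fin r ↪ E}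
    (H : Set.range g = Set.range h) : ∃ σ : Equiv.Perm (Fin r), h = g ∘ σ := by
  have hm : ∀ i, ∃ j, g j = h i := fun i => by
    have : h i ∈ Set.range g := H ▸ Set.mem_range_self i
    exact this
  choose σ hσ using hm
  have hinj : Function.Injective σ := fun i j hij => h.injective (by rw [← hσ, ← hσ, hij])
  exact ⟨Equiv.ofBijective σ (Finite.injective_iff_bijective.1 hinj), funext fun i => (hσ i).symm⟩

theorem det_ne_zero_of_range_eq {r : ℕ} {E : Type*} (D : Matrix (Fin r) E R) {g h : Fin r ↪ E}
    (H : Set.range g = Set.range h) (hg : (D.submatrix id g).det ≠ 0) :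
    (D.submatrix id h).det ≠ 0 := by
  obtain ⟨σ, hσ⟩ := exists_equiv_of_range_eq H
  have : D.submatrix id h = (D.submatrix id g).submatrix id σ := by
    rw [Matrix.submatrix_submatrix, hσ]; rfl
  rw [this, Matrix.det_permute']
  intro h0
  refine hg ?_
  obtain h1 | h1 := Int.units_eq_one_or (Equiv.Perm.sign σ) <;> simpa [h1] using h0

theorem isRepresentableOver_of_isRepresentedBy [Nontrivial R] {P : Type*} [PartialField P]
    {f : P → R} {H : Subgroup Rˣ} (hf : IsEmbedding f H) (M : Matroid α) [M.Finite] {r : ℕ}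
    {D : Matrix (Fin r) M.E R} (hD : D.IsStrong H) (hM : M.IsRepresentedBy D) :
    M.IsRepresentableOver P := by
  have hA : ∀ i j, ∃ p, f p = D i j := fun i j => hf.exists_eq _ (hD.apply i j)
  choose A hA using hA
  have hAD : (Matrix.of A).map f = D := by ext i j; exact hA i j
  rw [← hAD] at hD
  have hdet : ∀ g : Fin r ↪ M.E, (D.submatrix id g).det ≠ 0 ↔
      ∃ d, HasDet ((Matrix.of A).submatrix id g) d ∧ d ≠ 0 := by
    intro g
    have h1 : ∀ d, HasDet ((Matrix.of A).submatrix id g) d → (D.submatrix id g).det = f d := by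
      intro d hd
      rw [← hf.hasDet hd, ← hAD]
      rfl
    constructor
    · intro h
      obtain ⟨d, hd⟩ := hf.exists_hasDet hD id g
      exact ⟨d, hd, fun h0 => h (by rw [h1 d hd, h0, hf.map_zero])⟩
    · rintro ⟨d, hd, hd0⟩
      rw [h1 d hd]
      exact hf.ne_zero_iff.2 hd0
  have hbases : ∀ B : Set M.E, M.IsBase ((↑) '' B : Set α) ↔ B ∈ bases (Matrix.of A) := by
    intro B
    constructor
    · intro hB
      obtain ⟨g, rfl⟩ := M.exists_range_eq (hM.ncard_eq _ hB)
      exact ⟨g, rfl, (hdet g).1 ((hM.isBase_iff g).1 hB)⟩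
    · rintro ⟨g, rfl, h⟩
      exact (hM.isBase_iff g).2 ((hdet g).2 h)
  refine ⟨r, Matrix.of A, fun k g h => hf.exists_hasDet hD g h, ?_, hbases⟩
  -- Square submatrices have at most `r` rows, which also bounds the set under `sSup`; a base
  -- provides one of size `r`.
  refine le_antisymm (csSup_le' ?_) (le_csSup ⟨r, ?_⟩ ?_)
  · rintro k ⟨g, -⟩
    simpa using Fintype.card_le_of_embedding g
  · rintro k ⟨g, -⟩
    simpa using Fintype.card_le_of_embedding g
  · obtain ⟨B, hB⟩ := M.exists_isBase
    have hB' : ((↑) '' ((↑) ⁻¹' B : Set M.E) : Set α) = B := by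
      rw [Subtype.image_preimage_coe]
      exact Set.inter_eq_right.2 hB.subset_ground
    rw [← hB', hbases] at hB
    obtain ⟨g, -, d, hd⟩ := hB
    exact ⟨Function.Embedding.refl _, g, d, hd⟩

/-- A homomorphism sends nonzero elements of `P` to units, so it changes neither the vanishing of
determinants nor the bases. -/
theorem IsRepresentableOver.exists_isRepresentedBy [Nontrivial R] {P : Type*} [PartialField P]
    {f : P → R} (hf : IsHomToRing f) {M : Matroid α} [M.Finite] (h : M.IsRepresentableOver P) :
    ∃ (r : ℕ) (A : Matrix (Fin r) M.E P), IsPMatrix A ∧ M.IsRepresentedBy (A.map f) := by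
  obtain ⟨r, A, hA, -, hb⟩ := h
  refine ⟨r, A, hA, fun B hB => ?_, fun g => ?_⟩
  · have hB' : ((↑) '' ((↑) ⁻¹' B : Set M.E) : Set α) = B := by
      rw [Subtype.image_preimage_coe]
      exact Set.inter_eq_right.2 hB.subset_ground
    rw [← hB', hb] at hB
    obtain ⟨g, hg, -⟩ := hB
    rw [← hB', ← hg, Set.ncard_image_of_injective _ Subtype.val_injective,
      Set.ncard_range_of_injective g.injective, Nat.card_eq_fintype_card, Fintype.card_fin]
  · rw [hb]
    constructor
    · rintro ⟨h, hh, d, hd, hd0⟩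
      refine det_ne_zero_of_range_eq _ hh ?_
      have := hf.hasDet hd
      rw [← Matrix.submatrix_map] at this
      rw [this]
      exact hf.ne_zero_iff.2 hd0
    · intro h
      obtain ⟨d, hd⟩ := hA r (Function.Embedding.refl _) g
      refine ⟨g, rfl, d, hd, fun h0 => h ?_⟩
      have := hf.hasDet hd
      rw [h0, hf.map_zero] at this
      exact this

/-- A represented matroid has a representation in standard form with respect to any base. -/
theorem IsRepresentableOver.exists_standard [Nontrivial R] {P : Type*} [PartialField P]
    {f : P → R} (hf : IsHomToRing f) {H : Subgroup Rˣ} (hH : ∀ p, UnitOrZero H (f p))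
    {M : Matroid α} [M.Finite] (h : M.IsRepresentableOver P) {r : ℕ} {g₀ : Fin r ↪ M.E}
    (hg₀ : M.IsBase ((↑) '' Set.range g₀ : Set α)) :
    ∃ D : Matrix (Fin r) M.E R, D.submatrix id g₀ = 1 ∧ M.IsRepresentedBy D ∧
      ∀ g : Fin r → M.E, UnitOrZero H (D.submatrix id g).det := by
  obtain ⟨r', A, hA, hM⟩ := h.exists_isRepresentedBy hf
  obtain rfl : r = r' := by
    have := hM.ncard_eq _ hg₀
    rw [Set.ncard_image_of_injective _ Subtype.val_injective,
      Set.ncard_range_of_injective g₀.injective, Nat.card_eq_fintype_card, Fintype.card_fin] at this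
    exact this
  have hdet : ∀ g : Fin r → M.E, UnitOrZero H ((A.map f).submatrix id g).det := by
    intro g
    refine Matrix.unitOrZero_det_of_injective _ id g fun _ hg => ?_
    obtain ⟨d, hd⟩ := hA r (Function.Embedding.refl _) ⟨g, hg⟩
    have := hf.hasDet hd
    rw [← Matrix.submatrix_map] at this
    exact this ▸ hH d
  -- Left multiplication by `C⁻¹` multiplies every maximal minor by the same unit.
  set C := (A.map f).submatrix id g₀ with hC
  have hCu : IsUnit C.det := (hdet g₀).isUnit ((hM.isBase_iff g₀).1 hg₀)
  have hsub : ∀ g : Fin r → M.E, (C⁻¹ * A.map f).submatrix id g =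
      C⁻¹ * (A.map f).submatrix id g := fun g => rfl
  have hdetC : ∀ g : Fin r → M.E, ((C⁻¹ * A.map f).submatrix id g).det =
      Ring.inverse C.det * ((A.map f).submatrix id g).det := fun g => by
    rw [hsub, Matrix.det_mul, Matrix.det_nonsing_inv]
  refine ⟨C⁻¹ * A.map f, ?_, ⟨hM.ncard_eq, fun g => ?_⟩, fun g => ?_⟩
  · rw [hsub, ← hC, Matrix.nonsing_inv_mul _ hCu]
  · rw [hM.isBase_iff, hdetC]
    have hinv := (hdet g₀).inverse_ne_zero ((hM.isBase_iff g₀).1 hg₀)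
    exact ⟨fun h => (hdet g₀).inverse.mul_ne_zero hinv h, fun h h0 => h (by rw [h0, mul_zero])⟩
  · rw [hdetC]
    exact (hdet g₀).inverse.mul (hdet g)

/-- `D` contains an identity matrix already, so the maximal minors of `[I | D]` are maximal minors
of `D`. -/
theorem _root_.Matrix.isStrong_of_standard [Nontrivial R] {H : Subgroup Rˣ} (hH : -1 ∈ H) {r : ℕ}
    {E : Type*} {D : Matrix (Fin r) E R} {g₀ : Fin r → E} (h1 : D.submatrix id g₀ = 1)
    (h : ∀ g : Fin r → E, UnitOrZero H (D.submatrix id g).det) : D.IsStrong H := by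
  classical
  refine Matrix.isStrong_of_det_fromCols_one hH fun g => ?_
  convert h (Sum.elim g₀ id ∘ g) using 2
  ext i j
  rcases hg : g j with x | y
  · rw [← h1]; simp [hg]
  · simp [hg]

theorem exists_base_embedding (M : Matroid α) [M.Finite] :
    ∃ (r : ℕ) (g : Fin r ↪ M.E), M.IsBase ((↑) '' Set.range g : Set α) := by
  obtain ⟨B, hB⟩ := M.exists_isBase
  have hB' : ((↑) '' ((↑) ⁻¹' B : Set M.E) : Set α) = B := by
    rw [Subtype.image_preimage_coe]
    exact Set.inter_eq_right.2 hB.subset_ground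
  obtain ⟨g, hg⟩ := M.exists_range_eq (B := (↑) ⁻¹' B) rfl
  exact ⟨_, g, by rwa [hg, hB']⟩

end Matroid

/-! ### The ring `ℤ[τ]`, its units and its fundamental elements -/

section GoldenInteger

/-- The ring `ℤ[τ]`, where `τ ^ 2 = τ + 1`. -/
abbrev GoldenInteger : Type := QuadraticAlgebra ℤ 1 1

namespace GoldenInteger

/-- The ring homomorphism that sends `τ` to `x`. -/
def toRing {A : Type*} [CommRing A] (x : A) (hx : x * x = 1 + x) : GoldenInteger →+* A :=
  (QuadraticAlgebra.lift ⟨x, by simpa using hx⟩ : GoldenInteger →ₐ[ℤ] A).toRingHom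

theorem toRing_mk {A : Type*} [CommRing A] (x : A) (hx : x * x = 1 + x) (a b : ℤ) :
    toRing x hx ⟨a, b⟩ = a + b * x := by
  simp [toRing, QuadraticAlgebra.lift]

theorem toRing_apply {A : Type*} [CommRing A] (x : A) (hx : x * x = 1 + x) (z : GoldenInteger) :
    toRing x hx z = z.re + z.im * x :=
  toRing_mk x hx _ _

/-- The unit `τ`. -/
def tau : GoldenIntegerˣ where
  val := ⟨0, 1⟩
  inv := ⟨-1, 1⟩
  val_inv := by decide
  inv_val := by decide

/-- The group of units generated by `τ` and `-1`. -/
def units : Subgroup GoldenIntegerˣ := Subgroup.closure {tau, -1}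

theorem _root_.Units.mem_closure_neg_one {R : Type*} [Ring R] {t u : Rˣ} :
    u ∈ Subgroup.closure {t, -1} ↔ ∃ n : ℤ, u = t ^ n ∨ u = -t ^ n := by
  constructor
  · intro h
    induction h using Subgroup.closure_induction with
    | mem x hx =>
      rcases hx with rfl | rfl
      · exact ⟨1, Or.inl (zpow_one _).symm⟩
      · exact ⟨0, Or.inr (by simp)⟩
    | one => exact ⟨0, Or.inl (by simp)⟩
    | mul x y _ _ hx hy =>
      obtain ⟨m, rfl | rfl⟩ := hx <;> obtain ⟨n, rfl | rfl⟩ := hy <;>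
        refine ⟨m + n, ?_⟩ <;> simp [zpow_add]
    | inv x _ hx =>
      obtain ⟨m, rfl | rfl⟩ := hx <;> refine ⟨-m, ?_⟩ <;> simp
  · have h1 : (-1 : Rˣ) ∈ Subgroup.closure {t, -1} := Subgroup.subset_closure (Or.inr rfl)
    have h2 : t ∈ Subgroup.closure {t, -1} := Subgroup.subset_closure (Or.inl rfl)
    rintro ⟨n, rfl | rfl⟩
    · exact zpow_mem h2 n
    · exact neg_one_mul (t ^ n) ▸ mul_mem h1 (zpow_mem h2 n)

theorem tau_mem : tau ∈ units := Subgroup.subset_closure (Or.inl rfl)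

theorem neg_one_mem : -1 ∈ units := Subgroup.subset_closure (Or.inr rfl)

/-- The embedding in the real numbers. -/
noncomputable def toReal : GoldenInteger →+* ℝ :=
  toRing Real.goldenRatio (by linear_combination Real.goldenRatio_sq)

theorem toReal_mk (a b : ℤ) : toReal ⟨a, b⟩ = a + b * Real.goldenRatio := toRing_mk _ _ _ _

theorem toReal_injective : Function.Injective toReal := by
  rw [injective_iff_map_eq_zero]
  rintro ⟨a, b⟩ h
  rw [toReal_mk] at h
  obtain rfl : b = 0 := by
    by_contra hb
    refine Real.goldenRatio_irrational ⟨-a / b, ?_⟩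
    have : (b : ℝ) ≠ 0 := by exact_mod_cast hb
    push_cast
    rw [div_eq_iff this]
    linear_combination -h
  obtain rfl : a = 0 := by simpa using h
  rfl

/-- The fundamental elements. -/
def fundamentals : List GoldenInteger :=
  [⟨1, 0⟩, ⟨0, 1⟩, ⟨0, -1⟩, ⟨-1, 1⟩, ⟨1, -1⟩, ⟨1, 1⟩, ⟨2, -1⟩]

theorem unitOrZero_of_mem_fundamentals {x : GoldenInteger} (hx : x ∈ fundamentals) :
    UnitOrZero units x := by
  have h : ∀ n : ℤ, UnitOrZero units ((tau ^ n : GoldenIntegerˣ) : GoldenInteger) := fun n =>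
    .of_mem (zpow_mem tau_mem n)
  simp only [fundamentals, List.mem_cons, List.not_mem_nil, or_false] at hx
  rcases hx with rfl | rfl | rfl | rfl | rfl | rfl | rfl
  · exact h 0
  · exact h 1
  · exact (h 1).neg neg_one_mem
  · exact h (-1)
  · exact (h (-1)).neg neg_one_mem
  · exact h 2
  · exact h (-2)

theorem isFundamental_of_mem_fundamentals {x : GoldenInteger} (hx : x ∈ fundamentals) :
    IsFundamental units x := by
  have h : ∀ x ∈ fundamentals, x ≠ 0 ∧ (1 - x = 0 ∨ 1 - x ∈ fundamentals) := by decide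
  refine ⟨unitOrZero_of_mem_fundamentals hx, (h x hx).1, ?_⟩
  rcases (h x hx).2 with h | h
  · exact Or.inl h
  · exact unitOrZero_of_mem_fundamentals h

theorem goldenRatio_zpow_neg_one : Real.goldenRatio ^ (-1 : ℤ) = Real.goldenRatio - 1 := by
  rw [zpow_neg_one]
  refine inv_eq_of_mul_eq_one_right ?_
  linear_combination Real.goldenRatio_sq

theorem goldenRatio_zpow_neg_two : Real.goldenRatio ^ (-2 : ℤ) = 2 - Real.goldenRatio := by
  rw [show (-2 : ℤ) = -1 + -1 by norm_num, zpow_add₀ Real.goldenRatio_ne_zero,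
    goldenRatio_zpow_neg_one]
  linear_combination Real.goldenRatio_sq

/-- Both exponents are negative. If one is `-1` the other is forced; if both are at most `-2`, the
sum is at most `2τ⁻² < 1`. -/
theorem goldenRatio_zpow_add_zpow {k l : ℤ} (h : Real.goldenRatio ^ k + Real.goldenRatio ^ l = 1) :
    (k = -1 ∧ l = -2) ∨ (k = -2 ∧ l = -1) := by
  have h1 := Real.one_lt_goldenRatio
  have hpos : ∀ n : ℤ, 0 < Real.goldenRatio ^ n := zpow_pos Real.goldenRatio_pos
  have hinj : ∀ m n : ℤ, Real.goldenRatio ^ m = Real.goldenRatio ^ n → m = n := fun m n e =>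
    (zpow_right_strictMono₀ h1).injective e
  have hneg : ∀ m : ℤ, Real.goldenRatio ^ m < 1 → m ≤ -1 := fun m e => by
    have := (zpow_lt_one_iff_right₀ h1).1 e
    omega
  have hk := hneg k (by linarith [hpos l])
  have hl := hneg l (by linarith [hpos k])
  rcases eq_or_lt_of_le hk with rfl | hk
  · refine Or.inl ⟨rfl, hinj _ _ ?_⟩
    rw [goldenRatio_zpow_neg_two]
    rw [goldenRatio_zpow_neg_one] at h
    linarith
  rcases eq_or_lt_of_le hl with rfl | hl
  · refine Or.inr ⟨hinj _ _ ?_, rfl⟩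
    rw [goldenRatio_zpow_neg_two]
    rw [goldenRatio_zpow_neg_one] at h
    linarith
  · have hk' := zpow_le_zpow_right₀ h1.le (show k ≤ -2 by omega)
    have hl' := zpow_le_zpow_right₀ h1.le (show l ≤ -2 by omega)
    rw [goldenRatio_zpow_neg_two] at hk' hl'
    have : Real.goldenRatio ^ 2 = Real.goldenRatio + 1 := Real.goldenRatio_sq
    nlinarith

theorem toReal_zpow (n : ℤ) :
    toReal ((tau ^ n : GoldenIntegerˣ) : GoldenInteger) = Real.goldenRatio ^ n := by
  have h : toReal (tau : GoldenInteger) = Real.goldenRatio := by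
    exact (toReal_mk 0 1).trans (by simp)
  have := congrArg Units.val (map_zpow (Units.map (toReal : GoldenInteger →* ℝ)) tau n)
  rw [Units.val_zpow_eq_zpow_val] at this
  exact this.trans (by rw [Units.coe_map]; exact congrArg (· ^ n) h)

/-- With `f = ±τ^k` and `1 - f = ±τ^l`, every choice of signs reduces to `τ^k + τ^l = 1` after
division by a power of `τ`, except two minus signs, which are impossible. -/
theorem mem_fundamentals_of_isFundamental {f : GoldenInteger} (hf : IsFundamental units f) :
    f ∈ fundamentals := by
  have hpos : ∀ n : ℤ, 0 < Real.goldenRatio ^ n := zpow_pos Real.goldenRatio_pos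
  have hsub : ∀ k l : ℤ, Real.goldenRatio ^ k = 1 + Real.goldenRatio ^ l →
      (k = 1 ∧ l = -1) ∨ (k = 2 ∧ l = 1) := by
    intro k l h
    have : Real.goldenRatio ^ (-k) + Real.goldenRatio ^ (l - k) = 1 := by
      rw [sub_eq_add_neg, zpow_add₀ Real.goldenRatio_ne_zero, zpow_neg]
      have := (hpos k).ne'
      field_simp
      exact h.symm
    have := goldenRatio_zpow_add_zpow this
    omega
  have key : ∀ x ∈ fundamentals, toReal f = toReal x → f ∈ fundamentals := fun x hx h =>
    toReal_injective h ▸ hx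
  have e1 := goldenRatio_zpow_neg_one
  have e2 := goldenRatio_zpow_neg_two
  have e3 := Real.goldenRatio_sq
  obtain h0 | ⟨u, hu, huf⟩ := hf.1
  · exact absurd h0 hf.2
  obtain h1 | ⟨v, hv, hvf⟩ := hf.3
  · rw [← sub_eq_zero.1 h1]
    decide
  have hsum : toReal f + toReal (1 - f) = 1 := by rw [map_sub, map_one]; ring
  rw [units, Units.mem_closure_neg_one] at hu hv
  obtain ⟨k, hk | hk⟩ := hu <;> obtain ⟨l, hl | hl⟩ := hv <;> subst hk hl <;>
    rw [← hvf, ← huf] at hsum <;>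
    simp only [Units.val_neg, map_neg, toReal_zpow] at hsum <;> rw [← huf] at key ⊢ <;>
    simp only [Units.val_neg, map_neg, toReal_zpow] at key ⊢
  · rcases goldenRatio_zpow_add_zpow hsum with ⟨rfl, rfl⟩ | ⟨rfl, rfl⟩
    · exact key ⟨-1, 1⟩ (by decide) (by rw [toReal_mk, e1]; push_cast; ring)
    · exact key ⟨2, -1⟩ (by decide) (by rw [toReal_mk, e2]; push_cast; ring)
  · rcases hsub k l (by linarith) with ⟨rfl, rfl⟩ | ⟨rfl, rfl⟩
    · exact key ⟨0, 1⟩ (by decide) (by rw [toReal_mk, zpow_one]; push_cast; ring)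
    · exact key ⟨1, 1⟩ (by decide) (by
        rw [toReal_mk, zpow_ofNat, e3]; push_cast; ring)
  · rcases hsub l k (by linarith) with ⟨rfl, rfl⟩ | ⟨rfl, rfl⟩
    · exact key ⟨1, -1⟩ (by decide) (by rw [toReal_mk, e1]; push_cast; ring)
    · exact key ⟨0, -1⟩ (by decide) (by rw [toReal_mk, zpow_one]; push_cast; ring)
  · linarith [hpos k, hpos l]

end GoldenInteger

end GoldenInteger

open PartialField

/-! ### Roots of `x² = 1 + x` in finite fields -/

section Roots

/-- Either the root lies in the prime field, or adjoining it gives a field with `p²` elements. -/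
theorem GaloisField.exists_mul_self_eq_one_add (p : ℕ) [Fact p.Prime] :
    ∃ x : GaloisField p 2, x * x = 1 + x := by
  by_cases h : ∃ r : ZMod p, r * r = 1 + r
  · obtain ⟨r, hr⟩ := h
    exact ⟨algebraMap _ _ r, by rw [← map_mul, hr, map_add, map_one]⟩
  · have : Fact (∀ r : ZMod p, r ^ 2 ≠ 1 + 1 * r) :=
      ⟨fun r hr => h ⟨r, by linear_combination hr⟩⟩
    let e : QuadraticAlgebra (ZMod p) 1 1 ≃ₐ[ZMod p] GaloisField p 2 :=
      GaloisField.algEquivGaloisField p 2 (by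
        rw [Nat.card_congr (QuadraticAlgebra.equivProd 1 1), Nat.card_prod, Nat.card_zmod, sq])
    refine ⟨e ⟨0, 1⟩, ?_⟩
    rw [← map_mul, ← map_one e, ← map_add]
    congr 1
    ext
    · simp [QuadraticAlgebra.re_one]
    · simp [QuadraticAlgebra.im_one]

/-- The root is `(1 + √5) / 2`. As `5 ≡ 1` mod 4, quadratic reciprocity makes 5 a square mod `p`
when `p` is one mod 5, and `1 = 1²`, `-1 = 2²` there. -/
theorem ZMod.exists_mul_self_eq_one_add {p : ℕ} [Fact p.Prime]
    (hp : (p : ℤ) ≡ 1 [ZMOD 5] ∨ (p : ℤ) ≡ -1 [ZMOD 5]) : ∃ x : ZMod p, x * x = 1 + x := by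
  have hp2 : p ≠ 2 := by
    rintro rfl
    revert hp
    decide
  have h2 : (2 : ZMod p) ≠ 0 := by
    intro h
    have := (ZMod.natCast_eq_zero_iff 2 p).1 (by exact_mod_cast h)
    exact hp2 ((Nat.prime_dvd_prime_iff_eq Fact.out Nat.prime_two).1 this)
  obtain ⟨s, hs⟩ : IsSquare ((5 : ℕ) : ZMod p) := by
    refine (ZMod.exists_sq_eq_prime_iff_of_mod_four_eq_one (p := 5) (by norm_num) hp2).1 ?_
    have h5 : ((p : ℤ) : ZMod 5) = 1 ∨ ((p : ℤ) : ZMod 5) = -1 := by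
      refine hp.imp (fun h => ?_) fun h => ?_
      · simpa using (ZMod.intCast_eq_intCast_iff _ _ 5).2 h
      · simpa using (ZMod.intCast_eq_intCast_iff _ _ 5).2 h
    rw [Int.cast_natCast] at h5
    rcases h5 with h | h <;> rw [h]
    · exact ⟨1, rfl⟩
    · exact ⟨2, rfl⟩
  push_cast at hs
  refine ⟨(1 + s) / 2, ?_⟩
  field_simp
  linear_combination -hs

end Roots

/-! ### The embeddings of fields, of products of fields and of `𝔾` -/

section Embeddings

theorem PartialField.isEmbedding_ofField (F : Type*) [Field F] :
    IsEmbedding (P := F) (id : F → F) ⊤ where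
  map_one := rfl
  map_mul _ _ := rfl
  map_padd _ _ _ h := Part.mem_some_iff.1 h
  neg_one_mem := trivial
  unitOrZero p := by
    rcases eq_or_ne p 0 with rfl | h
    · exact .zero
    · exact .of_mem (u := Units.mk0 p h) trivial
  exists_eq x _ := ⟨x, rfl⟩
  mem_padd _ _ _ h := Part.mem_some_iff.2 h

theorem unitOrZero_top_prod {F G : Type*} [Field F] [Field G] {x : F × G}
    (h : x.1 ≠ 0 ↔ x.2 ≠ 0) : UnitOrZero ⊤ x := by
  by_cases h1 : x.1 = 0
  · exact Or.inl (Prod.ext h1 (by simpa [h1] using h))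
  · exact Or.inr ⟨MulEquiv.prodUnits.symm (Units.mk0 _ h1, Units.mk0 _ (h.1 h1)), trivial, rfl⟩

theorem PartialField.isEmbedding_product (F G : Type*) [Field F] [Field G] :
    IsEmbedding (fun p : Product F G => p.1) ⊤ where
  map_one := rfl
  map_mul _ _ := rfl
  map_padd p q r h := by
    have := Product.mem_padd.1 h
    exact Prod.ext (Part.mem_some_iff.1 this.1) (Part.mem_some_iff.1 this.2)
  neg_one_mem := trivial
  unitOrZero p := unitOrZero_top_prod p.2
  exists_eq x hx := by
    refine ⟨⟨x, ?_⟩, rfl⟩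
    rcases hx with rfl | ⟨u, -, rfl⟩
    · simp
    · exact iff_of_true (u.isUnit.map (RingHom.fst F G)).ne_zero
        (u.isUnit.map (RingHom.snd F G)).ne_zero
  mem_padd p q r h := Product.mem_padd.2
    ⟨Part.mem_some_iff.2 (congrArg Prod.fst h), Part.mem_some_iff.2 (congrArg Prod.snd h)⟩

namespace GoldenInteger

theorem mem_carrier_iff {x : ℝ} :
    x ∈ carrier {Units.mk0 Real.goldenRatio Real.goldenRatio_ne_zero} ↔
      ∃ z, UnitOrZero units z ∧ toReal z = x := by
  rw [carrier, Set.singleton_union]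
  simp only [Set.mem_ofPred_eq, Units.mem_closure_neg_one]
  constructor
  · rintro (rfl | ⟨u, ⟨n, rfl | rfl⟩, rfl⟩)
    · exact ⟨0, .zero, map_zero _⟩
    · exact ⟨_, .of_mem (zpow_mem tau_mem n), by simp [toReal_zpow]⟩
    · exact ⟨_, (UnitOrZero.of_mem (zpow_mem tau_mem n)).neg neg_one_mem, by simp [toReal_zpow]⟩
  · rintro ⟨z, rfl | ⟨u, hu, rfl⟩, rfl⟩
    · exact Or.inl (map_zero _)
    · rw [units, Units.mem_closure_neg_one] at hu
      obtain ⟨n, rfl | rfl⟩ := hu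
      · exact Or.inr ⟨_, ⟨n, Or.inl rfl⟩, by simp [toReal_zpow]⟩
      · exact Or.inr ⟨_, ⟨n, Or.inr rfl⟩, by simp [toReal_zpow]⟩

/-- The element of `ℤ[τ]` underlying an element of the golden ratio partial field. -/
noncomputable def ofPartialField (p : GoldenRatioPartialField) : GoldenInteger :=
  (mem_carrier_iff.1 p.2).choose

theorem toReal_ofPartialField (p : GoldenRatioPartialField) : toReal (ofPartialField p) = p.1 :=
  (mem_carrier_iff.1 p.2).choose_spec.2

theorem isEmbedding_ofPartialField : IsEmbedding ofPartialField units where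
  map_one := toReal_injective (by rw [toReal_ofPartialField, map_one]; rfl)
  map_mul p q := toReal_injective (by
    rw [map_mul, toReal_ofPartialField, toReal_ofPartialField, toReal_ofPartialField]; rfl)
  map_padd p q r h := toReal_injective (by
    rw [map_add, toReal_ofPartialField, toReal_ofPartialField, toReal_ofPartialField]
    exact OfRing.mem_padd.1 h)
  neg_one_mem := neg_one_mem
  unitOrZero p := (mem_carrier_iff.1 p.2).choose_spec.1
  exists_eq x hx := ⟨⟨toReal x, mem_carrier_iff.2 ⟨x, hx, rfl⟩⟩,
    toReal_injective (toReal_ofPartialField _)⟩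
  mem_padd p q r h := OfRing.mem_padd.2 (by
    have := congrArg toReal h
    rwa [map_add, toReal_ofPartialField, toReal_ofPartialField, toReal_ofPartialField] at this)

end GoldenInteger

end Embeddings

/-! ### The lifting conditions for `ℤ[τ] → GF(4) × GF(5)` -/

section Lifting

namespace GoldenInteger

theorem eq_or_eq_of_galoisField_four {w : GaloisField 2 2} (hw : w * w = 1 + w)
    (x : GaloisField 2 2) : x = 0 ∨ x = 1 ∨ x = w ∨ x = 1 + w := by
  have hcard := GaloisField.card 2 2 (by norm_num)
  have h2 : (2 : GaloisField 2 2) = 0 := CharTwo.two_eq_zero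
  have hx : x ^ 4 = x := by
    have := Fintype.ofFinite (GaloisField 2 2)
    have h := FiniteField.pow_card x
    rwa [← Nat.card_eq_fintype_card, hcard] at h
  have : x * ((x - 1) * ((x - w) * (x - (1 + w)))) = 0 := by
    linear_combination hx + (x ^ 2 - x) * hw + (x ^ 2 - x ^ 3 + w * (1 - x) * (x ^ 2 - x)) * h2
  rcases mul_eq_zero.1 this with h | h
  · exact Or.inl h
  rcases mul_eq_zero.1 h with h | h
  · exact Or.inr (Or.inl (sub_eq_zero.1 h))
  rcases mul_eq_zero.1 h with h | h
  · exact Or.inr (Or.inr (Or.inl (sub_eq_zero.1 h)))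
  · exact Or.inr (Or.inr (Or.inr (sub_eq_zero.1 h)))

theorem mul_self_eq_one_add_prod {w : GaloisField 2 2} (hw : w * w = 1 + w) :
    ((w, 3) : GaloisField 2 2 × ZMod 5) * (w, 3) = 1 + (w, 3) :=
  Prod.ext hw (show (3 * 3 : ZMod 5) = 1 + 3 by decide)

theorem toRing_fst {w : GaloisField 2 2} (hw : w * w = 1 + w) (z : GoldenInteger) :
    (toRing _ (mul_self_eq_one_add_prod hw) z).1 = z.re + z.im * w := by
  rw [toRing_apply]; rfl

theorem toRing_snd {w : GaloisField 2 2} (hw : w * w = 1 + w) (z : GoldenInteger) :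
    (toRing _ (mul_self_eq_one_add_prod hw) z).2 = z.re + z.im * 3 := by
  rw [toRing_apply]; rfl

/-- Since `w` is not in the prime field, `1` and `w` are independent over it and both coordinates
must be even. The congruences turn equations under `φ` into decidable ones. -/
theorem dvd_of_toRing_eq_zero {w : GaloisField 2 2} (hw : w * w = 1 + w) {z : GoldenInteger}
    (hz : toRing _ (mul_self_eq_one_add_prod hw) z = 0) :
    2 ∣ z.re ∧ 2 ∣ z.im ∧ 5 ∣ z.re + z.im * 3 := by
  have h1 := toRing_fst hw z
  have h2 := toRing_snd hw z
  rw [hz] at h1 h2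
  have hc : ∀ n : ℤ, (n : GaloisField 2 2) = 0 ↔ 2 ∣ n := CharP.intCast_eq_zero_iff _ 2
  have hc' : ∀ n : ℤ, ¬2 ∣ n → (n : GaloisField 2 2) = 1 := fun n hn => by
    rw [← sub_eq_zero]
    exact_mod_cast (hc (n - 1)).2 (by omega)
  have him : 2 ∣ z.im := by
    by_contra him
    rw [hc' _ him, one_mul] at h1
    by_cases hre : 2 ∣ z.re
    · rw [(hc _).2 hre, zero_add] at h1
      rw [← h1] at hw
      simp at hw
    · rw [hc' _ hre] at h1
      have hw0 : w ≠ 0 := by rintro rfl; simp at hw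
      exact hw0 (mul_self_eq_zero.1 (hw.trans h1.symm))
  refine ⟨?_, him, ?_⟩
  · rw [(hc _).2 him, zero_mul, add_zero] at h1
    exact (hc _).1 h1.symm
  · refine (ZMod.intCast_zmod_eq_zero_iff_dvd _ 5).1 ?_
    push_cast
    exact h2.symm

theorem toRing_tau {w : GaloisField 2 2} (hw : w * w = 1 + w) :
    toRing _ (mul_self_eq_one_add_prod hw) (tau : GoldenInteger) = (w, 3) :=
  (toRing_mk _ _ 0 1).trans (by simp)

theorem exists_units_eq {w : GaloisField 2 2} (hw : w * w = 1 + w)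
    (u : (GaloisField 2 2 × ZMod 5)ˣ) :
    ∃ v ∈ units, toRing _ (mul_self_eq_one_add_prod hw) (v : GoldenInteger) = u := by
  have h2 : (2 : GaloisField 2 2) = 0 := CharTwo.two_eq_zero
  have hw3 : w ^ 3 = 1 := by linear_combination (w + 1) * hw + w * h2
  obtain ⟨i, hi⟩ : ∃ i : ℕ, w ^ i = u.val.1 := by
    rcases eq_or_eq_of_galoisField_four hw u.val.1 with h | h | h | h
    · exact absurd h (u.isUnit.map (RingHom.fst _ _)).ne_zero
    · exact ⟨0, by rw [h, pow_zero]⟩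
    · exact ⟨1, by rw [h, pow_one]⟩
    · exact ⟨2, (sq w).trans (hw.trans h.symm)⟩
  obtain ⟨j, hj⟩ : ∃ j : ℕ, (3 : ZMod 5) ^ j = u.val.2 := by
    have h : ∀ b : ZMod 5, b ≠ 0 → b = 3 ^ 0 ∨ b = 3 ^ 1 ∨ b = 3 ^ 2 ∨ b = 3 ^ 3 := by decide
    rcases h _ (u.isUnit.map (RingHom.snd _ _)).ne_zero with h | h | h | h <;> exact ⟨_, h.symm⟩
  -- Chinese remainders: `w` has order 3 and 3 has order 4, and `4i + 9j` is `i` mod 3 and `j` mod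
  -- 4.
  refine ⟨tau ^ (4 * i + 9 * j), pow_mem tau_mem _, ?_⟩
  rw [Units.val_pow_eq_pow_val, map_pow, toRing_tau hw]
  refine Prod.ext ?_ ?_
  · rw [Prod.pow_fst, ← hi, pow_add, pow_mul, pow_mul, show w ^ 4 = w by
      rw [pow_succ, hw3, one_mul], show w ^ 9 = 1 by rw [show 9 = 3 * 3 from rfl, pow_mul, hw3,
      one_pow], one_pow, mul_one]
  · rw [Prod.pow_snd, ← hj, pow_add, pow_mul, pow_mul, show (3 : ZMod 5) ^ 4 = 1 from by decide,
      show (3 : ZMod 5) ^ 9 = 3 from by decide, one_pow, one_mul]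

/-- Apart from 1, both components avoid 0 and 1, which leaves 2 · 3 = 6 pairs. They are the images
of the other six elements of `fundamentals`. -/
theorem exists_fundamental_eq {w : GaloisField 2 2} (hw : w * w = 1 + w)
    {f : GaloisField 2 2 × ZMod 5} (hf : IsFundamental ⊤ f) :
    ∃ g ∈ fundamentals, toRing _ (mul_self_eq_one_add_prod hw) g = f := by
  have h2 : (2 : GaloisField 2 2) = 0 := CharTwo.two_eq_zero
  have hu := hf.1.isUnit hf.2
  have ha : f.1 ≠ 0 := (hu.map (RingHom.fst _ _)).ne_zero
  have hb : f.2 ≠ 0 := (hu.map (RingHom.snd _ _)).ne_zero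
  have key : ∀ g ∈ fundamentals, (g.re + g.im * w : GaloisField 2 2) = f.1 →
      (g.re + g.im * 3 : ZMod 5) = f.2 →
      ∃ g ∈ fundamentals, toRing _ (mul_self_eq_one_add_prod hw) g = f := fun g hg h1 h2 =>
    ⟨g, hg, Prod.ext ((toRing_fst hw g).trans h1) ((toRing_snd hw g).trans h2)⟩
  by_cases h1 : 1 - f = 0
  · exact ⟨1, by decide, by rw [map_one]; exact sub_eq_zero.1 h1⟩
  have hu' := hf.3.isUnit h1
  have ha' : 1 - f.1 ≠ 0 := (hu'.map (RingHom.fst _ _)).ne_zero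
  have hb' : 1 - f.2 ≠ 0 := (hu'.map (RingHom.snd _ _)).ne_zero
  have hb2 : ∀ b : ZMod 5, b ≠ 0 → 1 - b ≠ 0 → b = 2 ∨ b = 3 ∨ b = 4 := by decide
  rcases eq_or_eq_of_galoisField_four hw f.1 with h | h | h | h
  · exact absurd h ha
  · exact absurd (by rw [h, sub_self]) ha'
  · rcases hb2 _ hb hb' with h' | h' | h' <;> rw [h, h'] at key
    · exact key ⟨0, -1⟩ (by decide) (by push_cast; linear_combination -w * h2) (by decide)
    · exact key ⟨0, 1⟩ (by decide) (by push_cast; ring) (by decide)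
    · exact key ⟨2, -1⟩ (by decide) (by push_cast; linear_combination (1 - w) * h2) (by decide)
  · rcases hb2 _ hb hb' with h' | h' | h' <;> rw [h, h'] at key
    · exact key ⟨-1, 1⟩ (by decide) (by push_cast; linear_combination -h2) (by decide)
    · exact key ⟨1, -1⟩ (by decide) (by push_cast; linear_combination -w * h2) (by decide)
    · exact key ⟨1, 1⟩ (by decide) (by push_cast; ring) (by decide)

theorem isLifting {w : GaloisField 2 2} (hw : w * w = 1 + w) :
    IsLifting (toRing _ (mul_self_eq_one_add_prod hw)) units ⊤ where
  neg_one_mem := neg_one_mem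
  neg_one_mem' := trivial
  surj u _ := exists_units_eq hw u
  exists_fundamental f hf := by
    obtain ⟨g, hg, h⟩ := exists_fundamental_eq hw hf
    exact ⟨g, isFundamental_of_mem_fundamentals hg, h⟩
  eq_one f g h hf hg hh e := by
    have key : ∀ f ∈ fundamentals, ∀ g ∈ fundamentals, ∀ h ∈ fundamentals,
        (2 ∣ (f * g * h - 1).re ∧ 2 ∣ (f * g * h - 1).im ∧
          -- The check runs over the 343 triples of fundamental elements.
          5 ∣ (f * g * h - 1).re + (f * g * h - 1).im * 3) → f * g * h = 1 := by decide +kernel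
    refine key f (mem_fundamentals_of_isFundamental hf) g (mem_fundamentals_of_isFundamental hg)
      h (mem_fundamentals_of_isFundamental hh) (dvd_of_toRing_eq_zero hw ?_)
    rw [map_sub, e, map_one, sub_self]
  eq_neg f g hf hg e := by
    have key : ∀ f ∈ fundamentals, ∀ g ∈ fundamentals,
        (2 ∣ (f + g).re ∧ 2 ∣ (f + g).im ∧ 5 ∣ (f + g).re + (f + g).im * 3) → f = -g := by
      decide
    refine key f (mem_fundamentals_of_isFundamental hf) g (mem_fundamentals_of_isFundamental hg)
      (dvd_of_toRing_eq_zero hw ?_)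
    rw [map_add, e, neg_add_cancel]

end GoldenInteger

end Lifting

open GoldenInteger

/-! ### The implications between the three conditions -/

namespace Matroid

variable {α : Type*} {M : Matroid α}

theorem IsRepresentedBy.isRepresentableOver_field [M.Finite] {F : Type*} [Field F] {r : ℕ}
    {D : Matrix (Fin r) M.E F} (hM : M.IsRepresentedBy D) : M.IsRepresentableOver F :=
  isRepresentableOver_of_isRepresentedBy (isEmbedding_ofField F) M
    (fun _ _ _ => (isEmbedding_ofField F).unitOrZero _) hM

theorem IsRepresentableOver.of_golden_root [M.Finite]
    (h : M.IsRepresentableOver GoldenRatioPartialField) {F : Type*} [Field F]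
    (hF : ∃ x : F, x * x = 1 + x) : M.IsRepresentableOver F := by
  obtain ⟨x, hx⟩ := hF
  have hf := isEmbedding_ofPartialField
  have hom : IsHomToRing (toRing x hx ∘ ofPartialField) :=
    ⟨by simp [hf.map_one], fun p q => by simp [hf.map_mul], fun p q r h => by
      simp [hf.map_padd p q r h]⟩
  obtain ⟨r, A, -, hM⟩ := h.exists_isRepresentedBy hom
  exact hM.isRepresentableOver_field

/-- Minors of the lift are zero or units, so they vanish exactly when their images do, and the lift
represents the same matroid. -/
theorem isRepresentableOver_golden_of_product [M.Finite]
    (h : M.IsRepresentableOver (Product (GaloisField 2 2) (ZMod 5))) :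
    M.IsRepresentableOver GoldenRatioPartialField := by
  obtain ⟨w, hw⟩ := GaloisField.exists_mul_self_eq_one_add 2
  obtain ⟨r, g₀, hg₀⟩ := M.exists_base_embedding
  have hP := isEmbedding_product (GaloisField 2 2) (ZMod 5)
  obtain ⟨D, h1, hM, hD⟩ := h.exists_standard hP.toIsHomToRing hP.unitOrZero hg₀
  have hL := isLifting hw
  have : Finite M.E := M.ground_finite
  obtain ⟨E, hE, hED⟩ := (Matrix.isStrong_of_standard hP.neg_one_mem h1 hD).hasStrongLift hL
  refine isRepresentableOver_of_isRepresentedBy isEmbedding_ofPartialField M hE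
    ⟨hM.ncard_eq, fun g => ?_⟩
  rw [hM.isBase_iff, ← hED, not_iff_not]
  have := (hE r (Function.Embedding.refl _) g).map_eq_zero
    (φ := toRing _ (mul_self_eq_one_add_prod hw))
  rw [RingHom.map_det] at this
  exact this

/-- Standard forms with respect to the same `g₀` pair to a matrix that contains the identity. Each
of its maximal minors has both components zero or both nonzero, which makes it strong. -/
theorem isRepresentableOver_product [M.Finite] {F G : Type*} [Field F] [Field G]
    (hF : M.IsRepresentableOver F) (hG : M.IsRepresentableOver G) :
    M.IsRepresentableOver (Product F G) := by
  obtain ⟨r, g₀, hg₀⟩ := M.exists_base_embedding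
  obtain ⟨A, hA1, hA, -⟩ := hF.exists_standard (isEmbedding_ofField F).toIsHomToRing
    (isEmbedding_ofField F).unitOrZero hg₀
  obtain ⟨B, hB1, hB, -⟩ := hG.exists_standard (isEmbedding_ofField G).toIsHomToRing
    (isEmbedding_ofField G).unitOrZero hg₀
  let D : Matrix (Fin r) M.E (F × G) := Matrix.of fun i j => (A i j, B i j)
  have hD1 : D.submatrix id g₀ = 1 := by
    ext i j
    · exact (congrFun (congrFun hA1 i) j).trans (by simp only [Matrix.one_apply]; split <;> rfl)
    · exact (congrFun (congrFun hB1 i) j).trans (by simp only [Matrix.one_apply]; split <;> rfl)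
  have hfst : ∀ g : Fin r → M.E, (D.submatrix id g).det.1 = (A.submatrix id g).det := fun g =>
    RingHom.map_det (RingHom.fst F G) _
  have hsnd : ∀ g : Fin r → M.E, (D.submatrix id g).det.2 = (B.submatrix id g).det := fun g =>
    RingHom.map_det (RingHom.snd F G) _
  have hdet : ∀ g : Fin r ↪ M.E,
      (A.submatrix id g).det ≠ 0 ↔ (B.submatrix id g).det ≠ 0 := fun g =>
    (hA.isBase_iff g).symm.trans (hB.isBase_iff g)
  have hD : ∀ g : Fin r → M.E, UnitOrZero ⊤ (D.submatrix id g).det := fun g =>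
    Matrix.unitOrZero_det_of_injective _ id g fun _ hg => unitOrZero_top_prod (by
      rw [hfst, hsnd]; exact hdet ⟨g, hg⟩)
  refine isRepresentableOver_of_isRepresentedBy (isEmbedding_product F G) M
    (Matrix.isStrong_of_standard (Subgroup.mem_top _) hD1 hD) ⟨hA.ncard_eq, fun g => ?_⟩
  rw [hA.isBase_iff, Ne, Ne, Prod.ext_iff, hfst, hsnd, not_iff_not]
  exact ⟨fun h => ⟨h, not_not.1 (mt (hdet g).2 (not_not.2 h))⟩, fun h => h.1⟩

end Matroid

theorem mainTheorem3 {α : Type*} (M : Matroid α) [M.Finite] :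
    List.TFAE
      [M.IsRepresentableOver (PartialField.Product (GaloisField 2 2) (ZMod 5)),
       M.IsRepresentableOver GoldenRatioPartialField,
       M.IsRepresentableOver (ZMod 5) ∧
         (∀ (p : ℕ) [Fact p.Prime], M.IsRepresentableOver (GaloisField p 2)) ∧
         (∀ (p : ℕ) [Fact p.Prime], ((p : ℤ) ≡ 1 [ZMOD 5] ∨ (p : ℤ) ≡ -1 [ZMOD 5]) →
           M.IsRepresentableOver (ZMod p))] := by
  tfae_have 1 → 2 := Matroid.isRepresentableOver_golden_of_product
  tfae_have 2 → 3 := fun h =>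
    ⟨h.of_golden_root ⟨3, by decide⟩,
      fun p _ => h.of_golden_root (GaloisField.exists_mul_self_eq_one_add p),
      fun p _ hp => h.of_golden_root (ZMod.exists_mul_self_eq_one_add hp)⟩
  tfae_have 3 → 1 := fun h => Matroid.isRepresentableOver_product (h.2.1 2) h.1
  tfae_finish
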